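/- Let $m_1,m_2\in\mathbb N$, $m=m_1+m_2$, $r>0$, $j=\mathrm{diag}(I_{m_1},-I_{m_2})$. Let $\mathcal U^{p\times q}[0,r]$ be the class of $p\times q$ complex matrix functions $\mathcal G$ on $[0,r]$ that are differentiable with $\mathcal G'(x)=\mathcal G'(0)+\int_0^x\mathcal G''(t)\,dt$, $\mathcal G''\in L_2^{p\times q}(0,r)$, and $\mathcal U^{p}=\mathcal U^{p\times1}$. Let $\beta\in\mathcal U^{m_2\times m}[0,r]$ satisfy $\beta j\beta^*\equiv0$ and $\beta' j\beta^*\equiv \mathrm i I_{m_2}$ on $[0,r]$; write $\beta=[\beta_1\ \beta_2]$ with $\beta_2$ the $m_2\times m_2$ block. In $L_2^{m_2}(0,r)$ let $$(Af)(x)=\int_0^x(t-x)f(t)\,dt,\qquad (Kf)(x)=\mathrm i\beta(x)j\int_0^x\beta(t)^*f(t)\,dt .$$ *The operator $V$.* Put $q=-\mathrm i\beta'j\beta'^*$. Let $u$ and $Z$ solve $u'=-\tfrac12 q\,u$, $u(0)=I_{m_2}$, and $Z'=\mathrm i\beta^*\beta''jZ$, $Z(0)=I_m$, and put $$u_4=u^*\Big(\tfrac{\mathrm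 i}{2}\big(\beta''j\beta'^*-\beta'j\beta''^*\big)-\tfrac34q^2\Big)u,\quad h_1=\mathrm i\,u^*\beta''jZ,\quad h_2=Z^{-1}\big(\beta''^*-\beta'^*q+\beta^*(q^2+\mathrm i\beta'j\beta''^*)\big)u,$$ $\mathcal F(s,\eta)=h_1(s)h_2(\eta)$, $\breve{\mathcal F}(t,\eta)=\int_\eta^t\mathcal F(s,\eta)\,ds$. For $0\le\zeta\le x\le r$ let $\mathcal V=\sum_{k\ge1}\mathcal V_k$, where $$2\mathcal V_1(x,\zeta)=\int_0^{\frac{x+\zeta}2}u_4\,dt+\int_0^{\frac{x-\zeta}2}u_4\,dt-\int_{\frac{x+\zeta}2}^x\breve{\mathcal F}(t,x-t+\zeta)\,dt-\int_{\frac{x-\zeta}2}^{x-\zeta}\breve{\mathcal F}(t,x-t-\zeta)\,dt-\int_{x-\zeta}^x\breve{\mathcal F}(t,\zeta+t-x)\,dt$$ and, with $G_k(t,\eta)=\int_\eta^t u_4(s)\mathcal V_{k-1}(s,\eta)\,ds-\int_\eta^t\int_\eta^s\mathcal F(s,\tau)\mathcal V_{k-1}(\tau,\eta)\,d\tau\,ds$,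 $$2\mathcal V_k(x,\zeta)=\int_{x-\zeta}^xG_k(t,\zeta+t-x)\,dt+\int_{\frac{x+\zeta}2}^xG_k(t,\zeta+x-t)\,dt+\int_{\frac{x-\zeta}2}^{x-\zeta}G_k(t,x-t-\zeta)\,dt\quad(k>1).$$ Let $(Vf)(x)=u(x)\big(f(x)+\int_0^x\mathcal V(x,t)f(t)\,dt\big)$. *Claim.* $V$ is a bounded operator in $L_2^{m_2}(0,r)$ with a bounded inverse; $V^{-1}\beta_2$ ($V^{-1}$ applied columnwise) belongs to $\mathcal U^{m_2\times m_2}[0,r]$; with $\mathcal V_0:=(V^{-1}\beta_2)'$, the operator $V_0f=\beta_2(0)f+\int_0^x\mathcal V_0(x-t)f(t)\,dt$ is bounded with a bounded inverse; and the normalised transformation operator $E:=VV_0$ satisfies $$K=EAE^{-1},\qquad E^{-1}\beta_2\equiv I_{m_2}.$$ Moreover, $E$ and $E^{-1}$ map $\mathcal U^{m_2}[0,r]$ into $\mathcal U^{m_2}[0,r]$. -/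

import Mathlib

open MeasureTheory Set
open scoped Matrix Matrix.Norms.L2Operator

namespace CanonicalSystem

noncomputable section

/-! Matrices carry the norm of operators between Euclidean spaces (`Matrix.Norms.L2Operator`). -/

/-- `G` is differentiable on `[0, r]` (one-sided derivatives at the end points) with derivative
`G'`, and `G' x = G' 0 + ∫₀ˣ G''` on `[0, r]` with `G''` square integrable on `(0, r)`: that is,
`G` belongs to the class `𝒰[0, r]`, with first derivative `G'` and second derivative `G''`. -/
def HasU {F : Type*} [NormedAddCommGroup F] [NormedSpace ℝ F] (r : ℝ) (G G' G'' : ℝ → F) : Prop :=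
  (∀ x ∈ Icc 0 r, HasDerivWithinAt G (G' x) (Icc 0 r) x) ∧
  MemLp G'' 2 (volume.restrict (Ioo 0 r)) ∧
  ∀ x ∈ Icc 0 r, G' x = G' 0 + ∫ t in (0 : ℝ)..x, G'' t

/-- The Hilbert space `L₂^p(0, r)` of square integrable functions with values in `ℂ^p`. -/
abbrev L2 (p : ℕ) (r : ℝ) : Type :=
  Lp (EuclideanSpace ℂ (Fin p)) 2 (volume.restrict (Ioo (0 : ℝ) r))

open Classical in
/-- The element of `L₂^p(0, r)` defined by a function; it is only used for functions that are
square integrable on `(0, r)` (see `HasU.memLp`). -/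
def toL2 {p : ℕ} (r : ℝ) (f : ℝ → EuclideanSpace ℂ (Fin p)) : L2 p r :=
  if h : MemLp f 2 (volume.restrict (Ioo (0 : ℝ) r)) then h.toLp f else 0

theorem HasU.memLp {F : Type*} [NormedAddCommGroup F] [NormedSpace ℝ F] {r : ℝ}
    {G G' G'' : ℝ → F} (h : HasU r G G' G'') : MemLp G 2 (volume.restrict (Ioo 0 r)) := by
  have hc : ContinuousOn G (Icc 0 r) := fun x hx => (h.1 x hx).continuousWithinAt
  obtain ⟨C, hC⟩ := isCompact_Icc.exists_bound_of_continuousOn hc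
  refine MemLp.of_bound (C := C) ?_ ?_
  · exact (hc.mono Ioo_subset_Icc_self).aestronglyMeasurable measurableSet_Ioo
  · exact (ae_restrict_iff' measurableSet_Ioo).2
      (Filter.Eventually.of_forall fun x hx => hC x (Ioo_subset_Icc_self hx))

/-- The action of a matrix on a (column) vector of a Euclidean space. -/
def act {ι κ : Type*} [Fintype κ] (M : Matrix ι κ ℂ) (v : EuclideanSpace ℂ κ) :
    EuclideanSpace ℂ ι :=
  WithLp.toLp 2 (M *ᵥ v.ofLp)

/-- The `k`-th column of a matrix, as a vector of a Euclidean space. -/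
def colE {p : ℕ} {κ : Type*} (M : Matrix (Fin p) κ ℂ) (k : κ) : EuclideanSpace ℂ (Fin p) :=
  WithLp.toLp 2 fun i => M i k

/-- The bounded operator `T` on `L₂^p(0, r)` is given by the formula `φ`:
`(T f)(x) = φ f x` for almost every `x` in `(0, r)`, for every `f`. -/
def Represents {p : ℕ} {r : ℝ} (T : L2 p r →L[ℂ] L2 p r)
    (φ : (ℝ → EuclideanSpace ℂ (Fin p)) → ℝ → EuclideanSpace ℂ (Fin p)) : Prop :=
  ∀ f : L2 p r, ∀ᵐ x ∂(volume.restrict (Ioo (0 : ℝ) r)), T f x = φ f x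

/-- A formula determines the operator. -/
theorem Represents.unique {p : ℕ} {r : ℝ} {S T : L2 p r →L[ℂ] L2 p r}
    {φ : (ℝ → EuclideanSpace ℂ (Fin p)) → ℝ → EuclideanSpace ℂ (Fin p)}
    (hS : Represents S φ) (hT : Represents T φ) : S = T := by
  ext1 f
  apply Lp.ext
  filter_upwards [hS f, hT f] with x h1 h2
  rw [h1, h2]

/-- `T` maps `𝒰^p[0, r]` into itself. -/
def MapsU {p : ℕ} {r : ℝ} (T : L2 p r →L[ℂ] L2 p r) : Prop :=
  ∀ f f' f'' : ℝ → EuclideanSpace ℂ (Fin p), HasU r f f' f'' →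
    ∃ g g' g'' : ℝ → EuclideanSpace ℂ (Fin p), HasU r g g' g'' ∧ T (toL2 r f) = toL2 r g

/-- The iterated integrals of the Peano-Baker series of `W' = a W`, `W(0) = I`. -/
def picard {n : Type*} [Fintype n] [DecidableEq n] (a : ℝ → Matrix n n ℂ) :
    ℕ → ℝ → Matrix n n ℂ
  | 0, _ => 1
  | k + 1, x => ∫ t in (0 : ℝ)..x, a t * picard a k t

/-- The solution of `W' = a W`, `W(0) = I`, on `[0, r]` (with `a` integrable on `(0, r)`), as the
sum of its Peano-Baker series. -/
def evolution {n : Type*} [Fintype n] [DecidableEq n] (a : ℝ → Matrix n n ℂ) (x : ℝ) :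
    Matrix n n ℂ :=
  ∑' k, picard a k x

/-- The matrix `j = diag(I_{m₁}, -I_{m₂})`. -/
def jMat (m₁ m₂ : ℕ) : Matrix (Fin m₁ ⊕ Fin m₂) (Fin m₁ ⊕ Fin m₂) ℂ :=
  Matrix.fromBlocks 1 0 0 (-1)

section Construction

/-! In this section `β` is the given matrix function, `β'` and `β''` are its derivatives.
With `q = -i β' j β'^*`, the operator `K⁻¹` acts on `y` with `y(0) = y'(0) = 0` as
`-(y'' + q y' + …)`. The unitary factor `u` removes the term with `y'`, and
`u^* K⁻¹ u z = -(z'' - u₄ z + ∫₀ˣ h₁(x) h₂(t) z(t) dt)`. -/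

variable {m₁ m₂ : ℕ}

/-- `q = -i β' j β'^*`, which equals `i β'' j β^*`. -/
def qFun (β' : ℝ → Matrix (Fin m₂) (Fin m₁ ⊕ Fin m₂) ℂ) (x : ℝ) : Matrix (Fin m₂) (Fin m₂) ℂ :=
  -(Complex.I • (β' x * jMat m₁ m₂ * (β' x)ᴴ))

/-- The unitary matrix function `u` with `u' = -(1/2) q u`, `u(0) = I`. -/
def uFun (β' : ℝ → Matrix (Fin m₂) (Fin m₁ ⊕ Fin m₂) ℂ) : ℝ → Matrix (Fin m₂) (Fin m₂) ℂ :=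
  evolution fun x => -((1 / 2 : ℂ) • qFun β' x)

/-- The matrix function `Z` with `Z' = i β^* β'' j Z`, `Z(0) = I`; it yields the inverse of
`K̂ = I - i β''(x) j ∫₀ˣ β(t)^* · dt`, namely
`K̂⁻¹ = I + i β''(x) j Z(x) ∫₀ˣ Z(t)⁻¹ β(t)^* · dt`. -/
def zFun (β β'' : ℝ → Matrix (Fin m₂) (Fin m₁ ⊕ Fin m₂) ℂ) :
    ℝ → Matrix (Fin m₁ ⊕ Fin m₂) (Fin m₁ ⊕ Fin m₂) ℂ :=
  evolution fun x => Complex.I • ((β x)ᴴ * β'' x * jMat m₁ m₂)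

/-- `u₄ = u^* ((i/2) (β'' j β'^* - β' j β''^*) - (3/4) q²) u`. -/
def u4Fun (β' β'' : ℝ → Matrix (Fin m₂) (Fin m₁ ⊕ Fin m₂) ℂ) (x : ℝ) :
    Matrix (Fin m₂) (Fin m₂) ℂ :=
  (uFun β' x)ᴴ *
    ((Complex.I / 2) • (β'' x * jMat m₁ m₂ * (β' x)ᴴ - β' x * jMat m₁ m₂ * (β'' x)ᴴ)
      - (3 / 4 : ℂ) • (qFun β' x * qFun β' x)) * uFun β' x

/-- `h₁ = i u^* β'' j Z`. -/
def h1Fun (β β' β'' : ℝ → Matrix (Fin m₂) (Fin m₁ ⊕ Fin m₂) ℂ) (x : ℝ) :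
    Matrix (Fin m₂) (Fin m₁ ⊕ Fin m₂) ℂ :=
  Complex.I • ((uFun β' x)ᴴ * β'' x * jMat m₁ m₂ * zFun β β'' x)

/-- `h₂ = (Z⁻¹ β^*)'' u`, where
`(Z⁻¹ β^*)'' = Z⁻¹ (β''^* - β'^* q + β^* (q² + i β' j β''^*))`. -/
def h2Fun (β β' β'' : ℝ → Matrix (Fin m₂) (Fin m₁ ⊕ Fin m₂) ℂ) (x : ℝ) :
    Matrix (Fin m₁ ⊕ Fin m₂) (Fin m₂) ℂ :=
  (zFun β β'' x)⁻¹ *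
    ((β'' x)ᴴ - (β' x)ᴴ * qFun β' x
      + (β x)ᴴ * (qFun β' x * qFun β' x + Complex.I • (β' x * jMat m₁ m₂ * (β'' x)ᴴ))) *
    uFun β' x

/-- `ℱ(s, η) = h₁(s) h₂(η)`. -/
def calF (β β' β'' : ℝ → Matrix (Fin m₂) (Fin m₁ ⊕ Fin m₂) ℂ) (s η : ℝ) :
    Matrix (Fin m₂) (Fin m₂) ℂ :=
  h1Fun β β' β'' s * h2Fun β β' β'' η

end Construction

section Kernel

variable {p : ℕ}

/-- The first term of the series for the kernel, with `ℱ̆(t, η) = ∫_η^t ℱ(s, η) ds`. -/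
def kernelFirst (u₄ : ℝ → Matrix (Fin p) (Fin p) ℂ) (F : ℝ → ℝ → Matrix (Fin p) (Fin p) ℂ)
    (x ζ : ℝ) : Matrix (Fin p) (Fin p) ℂ :=
  let Fb : ℝ → ℝ → Matrix (Fin p) (Fin p) ℂ := fun t η => ∫ s in η..t, F s η
  (1 / 2 : ℂ) •
    ((∫ t in (0 : ℝ)..((x + ζ) / 2), u₄ t) + (∫ t in (0 : ℝ)..((x - ζ) / 2), u₄ t)
      - (∫ t in ((x + ζ) / 2)..x, Fb t (x - t + ζ))
      - (∫ t in ((x - ζ) / 2)..(x - ζ), Fb t (x - t - ζ))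
      - (∫ t in (x - ζ)..x, Fb t (ζ + t - x)))

/-- The passage from a term of the series for the kernel to the next one. -/
def kernelStep (u₄ : ℝ → Matrix (Fin p) (Fin p) ℂ) (F : ℝ → ℝ → Matrix (Fin p) (Fin p) ℂ)
    (W : ℝ → ℝ → Matrix (Fin p) (Fin p) ℂ) (x ζ : ℝ) : Matrix (Fin p) (Fin p) ℂ :=
  (1 / 2 : ℂ) •
    ((∫ t in (x - ζ)..x, ∫ s in (ζ + t - x)..t, u₄ s * W s (ζ + t - x))
      + (∫ t in ((x + ζ) / 2)..x, ∫ s in (ζ + x - t)..t, u₄ s * W s (ζ + x - t))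
      + (∫ t in ((x - ζ) / 2)..(x - ζ), ∫ s in (x - t - ζ)..t, u₄ s * W s (x - t - ζ))
      - (∫ t in (x - ζ)..x, ∫ s in (ζ + t - x)..t, ∫ η in (ζ + t - x)..s,
          F s η * W η (ζ + t - x))
      - (∫ t in ((x + ζ) / 2)..x, ∫ s in (ζ + x - t)..t, ∫ η in (ζ + x - t)..s,
          F s η * W η (ζ + x - t))
      - (∫ t in ((x - ζ) / 2)..(x - ζ), ∫ s in (x - t - ζ)..t, ∫ η in (x - t - ζ)..s,
          F s η * W η (x - t - ζ)))

/-- The terms of the series for the kernel; `kernelTerm u₄ F k` is the term `𝒱_{k+1}`. -/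
def kernelTerm (u₄ : ℝ → Matrix (Fin p) (Fin p) ℂ) (F : ℝ → ℝ → Matrix (Fin p) (Fin p) ℂ) :
    ℕ → ℝ → ℝ → Matrix (Fin p) (Fin p) ℂ
  | 0 => kernelFirst u₄ F
  | k + 1 => kernelStep u₄ F (kernelTerm u₄ F k)

end Kernel

section Operators

variable {m₁ m₂ : ℕ}

/-- The kernel `𝒱(x, ζ) = ∑ₖ 𝒱ₖ(x, ζ)`, `0 ≤ ζ ≤ x ≤ r`. -/
def calV (β β' β'' : ℝ → Matrix (Fin m₂) (Fin m₁ ⊕ Fin m₂) ℂ) (x ζ : ℝ) :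
    Matrix (Fin m₂) (Fin m₂) ℂ :=
  ∑' k, kernelTerm (u4Fun β' β'') (calF β β' β'') k x ζ

/-- `(A f)(x) = ∫₀ˣ (t - x) f(t) dt`. -/
def formulaA {p : ℕ} (f : ℝ → EuclideanSpace ℂ (Fin p)) (x : ℝ) : EuclideanSpace ℂ (Fin p) :=
  ∫ t in (0 : ℝ)..x, (t - x) • f t

/-- `(K f)(x) = i β(x) j ∫₀ˣ β(t)^* f(t) dt`. -/
def formulaK (β : ℝ → Matrix (Fin m₂) (Fin m₁ ⊕ Fin m₂) ℂ)
    (f : ℝ → EuclideanSpace ℂ (Fin m₂)) (x : ℝ) : EuclideanSpace ℂ (Fin m₂) :=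
  Complex.I • act (β x * jMat m₁ m₂) (∫ t in (0 : ℝ)..x, act (β t)ᴴ (f t))

/-- `(V f)(x) = u(x) (f(x) + ∫₀ˣ 𝒱(x, t) f(t) dt)`. -/
def formulaV (β β' β'' : ℝ → Matrix (Fin m₂) (Fin m₁ ⊕ Fin m₂) ℂ)
    (f : ℝ → EuclideanSpace ℂ (Fin m₂)) (x : ℝ) : EuclideanSpace ℂ (Fin m₂) :=
  act (uFun β' x) (f x + ∫ t in (0 : ℝ)..x, act (calV β β' β'' x t) (f t))

/-- `(V₀ f)(x) = b f(x) + ∫₀ˣ 𝒱₀(x - t) f(t) dt`. -/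
def formulaV0 {p : ℕ} (b : Matrix (Fin p) (Fin p) ℂ) (V0 : ℝ → Matrix (Fin p) (Fin p) ℂ)
    (f : ℝ → EuclideanSpace ℂ (Fin p)) (x : ℝ) : EuclideanSpace ℂ (Fin p) :=
  act b (f x) + ∫ t in (0 : ℝ)..x, act (V0 (x - t)) (f t)

/-- The last `m₂` columns `β₂` of `β = [β₁ β₂]`. -/
def block2 (β : ℝ → Matrix (Fin m₂) (Fin m₁ ⊕ Fin m₂) ℂ) (x : ℝ) : Matrix (Fin m₂) (Fin m₂) ℂ :=
  (β x).toCols₂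

/-- `V` and `V₀` are the transformation operators belonging to `β`, as boundedly invertible
operators on `L₂^{m₂}(0, r)`: `V` has the kernel constructed above, and
`V₀ = β₂(0) + ∫₀ˣ 𝒱₀(x - t) · dt`, where `𝒱₀` is the derivative of the matrix function
`Y = V⁻¹ β₂` (`V⁻¹` is applied columnwise, and `Y` is taken as an element of `𝒰`). -/
def IsTransformationPair (r : ℝ) (β β' β'' : ℝ → Matrix (Fin m₂) (Fin m₁ ⊕ Fin m₂) ℂ)
    (V V₀ : L2 m₂ r ≃L[ℂ] L2 m₂ r) : Prop :=
  Represents (V : L2 m₂ r →L[ℂ] L2 m₂ r) (formulaV β β' β'') ∧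
  ∃ Y Y' Y'' : ℝ → Matrix (Fin m₂) (Fin m₂) ℂ, HasU r Y Y' Y'' ∧
    (∀ k, V.symm (toL2 r fun x => colE (block2 β x) k) = toL2 r fun x => colE (Y x) k) ∧
    Represents (V₀ : L2 m₂ r →L[ℂ] L2 m₂ r) (formulaV0 (block2 β 0) Y')

end Operators

end

end CanonicalSystem

open CanonicalSystem

/-! On functions with `y(0) = y'(0) = 0` the operator `A` inverts `-d²/dx²`, so `K V = V A` says
that `V` carries `-d²/dx²` to `K⁻¹`. To compute `K⁻¹`, differentiate `Y = K φ = i β j ω`, where `ω =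
∫₀ˣ β^* φ`. The identities `β j β^* = 0` and `β' j β^* = i I` give `Y' = i β' j ω` and `Y'' = i β''
j ω - φ`. Hence `ω' = i β^* β'' j ω - β^* Y''`, a linear equation that is solved with `Z`; two
integrations by parts express `ω` through `Y`, `Y'` and `∫ h₂ u^* Y`. In terms of `z = u^* Y` the
choice `u' = -q u / 2` cancels the first-order term and leaves `φ = -u (z'' - u₄ z + h₁ ∫₀ˣ h₂ z)`.

It remains to turn `y''` into this expression by `z = y + ∫₀ˣ 𝒱(x, t) y(t) dt`. Formally the kernel
must solve the wave equation `𝒱_xx - 𝒱_ζζ = u₄(x) 𝒱 - h₁(x) h₂(ζ) - ∫_ζ^x h₁(x) h₂(τ) 𝒱(τ, ζ) dτ`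
with `2 d/dx 𝒱(x, x) = u₄(x)` and `𝒱_ζ(x, 0) = 0`; the given series is the Picard iteration for the
corresponding integral equation. The coefficients are only square integrable, so the kernel itself
is never differentiated. Instead the integral equation is written with the Riemann function of the
half-line (`charInt_eq_setIntegral`, `IsKernelData.kernelSum_eq`). By Fubini `∫ 𝒱 y` is then a
superposition of d'Alembert waves with data `y`, and a single wave can be differentiated twice by
hand (`IsGlobalU.waveMean_eq`, `IsGlobalU.integral_waveSum`). This gives
`IsKernelData.hasU_transform`, and with the computation of `K⁻¹` it gives
`IsTransformationKernel.intertwines`.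

The convergence of the series, the uniqueness for initial value problems and the invertibility of `1
+ Volterra` all rest on `exists_weight`: in a supremum norm with weight `exp(-L x)`, `L` large,
integration against a square integrable coefficient contracts by `1/2`.

The normalisation uses the freedom to multiply `V` from the right by an operator commuting with `A`.
With `Y = V⁻¹ β₂`, the operator `V₀ f = d/dx ∫₀ˣ Y(x - t) f(t) dt` is of convolution type, hence
commutes with `A`, and it sends the constant columns of `I` to those of `Y`; so `E = V V₀` sends `I`
to `β₂`. It is invertible because `Y(0) = β₂(0)` is (`isUnit_block2`). That inverses preserve `𝒰` is
shown by solving for the second derivative of the preimage in `L₂`, integrating twice, and invoking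
uniqueness (`IsTransformationKernel.exists_preimage`, `exists_preimage_formulaV0`). -/

namespace CanonicalSystem

noncomputable section

set_option linter.unusedSectionVars false

/-! ### Calculus of absolutely continuous functions on `[0, r]`. -/

section Primitives

variable {E F G : Type*} [NormedAddCommGroup E] [NormedSpace ℝ E]
  [NormedAddCommGroup F] [NormedSpace ℝ F] [NormedAddCommGroup G] [NormedSpace ℝ G]

theorem intervalIntegrable_of_Ioo {r a b : ℝ} {f : ℝ → E} (hf : IntegrableOn f (Ioo 0 r))
    (ha : a ∈ Icc 0 r) (hb : b ∈ Icc 0 r) : IntervalIntegrable f volume a b := by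
  have h0 : IntervalIntegrable f volume 0 r :=
    (intervalIntegrable_iff_integrableOn_Ioo_of_le (ha.1.trans ha.2)).2 hf
  refine h0.mono_set ?_
  rw [uIcc_of_le (ha.1.trans ha.2)]
  exact uIcc_subset_Icc ha hb

theorem integral_congr_of_ae_Ioo {r a b : ℝ} {f g : ℝ → E}
    (h : f =ᵐ[volume.restrict (Ioo 0 r)] g) (ha : a ∈ Icc 0 r) (hb : b ∈ Icc 0 r) :
    ∫ t in a..b, f t = ∫ t in a..b, g t := by
  refine intervalIntegral.integral_congr_ae ?_
  have h' : ∀ᵐ t ∂volume, t ∈ Ioo 0 r → f t = g t := (ae_restrict_iff' measurableSet_Ioo).1 h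
  have hr : ∀ᵐ t : ℝ ∂volume, t ≠ r := by simp [ae_iff, measure_singleton]
  filter_upwards [h', hr] with t ht htr hm
  rcases le_total a b with hab | hab
  · rw [uIoc_of_le hab] at hm
    exact ht ⟨ha.1.trans_lt hm.1, lt_of_le_of_ne (hm.2.trans hb.2) htr⟩
  · rw [uIoc_of_ge hab] at hm
    exact ht ⟨hb.1.trans_lt hm.1, lt_of_le_of_ne (hm.2.trans ha.2) htr⟩

/-- Exchange of the order of integration over a triangle. -/
theorem integral_triangle_swap {x : ℝ} (hx : 0 ≤ x) {h : ℝ × ℝ → E}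
    (hh : IntegrableOn h (Ioc 0 x ×ˢ Ioc 0 x)) :
    ∫ s in (0 : ℝ)..x, ∫ t in (0 : ℝ)..s, h (s, t) =
      ∫ t in (0 : ℝ)..x, ∫ s in t..x, h (s, t) := by
  let D : Set (ℝ × ℝ) := {p | p.2 ≤ p.1}
  have hD : MeasurableSet D := measurableSet_le measurable_snd measurable_fst
  have hk : IntegrableOn (D.indicator h) (Ioc 0 x ×ˢ Ioc 0 x) := hh.indicator hD
  rw [IntegrableOn, Measure.volume_eq_prod, ← Measure.prod_restrict] at hk
  rw [intervalIntegral.integral_of_le hx, intervalIntegral.integral_of_le hx]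
  calc ∫ s in Ioc 0 x, ∫ t in (0 : ℝ)..s, h (s, t)
      = ∫ s in Ioc 0 x, ∫ t in Ioc 0 x, D.indicator h (s, t) := by
        refine setIntegral_congr_fun measurableSet_Ioc fun s hs => ?_
        have e : (fun t => D.indicator h (s, t)) = (Iic s).indicator fun t => h (s, t) := by
          ext t; simp [D, indicator]
        simp only [e]
        rw [integral_indicator measurableSet_Iic, Measure.restrict_restrict measurableSet_Iic,
          intervalIntegral.integral_of_le hs.1.le, inter_comm, Ioc_inter_Iic, min_eq_right hs.2]
    _ = ∫ t in Ioc 0 x, ∫ s in Ioc 0 x, D.indicator h (s, t) := integral_integral_swap hk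
    _ = ∫ t in Ioc 0 x, ∫ s in t..x, h (s, t) := by
        refine setIntegral_congr_fun measurableSet_Ioc fun t ht => ?_
        have e : (fun s => D.indicator h (s, t)) = (Ici t).indicator fun s => h (s, t) := by
          ext s; simp [D, indicator]
        simp only [e]
        rw [integral_indicator measurableSet_Ici, Measure.restrict_restrict measurableSet_Ici,
          intervalIntegral.integral_of_le ht.2, ← integral_Icc_eq_integral_Ioc]
        congr 2
        ext s; simp only [mem_inter_iff, mem_Ici, mem_Ioc, mem_Icc]
        constructor
        · rintro ⟨a, b, c⟩; exact ⟨a, c⟩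
        · rintro ⟨a, c⟩; exact ⟨a, ht.1.trans_le a, c⟩

/-- `f` is integrable on `(0, r)` and `F` is a primitive of `f` on `[0, r]`. -/
def HasIntDeriv (r : ℝ) (F f : ℝ → E) : Prop :=
  IntegrableOn f (Ioo 0 r) ∧ ∀ x ∈ Icc 0 r, F x = F 0 + ∫ t in (0 : ℝ)..x, f t

namespace HasIntDeriv

variable {r : ℝ} {A a : ℝ → E} {B b : ℝ → F}

theorem congr_ae (h : HasIntDeriv r A a) {a' : ℝ → E}
    (h' : a =ᵐ[volume.restrict (Ioo 0 r)] a') : HasIntDeriv r A a' :=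
  ⟨h.1.congr h', fun x hx => by
    rw [h.2 x hx, integral_congr_of_ae_Ioo h' (left_mem_Icc.2 (hx.1.trans hx.2)) hx]⟩

theorem congr_deriv (h : HasIntDeriv r A a) {a' : ℝ → E} (h' : ∀ x ∈ Ioo 0 r, a x = a' x) :
    HasIntDeriv r A a' :=
  h.congr_ae ((ae_restrict_iff' measurableSet_Ioo).2 (Filter.Eventually.of_forall h'))

theorem congr (h : HasIntDeriv r A a) {A' : ℝ → E} (h' : ∀ x ∈ Icc 0 r, A x = A' x) :
    HasIntDeriv r A' a :=
  ⟨h.1, fun x hx => by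
    rw [← h' x hx, ← h' 0 (left_mem_Icc.2 (hx.1.trans hx.2)), h.2 x hx]⟩

theorem const (r : ℝ) (c : E) : HasIntDeriv r (fun _ => c) fun _ => 0 :=
  ⟨integrableOn_zero, fun x _ => by simp⟩

theorem of_integral (ha : IntegrableOn a (Ioo 0 r)) (c : E) :
    HasIntDeriv r (fun x => c + ∫ t in (0 : ℝ)..x, a t) a :=
  ⟨ha, fun x _ => by simp⟩

theorem intervalIntegrable (h : HasIntDeriv r A a) {x y : ℝ} (hx : x ∈ Icc 0 r)
    (hy : y ∈ Icc 0 r) : IntervalIntegrable a volume x y :=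
  intervalIntegrable_of_Ioo h.1 hx hy

theorem continuousOn (h : HasIntDeriv r A a) : ContinuousOn A (Icc 0 r) := by
  rcases le_or_gt 0 r with hr | hr
  · have h1 : ContinuousOn (fun x => A 0 + ∫ t in (0 : ℝ)..x, a t) (uIcc 0 r) := by
      refine continuousOn_const.add ?_
      refine intervalIntegral.continuousOn_primitive_interval ?_
      rw [uIcc_of_le hr, integrableOn_Icc_iff_integrableOn_Ioo]
      exact h.1
    rw [uIcc_of_le hr] at h1
    exact h1.congr h.2
  · rw [Icc_eq_empty hr.not_ge]; exact continuousOn_empty _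

theorem add {A' a' : ℝ → E} (h : HasIntDeriv r A a) (h' : HasIntDeriv r A' a') :
    HasIntDeriv r (fun x => A x + A' x) fun x => a x + a' x :=
  ⟨h.1.add h'.1, fun x hx => by
    have h0 : (0 : ℝ) ∈ Icc 0 r := left_mem_Icc.2 (hx.1.trans hx.2)
    rw [intervalIntegral.integral_add (h.intervalIntegrable h0 hx) (h'.intervalIntegrable h0 hx)]
    simp only [h.2 x hx, h'.2 x hx]
    abel⟩

theorem clm (h : HasIntDeriv r A a) [CompleteSpace E] [CompleteSpace F] (L : E →L[ℝ] F) :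
    HasIntDeriv r (fun x => L (A x)) fun x => L (a x) :=
  ⟨L.integrable_comp h.1, fun x hx => by
    have h0 : (0 : ℝ) ∈ Icc 0 r := left_mem_Icc.2 (hx.1.trans hx.2)
    rw [L.intervalIntegral_comp_comm (h.intervalIntegrable h0 hx)]
    simp only [h.2 x hx, map_add]⟩

theorem neg (h : HasIntDeriv r A a) : HasIntDeriv r (fun x => -A x) fun x => -a x :=
  ⟨h.1.neg, fun x hx => by
    rw [intervalIntegral.integral_neg]
    simp only [h.2 x hx]
    abel⟩

theorem sub {A' a' : ℝ → E} (h : HasIntDeriv r A a) (h' : HasIntDeriv r A' a') :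
    HasIntDeriv r (fun x => A x - A' x) fun x => a x - a' x := by
  simpa only [sub_eq_add_neg] using h.add h'.neg

/-- The product rule. -/
theorem bilin [CompleteSpace E] [CompleteSpace F] [CompleteSpace G]
    (hA : HasIntDeriv r A a) (hB : HasIntDeriv r B b) (T : E →L[ℝ] F →L[ℝ] G) :
    HasIntDeriv r (fun x => T (A x) (B x)) fun x => T (a x) (B x) + T (A x) (b x) := by
  have key : ∀ x ∈ Icc 0 r, IntervalIntegrable (fun t => T (a t) (B t)) volume 0 x ∧
      IntervalIntegrable (fun t => T (A t) (b t)) volume 0 x := by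
    intro x hx
    have h0 : (0 : ℝ) ∈ Icc 0 r := left_mem_Icc.2 (hx.1.trans hx.2)
    have hs : uIcc 0 x ⊆ Icc 0 r := uIcc_subset_Icc h0 hx
    constructor
    · have h1 := hA.intervalIntegrable h0 hx
      obtain ⟨C, hC⟩ := isCompact_uIcc.exists_bound_of_continuousOn (hB.continuousOn.mono hs)
      have hm : AEStronglyMeasurable B (volume.restrict (uIoc 0 x)) :=
        ((hB.continuousOn.mono hs).mono uIoc_subset_uIcc).aestronglyMeasurable measurableSet_uIoc
      rw [intervalIntegrable_iff] at h1 ⊢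
      refine (h1.norm.const_mul (‖T‖ * C)).mono' ?_ ?_
      · exact T.continuous₂.comp_aestronglyMeasurable₂ h1.1 hm
      · refine (ae_restrict_iff' measurableSet_uIoc).2 (Filter.Eventually.of_forall fun t ht => ?_)
        refine (T.le_opNorm₂ _ _).trans ?_
        have := hC t (uIoc_subset_uIcc ht)
        calc ‖T‖ * ‖a t‖ * ‖B t‖ ≤ ‖T‖ * ‖a t‖ * C := by gcongr
          _ = ‖T‖ * C * ‖a t‖ := by ring
    · have h1 := hB.intervalIntegrable h0 hx
      obtain ⟨C, hC⟩ := isCompact_uIcc.exists_bound_of_continuousOn (hA.continuousOn.mono hs)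
      have hm : AEStronglyMeasurable A (volume.restrict (uIoc 0 x)) :=
        ((hA.continuousOn.mono hs).mono uIoc_subset_uIcc).aestronglyMeasurable measurableSet_uIoc
      rw [intervalIntegrable_iff] at h1 ⊢
      refine (h1.norm.const_mul (‖T‖ * C)).mono' ?_ ?_
      · exact T.continuous₂.comp_aestronglyMeasurable₂ hm h1.1
      · refine (ae_restrict_iff' measurableSet_uIoc).2 (Filter.Eventually.of_forall fun t ht => ?_)
        refine (T.le_opNorm₂ _ _).trans ?_
        have := hC t (uIoc_subset_uIcc ht)
        gcongr
  refine ⟨?_, fun x hx => ?_⟩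
  · rcases le_or_gt 0 r with hr | hr
    · have := key r (right_mem_Icc.2 hr)
      exact (intervalIntegrable_iff_integrableOn_Ioo_of_le hr).1 (this.1.add this.2)
    · rw [Ioo_eq_empty hr.not_gt]; exact integrableOn_empty
  · have h0 : (0 : ℝ) ∈ Icc 0 r := left_mem_Icc.2 (hx.1.trans hx.2)
    have hai := hA.intervalIntegrable h0 hx
    have hbi := hB.intervalIntegrable h0 hx
    have hint : IntegrableOn (fun p : ℝ × ℝ => T (a p.1) (b p.2)) (Ioc 0 x ×ˢ Ioc 0 x) := by
      rw [IntegrableOn, Measure.volume_eq_prod, ← Measure.prod_restrict]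
      exact ((intervalIntegrable_iff_integrableOn_Ioc_of_le hx.1).1 hai).op_fst_snd
        (by fun_prop) ⟨‖T‖, T.le_opNorm₂⟩ ((intervalIntegrable_iff_integrableOn_Ioc_of_le hx.1).1 hbi)
    have hsub : ∀ t ∈ Icc 0 x, t ∈ Icc 0 r := fun t ht => ⟨ht.1, ht.2.trans hx.2⟩
    have e1 : ∀ t ∈ Icc 0 x, T (a t) (B t) = T (a t) (B 0) + ∫ s in (0 : ℝ)..t, T (a t) (b s) := by
      intro t ht
      rw [hB.2 t (hsub t ht), map_add,
        (T (a t)).intervalIntegral_comp_comm (hB.intervalIntegrable h0 (hsub t ht))]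
    have e2 : ∀ t ∈ Icc 0 x, ∫ s in t..x, T (a s) (b t) = T (A x) (b t) - T (A t) (b t) := by
      intro t ht
      have h3 := (T.flip (b t)).intervalIntegral_comp_comm (hA.intervalIntegrable (hsub t ht) hx)
      simp only [ContinuousLinearMap.flip_apply] at h3
      rw [h3, ← intervalIntegral.integral_interval_sub_left (hA.intervalIntegrable h0 hx)
        (hA.intervalIntegrable h0 (hsub t ht)), hA.2 x hx, hA.2 t (hsub t ht)]
      simp
    -- The integral of `T (a s) (b t)` over the triangle `t ≤ s` is evaluated in both orders: one
    -- yields `∫ T a B`, the other `∫ T A b`, up to boundary terms.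
    have sw := integral_triangle_swap hx.1 hint
    simp only at sw
    have i1 : IntervalIntegrable (fun t => T (a t) (B 0)) volume 0 x := by
      have := hai
      rw [intervalIntegrable_iff] at this ⊢
      exact (T.flip (B 0)).integrable_comp this
    have i2 : IntervalIntegrable (fun t => T (A x) (b t)) volume 0 x := by
      have := hbi
      rw [intervalIntegrable_iff] at this ⊢
      exact (T (A x)).integrable_comp this
    have s1 : ∫ t in (0 : ℝ)..x, T (a t) (B t) =
        (T (∫ t in (0 : ℝ)..x, a t)) (B 0) +
          ∫ t in (0 : ℝ)..x, ∫ s in (0 : ℝ)..t, T (a t) (b s) := by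
      have : ∀ t ∈ uIcc 0 x, ∫ s in (0 : ℝ)..t, T (a t) (b s) = T (a t) (B t) - T (a t) (B 0) := by
        intro t ht
        rw [uIcc_of_le hx.1] at ht
        rw [e1 t ht]; abel
      rw [intervalIntegral.integral_congr this, intervalIntegral.integral_sub (key x hx).1 i1]
      have h3 := (T.flip (B 0)).intervalIntegral_comp_comm hai
      simp only [ContinuousLinearMap.flip_apply] at h3
      rw [h3]; abel
    have s2 : ∫ t in (0 : ℝ)..x, ∫ s in t..x, T (a s) (b t) =
        T (A x) (∫ t in (0 : ℝ)..x, b t) - ∫ t in (0 : ℝ)..x, T (A t) (b t) := by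
      have : ∀ t ∈ uIcc 0 x, ∫ s in t..x, T (a s) (b t) = T (A x) (b t) - T (A t) (b t) := by
        intro t ht
        rw [uIcc_of_le hx.1] at ht
        exact e2 t ht
      rw [intervalIntegral.integral_congr this, intervalIntegral.integral_sub i2 (key x hx).2,
        (T (A x)).intervalIntegral_comp_comm hbi]
    rw [intervalIntegral.integral_add (key x hx).1 (key x hx).2, s1, sw, s2]
    have ea : ∫ t in (0 : ℝ)..x, a t = A x - A 0 := by rw [hA.2 x hx]; abel
    have eb : ∫ t in (0 : ℝ)..x, b t = B x - B 0 := by rw [hB.2 x hx]; abel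
    rw [ea, eb]
    simp only [map_sub, _root_.sub_apply]
    abel

/-- By Lebesgue's differentiation theorem both densities are almost everywhere the derivative of the
same function. This permits differentiating identities such as `β' j β^* = i I`, where `β''` exists
only as a density. -/
theorem ae_unique [CompleteSpace E] {a' : ℝ → E} (h : HasIntDeriv r A a)
    (h' : HasIntDeriv r A a') : a =ᵐ[volume.restrict (Ioo 0 r)] a' := by
  rcases le_or_gt 0 r with hr | hr
  · have h0 : (0 : ℝ) ∈ Icc 0 r := left_mem_Icc.2 hr
    have hri : r ∈ Icc 0 r := right_mem_Icc.2 hr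
    have d := (h.intervalIntegrable h0 hri).ae_hasDerivAt_integral
    have d' := (h'.intervalIntegrable h0 hri).ae_hasDerivAt_integral
    refine (ae_restrict_iff' measurableSet_Ioo).2 ?_
    rw [uIcc_of_le hr] at d d'
    filter_upwards [d, d'] with x hx hx' hm
    have hmc := Ioo_subset_Icc_self hm
    refine (hx hmc 0 h0).unique ((hx' hmc 0 h0).congr_of_eventuallyEq ?_)
    filter_upwards [Ioo_mem_nhds hm.1 hm.2] with y hy
    have h1 := h.2 y (Ioo_subset_Icc_self hy)
    rw [h'.2 y (Ioo_subset_Icc_self hy)] at h1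
    exact (add_left_cancel h1).symm
  · rw [Ioo_eq_empty hr.not_gt, Measure.restrict_empty]
    simp [Filter.EventuallyEq]

/-- The tool for most of the functional identities: compare the values at `0` and the densities. -/
theorem eq_of_ae {A' a' : ℝ → E} (h : HasIntDeriv r A a) (h' : HasIntDeriv r A' a')
    (h0 : A 0 = A' 0) (he : a =ᵐ[volume.restrict (Ioo 0 r)] a') {x : ℝ} (hx : x ∈ Icc 0 r) :
    A x = A' x := by
  rw [h.2 x hx, h'.2 x hx, h0,
    integral_congr_of_ae_Ioo he (left_mem_Icc.2 (hx.1.trans hx.2)) hx]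

theorem hasDerivWithinAt [CompleteSpace E] (h : HasIntDeriv r A a)
    (ha : ContinuousOn a (Icc 0 r)) {x : ℝ} (hx : x ∈ Icc 0 r) :
    HasDerivWithinAt A (a x) (Icc 0 r) x := by
  have h0 : (0 : ℝ) ∈ Icc 0 r := left_mem_Icc.2 (hx.1.trans hx.2)
  have : Fact (x ∈ Icc 0 r) := ⟨hx⟩
  have := intervalIntegral.integral_hasDerivWithinAt_right (s := Icc 0 r) (t := Icc 0 r)
    (h.intervalIntegrable h0 hx) (ha.stronglyMeasurableAtFilter_nhdsWithin measurableSet_Icc x)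
    (ha x hx)
  exact (this.const_add (A 0)).congr h.2 (h.2 x hx)

end HasIntDeriv

theorem memLp_integrableOn_Ioo {r : ℝ} {f : ℝ → E}
    (h : MemLp f 2 (volume.restrict (Ioo 0 r))) : IntegrableOn f (Ioo 0 r) :=
  h.integrable (by norm_num)

theorem HasU.hasIntDeriv_deriv {r : ℝ} {A A' A'' : ℝ → E} (h : HasU r A A' A'') :
    HasIntDeriv r A' A'' :=
  ⟨memLp_integrableOn_Ioo h.2.1, h.2.2⟩

theorem HasU.hasIntDeriv [CompleteSpace E] {r : ℝ} {A A' A'' : ℝ → E} (h : HasU r A A' A'') :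
    HasIntDeriv r A A' := by
  have hc := h.hasIntDeriv_deriv.continuousOn
  refine ⟨(hc.integrableOn_Icc).mono_set Ioo_subset_Icc_self, fun x hx => ?_⟩
  have hs : Icc 0 x ⊆ Icc 0 r := Icc_subset_Icc_right hx.2
  rw [intervalIntegral.integral_eq_sub_of_hasDerivAt_of_le hx.1 (f := A) (f' := A')]
  · abel
  · exact fun y hy => ((h.1 y (hs hy)).continuousWithinAt).mono hs
  · intro y hy
    exact (h.1 y (hs (Ioo_subset_Icc_self hy))).hasDerivAt
      (Icc_mem_nhds hy.1 (hy.2.trans_le hx.2))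
  · exact ((hc.mono hs).mono (uIcc_of_le hx.1).le).intervalIntegrable

theorem HasIntDeriv.hasU [CompleteSpace E] {r : ℝ} {A A' A'' : ℝ → E} (h : HasIntDeriv r A A')
    (h' : HasIntDeriv r A' A'') (h2 : MemLp A'' 2 (volume.restrict (Ioo 0 r))) :
    HasU r A A' A'' :=
  ⟨fun _ hx => h.hasDerivWithinAt h'.continuousOn hx, h2, h'.2⟩

end Primitives

/-! ### Products of square integrable and continuous functions. -/

section Bilinear

variable {E F G : Type*} [NormedAddCommGroup E] [NormedSpace ℝ E]
  [NormedAddCommGroup F] [NormedSpace ℝ F] [NormedAddCommGroup G] [NormedSpace ℝ G]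

theorem memLp_bilin_left {r : ℝ} {p : ENNReal} {f : ℝ → E} {g : ℝ → F} (T : E →L[ℝ] F →L[ℝ] G)
    (hf : MemLp f p (volume.restrict (Ioo 0 r))) (hg : ContinuousOn g (Icc 0 r)) :
    MemLp (fun x => T (f x) (g x)) p (volume.restrict (Ioo 0 r)) := by
  obtain ⟨C, hC⟩ := isCompact_Icc.exists_bound_of_continuousOn hg
  have hgm : AEStronglyMeasurable g (volume.restrict (Ioo 0 r)) :=
    (hg.mono Ioo_subset_Icc_self).aestronglyMeasurable measurableSet_Ioo
  refine hf.of_le_mul (c := ‖T‖ * C) (T.continuous₂.comp_aestronglyMeasurable₂ hf.1 hgm) ?_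
  refine (ae_restrict_iff' measurableSet_Ioo).2 (Filter.Eventually.of_forall fun t ht => ?_)
  refine (T.le_opNorm₂ _ _).trans ?_
  have := hC t (Ioo_subset_Icc_self ht)
  calc ‖T‖ * ‖f t‖ * ‖g t‖ ≤ ‖T‖ * ‖f t‖ * C := by gcongr
    _ = ‖T‖ * C * ‖f t‖ := by ring

theorem memLp_bilin_right {r : ℝ} {p : ENNReal} {f : ℝ → E} {g : ℝ → F} (T : E →L[ℝ] F →L[ℝ] G)
    (hf : ContinuousOn f (Icc 0 r)) (hg : MemLp g p (volume.restrict (Ioo 0 r))) :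
    MemLp (fun x => T (f x) (g x)) p (volume.restrict (Ioo 0 r)) :=
  memLp_bilin_left T.flip hg hf

theorem memLp_of_continuousOn {r : ℝ} {p : ENNReal} {f : ℝ → E} (hf : ContinuousOn f (Icc 0 r)) :
    MemLp f p (volume.restrict (Ioo 0 r)) := by
  obtain ⟨C, hC⟩ := isCompact_Icc.exists_bound_of_continuousOn hf
  refine MemLp.of_bound (C := C) ?_ ?_
  · exact (hf.mono Ioo_subset_Icc_self).aestronglyMeasurable measurableSet_Ioo
  · exact (ae_restrict_iff' measurableSet_Ioo).2
      (Filter.Eventually.of_forall fun x hx => hC x (Ioo_subset_Icc_self hx))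

end Bilinear

/-! ### Matrix operations as bounded linear and bilinear maps. -/

section Matrices

variable {l m n : Type*} [Fintype l] [Fintype m] [Fintype n]
  [DecidableEq l] [DecidableEq m] [DecidableEq n]

/-- Matrix multiplication as a bounded bilinear map. -/
def mulL : Matrix l m ℂ →L[ℝ] Matrix m n ℂ →L[ℝ] Matrix l n ℂ :=
  LinearMap.mkContinuous₂
    (LinearMap.mk₂ ℝ (fun (A : Matrix l m ℂ) (B : Matrix m n ℂ) => A * B) (fun _ _ _ => Matrix.add_mul _ _ _)
      (fun _ _ _ => Matrix.smul_mul _ _ _) (fun _ _ _ => Matrix.mul_add _ _ _)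
      (fun _ _ _ => Matrix.mul_smul _ _ _)) 1 fun A B => by
        rw [LinearMap.mk₂_apply, one_mul]; exact Matrix.l2_opNorm_mul A B

@[simp] theorem mulL_apply (A : Matrix l m ℂ) (B : Matrix m n ℂ) : mulL A B = A * B := rfl

theorem norm_act_le (A : Matrix l m ℂ) (v : EuclideanSpace ℂ m) : ‖act A v‖ ≤ ‖A‖ * ‖v‖ :=
  A.l2_opNorm_mulVec v

/-- The action of matrices on vectors as a bounded bilinear map. -/
def actL : Matrix l m ℂ →L[ℂ] EuclideanSpace ℂ m →L[ℂ] EuclideanSpace ℂ l :=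
  LinearMap.mkContinuous₂
    (LinearMap.mk₂ ℂ (fun (A : Matrix l m ℂ) (v : EuclideanSpace ℂ m) => act A v)
      (fun A B v => by simp [act, Matrix.add_mulVec])
      (fun c A v => by simp [act, Matrix.smul_mulVec])
      (fun A v w => by simp [act, Matrix.mulVec_add])
      (fun c A v => by simp [act, Matrix.mulVec_smul])) 1 fun A B => by
        rw [one_mul]; exact norm_act_le A B

@[simp] theorem actL_apply (A : Matrix l m ℂ) (v : EuclideanSpace ℂ m) : actL A v = act A v := rfl

/-- The action of matrices on vectors as a bounded real bilinear map. -/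
def actR : Matrix l m ℂ →L[ℝ] EuclideanSpace ℂ m →L[ℝ] EuclideanSpace ℂ l :=
  LinearMap.mkContinuous₂
    (LinearMap.mk₂ ℝ (fun (A : Matrix l m ℂ) (v : EuclideanSpace ℂ m) => act A v)
      (fun A B v => by simp [act, Matrix.add_mulVec])
      (fun c A v => by simp [act, Matrix.smul_mulVec])
      (fun A v w => by simp [act, Matrix.mulVec_add])
      (fun c A v => by simp [act, Matrix.mulVec_smul])) 1 fun A B => by
        rw [one_mul]; exact norm_act_le A B

@[simp] theorem actR_apply (A : Matrix l m ℂ) (v : EuclideanSpace ℂ m) : actR A v = act A v := rfl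

theorem act_act (A : Matrix l m ℂ) (B : Matrix m n ℂ) (v : EuclideanSpace ℂ n) :
    act A (act B v) = act (A * B) v := by
  simp [act, Matrix.mulVec_mulVec]

@[simp] theorem one_act (v : EuclideanSpace ℂ l) : act (1 : Matrix l l ℂ) v = v := by
  simp [act]

theorem add_act (A B : Matrix l m ℂ) (v : EuclideanSpace ℂ m) :
    act (A + B) v = act A v + act B v := by
  simp [act, Matrix.add_mulVec]

theorem sub_act (A B : Matrix l m ℂ) (v : EuclideanSpace ℂ m) :
    act (A - B) v = act A v - act B v := by
  simp [act, Matrix.sub_mulVec]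

theorem neg_act (A : Matrix l m ℂ) (v : EuclideanSpace ℂ m) : act (-A) v = -act A v := by
  simp [act, Matrix.neg_mulVec]

theorem smul_act (c : ℂ) (A : Matrix l m ℂ) (v : EuclideanSpace ℂ m) :
    act (c • A) v = c • act A v := by
  simp [act, Matrix.smul_mulVec]

theorem zero_act (v : EuclideanSpace ℂ m) : act (0 : Matrix l m ℂ) v = 0 := by
  simp [act]

theorem act_add (A : Matrix l m ℂ) (v w : EuclideanSpace ℂ m) :
    act A (v + w) = act A v + act A w := map_add (actR A) v w

theorem act_sub (A : Matrix l m ℂ) (v w : EuclideanSpace ℂ m) :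
    act A (v - w) = act A v - act A w := map_sub (actR A) v w

theorem act_neg (A : Matrix l m ℂ) (v : EuclideanSpace ℂ m) :
    act A (-v) = -act A v := map_neg (actR A) v

theorem act_smul (c : ℂ) (A : Matrix l m ℂ) (v : EuclideanSpace ℂ m) :
    act A (c • v) = c • act A v := map_smul (actL A) c v

theorem act_zero (A : Matrix l m ℂ) : act A (0 : EuclideanSpace ℂ m) = 0 := map_zero (actR A)

/-- The conjugate transpose as a bounded real linear map. -/
def conjTransposeR : Matrix l m ℂ →L[ℝ] Matrix m l ℂ :=
  LinearMap.mkContinuous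
    { toFun := fun A => Aᴴ
      map_add' := fun A B => Matrix.conjTranspose_add A B
      map_smul' := fun c A => by simp [Matrix.conjTranspose_smul] } 1 fun A => by
        simp [Matrix.l2_opNorm_conjTranspose]

@[simp] theorem conjTransposeR_apply (A : Matrix l m ℂ) : conjTransposeR A = Aᴴ := rfl

/-- The transpose as a bounded real linear map. -/
def transposeR : Matrix l m ℂ →L[ℝ] Matrix m l ℂ :=
  LinearMap.toContinuousLinearMap
    { toFun := fun A => Aᵀ
      map_add' := fun A B => Matrix.transpose_add A B
      map_smul' := fun c A => by simp [Matrix.transpose_smul] }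

@[simp] theorem transposeR_apply (A : Matrix l m ℂ) : transposeR A = Aᵀ := rfl

theorem HasIntDeriv.mul {r : ℝ} {A a : ℝ → Matrix l m ℂ} {B b : ℝ → Matrix m n ℂ}
    (hA : HasIntDeriv r A a) (hB : HasIntDeriv r B b) :
    HasIntDeriv r (fun x => A x * B x) fun x => a x * B x + A x * b x :=
  hA.bilin hB mulL

theorem HasIntDeriv.act {r : ℝ} {A a : ℝ → Matrix l m ℂ} {v w : ℝ → EuclideanSpace ℂ m}
    (hA : HasIntDeriv r A a) (hv : HasIntDeriv r v w) :
    HasIntDeriv r (fun x => act (A x) (v x)) fun x =>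
      CanonicalSystem.act (a x) (v x) + CanonicalSystem.act (A x) (w x) :=
  hA.bilin hv actR

theorem HasIntDeriv.conjTranspose {r : ℝ} {A a : ℝ → Matrix l m ℂ} (hA : HasIntDeriv r A a) :
    HasIntDeriv r (fun x => (A x)ᴴ) fun x => (a x)ᴴ :=
  hA.clm conjTransposeR

theorem HasIntDeriv.smul {r : ℝ} {A a : ℝ → Matrix l m ℂ} (hA : HasIntDeriv r A a) (c : ℂ) :
    HasIntDeriv r (fun x => c • A x) fun x => c • a x :=
  hA.clm ((c • ContinuousLinearMap.id ℂ (Matrix l m ℂ)).restrictScalars ℝ)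

end Matrices

/-! ### Exponential weights and Gronwall-type uniqueness. -/

section Weight

/-- A square integrable coefficient is small with respect to an exponential weight. -/
theorem exists_weight {r : ℝ} {c : ℝ → ℝ} (hc : MemLp c 2 (volume.restrict (Ioo 0 r))) {ε : ℝ}
    (hε : 0 < ε) :
    ∃ L : ℝ, 0 < L ∧ ∀ x ∈ Icc 0 r,
      ∫ s in (0 : ℝ)..x, c s * Real.exp (L * s) ≤ ε * Real.exp (L * x) := by
  have hc2 : IntegrableOn (fun s => c s ^ 2) (Ioo 0 r) := hc.integrable_sq
  set I := ∫ s in Ioo 0 r, c s ^ 2 with hI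
  have hI0 : 0 ≤ I := integral_nonneg fun s => sq_nonneg _
  -- `d` is the parameter in Young's inequality `c e ≤ (d/2) c² + e²/(2d)`, chosen so that `d I ≤
  -- ε`; the summand `1` avoids division by zero. The choice `L = 1/(d ε)` makes the second term
  -- contribute `1/(2d) · 1/(2L) = ε/4`, so that the total is at most `ε/2 + ε/4`.
  set d := ε / (I + 1) with hd
  have hdpos : 0 < d := by positivity
  have hdI : d * I ≤ ε := by
    rw [hd, div_mul_eq_mul_div, div_le_iff₀ (by positivity)]
    nlinarith
  set L := 1 / (d * ε) with hL
  have hLpos : 0 < L := by positivity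
  refine ⟨L, hLpos, fun x hx => ?_⟩
  have h0 : (0 : ℝ) ∈ Icc 0 r := left_mem_Icc.2 (hx.1.trans hx.2)
  have i2 : IntervalIntegrable (fun s => c s ^ 2) volume 0 x := intervalIntegrable_of_Ioo hc2 h0 hx
  have i1 : IntervalIntegrable (fun s => c s * Real.exp (L * s)) volume 0 x :=
    (intervalIntegrable_of_Ioo (memLp_integrableOn_Ioo hc) h0 hx).mul_continuousOn
      (by fun_prop)
  have i3 : IntervalIntegrable (fun s => Real.exp (2 * L * (s - x))) volume 0 x :=
    Continuous.intervalIntegrable (by fun_prop) _ _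
  have e3 : ∫ s in (0 : ℝ)..x, Real.exp (2 * L * (s - x)) ≤ 1 / (2 * L) := by
    have hder : ∀ s ∈ uIcc 0 x, HasDerivAt (fun s => Real.exp (2 * L * (s - x)) / (2 * L))
        (Real.exp (2 * L * (s - x))) s := by
      intro s _
      have h1 : HasDerivAt (fun s => 2 * L * (s - x)) (2 * L) s := by
        simpa using ((hasDerivAt_id s).sub_const x).const_mul (2 * L)
      have := h1.exp.div_const (2 * L)
      refine this.congr_deriv ?_
      field_simp
    rw [intervalIntegral.integral_eq_sub_of_hasDerivAt hder i3]
    have : 0 < Real.exp (2 * L * (0 - x)) / (2 * L) := by positivity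
    simp only [sub_self, mul_zero, Real.exp_zero]
    linarith
  have e2 : ∫ s in (0 : ℝ)..x, c s ^ 2 ≤ I := by
    rw [intervalIntegral.integral_of_le hx.1, hI, ← integral_Ioc_eq_integral_Ioo]
    refine setIntegral_mono_set ?_ (Filter.Eventually.of_forall fun s => sq_nonneg _)
      (Ioc_subset_Ioc_right hx.2).eventuallyLE
    rwa [integrableOn_Ioc_iff_integrableOn_Ioo]
  have hp : ∀ s ∈ Icc 0 x, c s * Real.exp (L * s) ≤
      Real.exp (L * x) * (d / 2 * c s ^ 2 + 1 / (2 * d) * Real.exp (2 * L * (s - x))) := by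
    intro s _
    have h1 : Real.exp (L * s) = Real.exp (L * x) * Real.exp (L * (s - x)) := by
      rw [← Real.exp_add]; ring_nf
    have h2 : Real.exp (2 * L * (s - x)) = Real.exp (L * (s - x)) ^ 2 := by
      rw [← Real.exp_nat_mul]; push_cast; ring_nf
    rw [h1, h2]
    set e := Real.exp (L * (s - x))
    have h3 : c s * e ≤ d / 2 * c s ^ 2 + 1 / (2 * d) * e ^ 2 := by
      have : 0 ≤ (d * c s - e) ^ 2 / (2 * d) := by positivity
      have h4 : (d * c s - e) ^ 2 / (2 * d) = d / 2 * c s ^ 2 + 1 / (2 * d) * e ^ 2 - c s * e := by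
        field_simp; ring
      linarith
    calc c s * (Real.exp (L * x) * e) = Real.exp (L * x) * (c s * e) := by ring
      _ ≤ _ := by gcongr
  have i4 : IntervalIntegrable
      (fun s => d / 2 * c s ^ 2 + 1 / (2 * d) * Real.exp (2 * L * (s - x))) volume 0 x :=
    (i2.const_mul _).add (i3.const_mul _)
  calc ∫ s in (0 : ℝ)..x, c s * Real.exp (L * s)
      ≤ ∫ s in (0 : ℝ)..x,
        Real.exp (L * x) * (d / 2 * c s ^ 2 + 1 / (2 * d) * Real.exp (2 * L * (s - x))) :=
        intervalIntegral.integral_mono_on hx.1 i1 (i4.const_mul _) hp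
    _ = Real.exp (L * x) * (d / 2 * (∫ s in (0 : ℝ)..x, c s ^ 2) +
        1 / (2 * d) * ∫ s in (0 : ℝ)..x, Real.exp (2 * L * (s - x))) := by
        rw [intervalIntegral.integral_const_mul, intervalIntegral.integral_add (i2.const_mul _)
          (i3.const_mul _), intervalIntegral.integral_const_mul,
          intervalIntegral.integral_const_mul]
    _ ≤ Real.exp (L * x) * (d / 2 * I + 1 / (2 * d) * (1 / (2 * L))) := by gcongr
    _ ≤ Real.exp (L * x) * ε := by
        gcongr
        have : 1 / (2 * d) * (1 / (2 * L)) = ε / 4 := by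
          rw [hL]; field_simp; norm_num
        rw [this]; linarith
    _ = ε * Real.exp (L * x) := mul_comm _ _

/-- A function which satisfies a homogeneous Volterra inequality vanishes. -/
theorem eq_zero_of_volterra_bound {E : Type*} [NormedAddCommGroup E] {r : ℝ} {c : ℝ → ℝ}
    (hc : MemLp c 2 (volume.restrict (Ioo 0 r))) {d : ℝ → E} (hd : ContinuousOn d (Icc 0 r))
    (H : ∀ L M : ℝ, 0 ≤ L → 0 ≤ M → (∀ s ∈ Icc 0 r, ‖d s‖ ≤ M * Real.exp (L * s)) →
      ∀ x ∈ Icc 0 r, ‖d x‖ ≤ M * ∫ s in (0 : ℝ)..x, c s * Real.exp (L * s)) :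
    ∀ x ∈ Icc 0 r, d x = 0 := by
  obtain ⟨L, hL, hw⟩ := exists_weight hc (ε := 1 / 2) (by norm_num)
  obtain ⟨C, hC⟩ := isCompact_Icc.exists_bound_of_continuousOn hd
  -- Each application of `H` followed by the weight estimate halves the constant, so `d` lies below
  -- every term of a null sequence.
  have hind : ∀ n : ℕ, ∀ s ∈ Icc 0 r, ‖d s‖ ≤ |C| * (1 / 2) ^ n * Real.exp (L * s) := by
    intro n
    induction n with
    | zero =>
      intro s hs
      have : 1 ≤ Real.exp (L * s) := Real.one_le_exp (mul_nonneg hL.le hs.1)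
      calc ‖d s‖ ≤ |C| := (hC s hs).trans (le_abs_self C)
        _ = |C| * (1 / 2) ^ 0 * 1 := by simp
        _ ≤ _ := by gcongr
    | succ n ih =>
      intro s hs
      refine (H L _ hL.le (by positivity) ih s hs).trans ?_
      calc _ ≤ |C| * (1 / 2) ^ n * (1 / 2 * Real.exp (L * s)) := by gcongr; exact hw s hs
        _ = _ := by ring
  intro x hx
  have hlim : Filter.Tendsto (fun n : ℕ => |C| * (1 / 2) ^ n * Real.exp (L * x)) Filter.atTop
      (nhds 0) := by
    have := ((tendsto_pow_atTop_nhds_zero_of_lt_one (r := (1 / 2 : ℝ)) (by norm_num)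
      (by norm_num)).const_mul |C|).mul_const (Real.exp (L * x))
    simpa using this
  have := ge_of_tendsto' hlim fun n => hind n x hx
  simpa using this

end Weight

/-! ### Linear differential systems with square integrable coefficients. -/

section Evolution

variable {n : Type*} [Fintype n] [DecidableEq n] {r : ℝ} {a : ℝ → Matrix n n ℂ}

theorem picard_hasIntDeriv (ha : MemLp a 2 (volume.restrict (Ioo 0 r))) (k : ℕ) :
    ContinuousOn (picard a k) (Icc 0 r) ∧
      HasIntDeriv r (picard a (k + 1)) fun t => a t * picard a k t := by
  have step : ∀ k, ContinuousOn (picard a k) (Icc 0 r) →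
      HasIntDeriv r (picard a (k + 1)) fun t => a t * picard a k t := by
    intro k hk
    refine ⟨memLp_integrableOn_Ioo (memLp_bilin_left mulL ha hk), fun x _ => ?_⟩
    simp [picard]
  induction k with
  | zero =>
    have : ContinuousOn (picard a 0) (Icc 0 r) := by
      have : picard a 0 = fun _ => 1 := by ext1 x; simp [picard]
      rw [this]; exact continuousOn_const
    exact ⟨this, step 0 this⟩
  | succ k ih => exact ⟨ih.2.continuousOn, step _ ih.2.continuousOn⟩

/-- In the norm with weight `exp(-L x)` each integration against `a` contracts by `1/2`, so the
series has a geometric majorant that is uniform on `[0, r]`. -/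
theorem picard_bound (ha : MemLp a 2 (volume.restrict (Ioo 0 r))) :
    ∃ C : ℝ, 0 ≤ C ∧ ∀ k, ∀ x ∈ Icc 0 r, ‖picard a k x‖ ≤ C * (1 / 2) ^ k := by
  obtain ⟨L, hL, hw⟩ := exists_weight ha.norm (ε := 1 / 2) (by norm_num)
  have hind : ∀ k : ℕ, ∀ x ∈ Icc 0 r,
      ‖picard a k x‖ ≤ ‖(1 : Matrix n n ℂ)‖ * (1 / 2) ^ k * Real.exp (L * x) := by
    intro k
    induction k with
    | zero =>
      intro x hx
      have : 1 ≤ Real.exp (L * x) := Real.one_le_exp (mul_nonneg hL.le hx.1)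
      simp only [picard, pow_zero, mul_one]
      exact le_mul_of_one_le_right (norm_nonneg _) this
    | succ k ih =>
      intro x hx
      have h0 : (0 : ℝ) ∈ Icc 0 r := left_mem_Icc.2 (hx.1.trans hx.2)
      have i1 : IntervalIntegrable (fun s => ‖a s‖ * Real.exp (L * s)) volume 0 x :=
        (intervalIntegrable_of_Ioo (memLp_integrableOn_Ioo ha.norm) h0 hx).mul_continuousOn
          (by fun_prop)
      rw [picard]
      calc ‖∫ t in (0 : ℝ)..x, a t * picard a k t‖
          ≤ ∫ t in (0 : ℝ)..x, ‖(1 : Matrix n n ℂ)‖ * (1 / 2) ^ k *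
              (‖a t‖ * Real.exp (L * t)) := by
            refine intervalIntegral.norm_integral_le_of_norm_le hx.1 ?_ (i1.const_mul _)
            refine Filter.Eventually.of_forall fun t ht => ?_
            calc ‖a t * picard a k t‖ ≤ ‖a t‖ * ‖picard a k t‖ := Matrix.l2_opNorm_mul _ _
              _ ≤ ‖a t‖ * (‖(1 : Matrix n n ℂ)‖ * (1 / 2) ^ k * Real.exp (L * t)) := by
                gcongr; exact ih t ⟨ht.1.le, ht.2.trans hx.2⟩
              _ = _ := by ring
        _ ≤ ‖(1 : Matrix n n ℂ)‖ * (1 / 2) ^ k * (1 / 2 * Real.exp (L * x)) := by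
            rw [intervalIntegral.integral_const_mul]; gcongr; exact hw x hx
        _ = _ := by ring
  refine ⟨‖(1 : Matrix n n ℂ)‖ * Real.exp (L * r), by positivity, fun k x hx => ?_⟩
  calc _ ≤ _ := hind k x hx
    _ ≤ ‖(1 : Matrix n n ℂ)‖ * (1 / 2) ^ k * Real.exp (L * r) := by gcongr; exact hx.2
    _ = _ := by ring

theorem evolution_zero : evolution a 0 = 1 := by
  rw [evolution, tsum_eq_single 0]
  · rfl
  · intro k hk
    obtain ⟨k, rfl⟩ := Nat.exists_eq_succ_of_ne_zero hk
    simp [picard]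

/-- The Peano-Baker series solves the differential equation. -/
theorem evolution_hasIntDeriv (ha : MemLp a 2 (volume.restrict (Ioo 0 r))) :
    HasIntDeriv r (evolution a) fun x => a x * evolution a x := by
  obtain ⟨C, hC0, hC⟩ := picard_bound ha
  have hs : Summable fun k : ℕ => C * (1 / 2 : ℝ) ^ k :=
    (summable_geometric_of_lt_one (by norm_num) (by norm_num)).mul_left C
  have hsx : ∀ x ∈ Icc 0 r, Summable fun k => picard a k x := fun x hx =>
    Summable.of_norm_bounded hs fun k => hC k x hx
  have hcont : ContinuousOn (evolution a) (Icc 0 r) :=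
    continuousOn_tsum (fun k => (picard_hasIntDeriv ha k).1) hs hC
  have hint : IntegrableOn (fun x => a x * evolution a x) (Ioo 0 r) :=
    memLp_integrableOn_Ioo (memLp_bilin_left mulL ha hcont)
  refine ⟨hint, fun x hx => ?_⟩
  have h0 : (0 : ℝ) ∈ Icc 0 r := left_mem_Icc.2 (hx.1.trans hx.2)
  have hx' : ∀ t ∈ uIoc 0 x, t ∈ Icc 0 r := by
    intro t ht
    rw [uIoc_of_le hx.1] at ht
    exact ⟨ht.1.le, ht.2.trans hx.2⟩
  -- Termwise integration shifts the series by one index; the majorant is `‖a t‖ C 2⁻ᵏ`.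
  have hsum : HasSum (fun k => ∫ t in (0 : ℝ)..x, a t * picard a k t)
      (∫ t in (0 : ℝ)..x, a t * evolution a t) := by
    refine intervalIntegral.hasSum_integral_of_dominated_convergence
      (fun k t => ‖a t‖ * (C * (1 / 2) ^ k)) ?_ ?_ ?_ ?_ ?_
    · intro k
      exact ((picard_hasIntDeriv ha k).2.intervalIntegrable h0 hx).aestronglyMeasurable_restrict_uIoc
    · intro k
      refine Filter.Eventually.of_forall fun t ht => ?_
      refine (Matrix.l2_opNorm_mul _ _).trans ?_
      gcongr
      exact hC k t (hx' t ht)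
    · exact Filter.Eventually.of_forall fun t _ => hs.mul_left _
    · simp_rw [tsum_mul_left]
      exact (intervalIntegrable_of_Ioo (memLp_integrableOn_Ioo ha.norm) h0 hx).mul_const _
    · refine Filter.Eventually.of_forall fun t ht => ?_
      exact (hsx t (hx' t ht)).hasSum.mul_left (a t)
  rw [evolution_zero, evolution, (hsx x hx).tsum_eq_zero_add, ← hsum.tsum_eq]
  rfl

/-- A fundamental matrix is invertible, and its inverse is absolutely continuous. -/
theorem exists_inverse_of_hasIntDeriv {W : ℝ → Matrix n n ℂ}
    (ha : MemLp a 2 (volume.restrict (Ioo 0 r)))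
    (hW : HasIntDeriv r W fun x => a x * W x) (h0 : W 0 = 1) :
    ∃ X : ℝ → Matrix n n ℂ, HasIntDeriv r X (fun x => -(X x * a x)) ∧ X 0 = 1 ∧
      ∀ x ∈ Icc 0 r, X x * W x = 1 ∧ W x * X x = 1 := by
  -- The inverse must satisfy `X' = -X a`; transposition turns this into an equation with the
  -- coefficient on the left, whose solution is again an `evolution`. Then `(X W)' = -X a W + X a W
  -- = 0`.
  let b : ℝ → Matrix n n ℂ := fun x => -(a x)ᵀ
  have hb : MemLp b 2 (volume.restrict (Ioo 0 r)) :=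
    ((transposeR (l := n) (m := n)).comp_memLp' ha).neg
  let X : ℝ → Matrix n n ℂ := fun x => (evolution b x)ᵀ
  have hX : HasIntDeriv r X fun x => -(X x * a x) := by
    have := (evolution_hasIntDeriv hb).clm transposeR
    refine this.congr_deriv fun x _ => ?_
    simp [X, b, Matrix.transpose_mul]
  have hX0 : X 0 = 1 := by simp [X, evolution_zero]
  have hXW : ∀ x ∈ Icc 0 r, X x * W x = 1 := by
    intro x hx
    have h1 := hX.mul hW
    refine h1.eq_of_ae (HasIntDeriv.const r 1) (by simp [hX0, h0]) ?_ hx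
    refine Filter.Eventually.of_forall fun t => ?_
    simp [Matrix.mul_assoc]
  exact ⟨X, hX, hX0, fun x hx => ⟨hXW x hx, mul_eq_one_comm.1 (hXW x hx)⟩⟩

end Evolution

/-! ### Integrals along characteristics and the Riemann function. -/

section Characteristics

variable {E : Type*} [NormedAddCommGroup E] [NormedSpace ℝ E]

/-- Variable limits are absorbed into the indicator of a measurable region. This supplies the joint
measurability that the later uses of Fubini's theorem need. -/
theorem stronglyMeasurable_intervalIntegral {α : Type*} [MeasurableSpace α] {f : α → ℝ → E}
    (hf : StronglyMeasurable (Function.uncurry f)) {a b : α → ℝ} (ha : Measurable a)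
    (hb : Measurable b) : StronglyMeasurable fun p => ∫ t in a p..b p, f p t := by
  have key : ∀ {a b : α → ℝ}, Measurable a → Measurable b →
      StronglyMeasurable fun p => ∫ t in Ioc (a p) (b p), f p t := by
    intro a b ha hb
    have hS : MeasurableSet {q : α × ℝ | q.2 ∈ Ioc (a q.1) (b q.1)} :=
      (measurableSet_lt (ha.comp measurable_fst) measurable_snd).inter
        (measurableSet_le measurable_snd (hb.comp measurable_fst))
    have := (hf.indicator hS).integral_prod_right' (ν := volume)
    have e : (fun p => ∫ t in Ioc (a p) (b p), f p t) = fun p =>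
        ∫ t, {q : α × ℝ | q.2 ∈ Ioc (a q.1) (b q.1)}.indicator (Function.uncurry f) (p, t) := by
      ext1 p
      rw [← integral_indicator measurableSet_Ioc]
      rfl
    rw [e]; exact this
  simp only [intervalIntegral]
  exact (key ha hb).sub (key hb ha)

/-- The sum of the integrals of `g` along the families of characteristics which occur in the
construction of the kernel. -/
def charInt (g : ℝ → ℝ → E) (x ζ : ℝ) : E :=
  (1 / 2 : ℝ) •
    ((∫ t in (x - ζ)..x, ∫ s in (ζ + t - x)..t, g s (ζ + t - x))
      + (∫ t in ((x + ζ) / 2)..x, ∫ s in (ζ + x - t)..t, g s (ζ + x - t))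
      + (∫ t in ((x - ζ) / 2)..(x - ζ), ∫ s in (x - t - ζ)..t, g s (x - t - ζ)))

/-- The position `η` of the source is made the outer variable in each of the three terms; for fixed
`η` the inner integral then runs upwards from the diagonal `s = η`. -/
theorem charInt_eq_interval (g : ℝ → ℝ → E) (x ζ : ℝ) :
    charInt g x ζ = (1 / 2 : ℝ) •
    ((∫ η in (0 : ℝ)..ζ, ∫ s in η..(x - ζ + η), g s η)
      + (∫ η in ζ..((x + ζ) / 2), ∫ s in η..(x + ζ - η), g s η)
      + (∫ η in (0 : ℝ)..((x - ζ) / 2), ∫ s in η..(x - ζ - η), g s η)) := by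
  unfold charInt
  refine congrArg _ (congrArg₂ _ (congrArg₂ _ ?_ ?_) ?_)
  · have := intervalIntegral.integral_comp_add_right (a := x - ζ) (b := x)
      (fun η => ∫ s in η..(x - ζ + η), g s η) (ζ - x)
    rw [show x - ζ + (ζ - x) = 0 by ring, show x + (ζ - x) = ζ by ring] at this
    rw [← this]
    refine intervalIntegral.integral_congr fun t _ => ?_
    rw [show t + (ζ - x) = ζ + t - x by ring, show x - ζ + (ζ + t - x) = t by ring]
  · have := intervalIntegral.integral_comp_sub_left (a := (x + ζ) / 2) (b := x)
      (fun η => ∫ s in η..(x + ζ - η), g s η) (ζ + x)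
    rw [show ζ + x - x = ζ by ring, show ζ + x - (x + ζ) / 2 = (x + ζ) / 2 by ring] at this
    rw [← this]
    refine intervalIntegral.integral_congr fun t _ => ?_
    rw [show x + ζ - (ζ + x - t) = t by ring]
  · have := intervalIntegral.integral_comp_sub_left (a := (x - ζ) / 2) (b := x - ζ)
      (fun η => ∫ s in η..(x - ζ - η), g s η) (x - ζ)
    rw [show x - ζ - (x - ζ) = 0 by ring, show x - ζ - (x - ζ) / 2 = (x - ζ) / 2 by ring] at this
    rw [← this]
    refine intervalIntegral.integral_congr fun t _ => ?_
    rw [show x - ζ - (x - ζ - t) = t by ring, show x - ζ - t = x - t - ζ by ring]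

/-- The hypothesis is stated fibrewise and only below the diagonal, so that it can be checked for
integrands given by iterated integrals without any joint measurability. The endpoint `r` is a null
set. -/
theorem charInt_congr {r : ℝ} {g g' : ℝ → ℝ → E}
    (h : ∀ᵐ η ∂(volume.restrict (Ioo 0 r)), ∀ᵐ s ∂(volume.restrict (Ioo 0 r)),
      η < s → g s η = g' s η) {x ζ : ℝ} (hζ : 0 ≤ ζ) (hζx : ζ ≤ x) (hx : x ≤ r) :
    charInt g x ζ = charInt g' x ζ := by
  have key : ∀ (a b : ℝ) (e : ℝ → ℝ), a ∈ Icc 0 r → b ∈ Icc 0 r →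
      (∀ η ∈ uIoc a b, η ≤ e η ∧ e η ≤ r ∧ 0 ≤ η) →
      ∫ η in a..b, ∫ s in η..e η, g s η = ∫ η in a..b, ∫ s in η..e η, g' s η := by
    intro a b e ha hb he
    refine intervalIntegral.integral_congr_ae ?_
    have hr : ∀ᵐ t : ℝ ∂volume, t ≠ r := by simp [ae_iff, measure_singleton]
    have h' := (ae_restrict_iff' measurableSet_Ioo).1 h
    filter_upwards [h', hr] with η hη hηr hm
    obtain ⟨h1, h2, h3⟩ := he η hm
    have h4 : 0 < η := by
      rcases le_total a b with hab | hab
      · rw [uIoc_of_le hab] at hm; exact ha.1.trans_lt hm.1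
      · rw [uIoc_of_ge hab] at hm; exact hb.1.trans_lt hm.1
    have h5 := (ae_restrict_iff' measurableSet_Ioo).1
      (hη ⟨h4, lt_of_le_of_ne (h1.trans h2) hηr⟩)
    refine intervalIntegral.integral_congr_ae ?_
    filter_upwards [h5, hr] with s hs hsr hsm
    rw [uIoc_of_le h1] at hsm
    exact hs ⟨h4.trans hsm.1, lt_of_le_of_ne (hsm.2.trans h2) hsr⟩ hsm.1
  rw [charInt_eq_interval, charInt_eq_interval]
  refine congrArg _ (congrArg₂ _ (congrArg₂ _ ?_ ?_) ?_)
  · refine key _ _ _ ⟨le_rfl, by linarith⟩ ⟨hζ, by linarith⟩ fun η hη => ?_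
    rw [uIoc_of_le hζ] at hη
    exact ⟨by linarith, by linarith [hη.2], hη.1.le⟩
  · refine key _ _ _ ⟨hζ, by linarith⟩ ⟨by linarith, by linarith⟩ fun η hη => ?_
    rw [uIoc_of_le (by linarith)] at hη
    exact ⟨by linarith [hη.2], by linarith [hη.1], by linarith [hη.1]⟩
  · refine key _ _ _ ⟨le_rfl, by linarith⟩ ⟨by linarith, by linarith⟩ fun η hη => ?_
    rw [uIoc_of_le (by linarith)] at hη
    exact ⟨by linarith [hη.2], by linarith [hη.1], by linarith [hη.1]⟩

theorem charInt_stronglyMeasurable {g : ℝ → ℝ → E}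
    (hg : StronglyMeasurable (Function.uncurry g)) :
    StronglyMeasurable (Function.uncurry (charInt g)) := by
  have inner : ∀ e : (ℝ × ℝ) × ℝ → ℝ, Measurable e →
      StronglyMeasurable fun q : (ℝ × ℝ) × ℝ => ∫ s in q.2..e q, g s q.2 := by
    intro e he
    refine stronglyMeasurable_intervalIntegral (f := fun q s => g s q.2) ?_ measurable_snd he
    exact hg.comp_measurable (g := fun z : ((ℝ × ℝ) × ℝ) × ℝ => (z.2, z.1.2)) (by fun_prop)
  have : Function.uncurry (charInt g) = fun p : ℝ × ℝ => (1 / 2 : ℝ) •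
    ((∫ η in (0 : ℝ)..p.2, ∫ s in η..(p.1 - p.2 + η), g s η)
      + (∫ η in p.2..((p.1 + p.2) / 2), ∫ s in η..(p.1 + p.2 - η), g s η)
      + (∫ η in (0 : ℝ)..((p.1 - p.2) / 2), ∫ s in η..(p.1 - p.2 - η), g s η)) := by
    ext1 p; exact charInt_eq_interval g p.1 p.2
  rw [this]
  refine StronglyMeasurable.const_smul (StronglyMeasurable.add (StronglyMeasurable.add ?_ ?_) ?_) _
  · exact stronglyMeasurable_intervalIntegral
      (f := fun (p : ℝ × ℝ) η => ∫ s in η..(p.1 - p.2 + η), g s η)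
      (inner (fun q => q.1.1 - q.1.2 + q.2) (by fun_prop)) (by fun_prop) (by fun_prop)
  · exact stronglyMeasurable_intervalIntegral
      (f := fun (p : ℝ × ℝ) η => ∫ s in η..(p.1 + p.2 - η), g s η)
      (inner (fun q => q.1.1 + q.1.2 - q.2) (by fun_prop)) (by fun_prop) (by fun_prop)
  · exact stronglyMeasurable_intervalIntegral
      (f := fun (p : ℝ × ℝ) η => ∫ s in η..(p.1 - p.2 - η), g s η)
      (inner (fun q => q.1.1 - q.1.2 - q.2) (by fun_prop)) (by fun_prop) (by fun_prop)

/-- The triangle `0 < η < s ≤ r` of points `(s, η)`. -/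
def triangle (r : ℝ) : Set (ℝ × ℝ) := {p | 0 < p.2 ∧ p.2 < p.1 ∧ p.1 ≤ r}

theorem measurableSet_triangle (r : ℝ) : MeasurableSet (triangle r) :=
  ((measurableSet_lt measurable_const measurable_snd).inter
    ((measurableSet_lt measurable_snd measurable_fst).inter
      (measurableSet_le measurable_fst measurable_const)))

theorem triangle_subset (r : ℝ) : triangle r ⊆ Ioc 0 r ×ˢ Ioc 0 r := fun _ h =>
  ⟨⟨h.1.trans h.2.1, h.2.2⟩, ⟨h.1, h.2.1.le.trans h.2.2⟩⟩

/-- The Riemann function of the wave equation with a reflecting boundary. -/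
def riemann (x ζ s η : ℝ) : ℝ :=
  1 / 2 * ((if s - η ≤ x - ζ ∧ s + η ≤ x + ζ then 1 else 0) + if s + η ≤ x - ζ then 1 else 0)

theorem riemann_nonneg (x ζ s η : ℝ) : 0 ≤ riemann x ζ s η := by
  unfold riemann; split_ifs <;> norm_num

theorem riemann_le_one (x ζ s η : ℝ) : riemann x ζ s η ≤ 1 := by
  unfold riemann; split_ifs <;> norm_num

theorem norm_riemann_le_one (x ζ s η : ℝ) : ‖riemann x ζ s η‖ ≤ 1 := by
  rw [Real.norm_of_nonneg (riemann_nonneg ..)]; exact riemann_le_one ..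

theorem riemann_eq_zero {x ζ s η : ℝ} (hη : 0 ≤ η) (hζ : 0 ≤ ζ) (h : x < s) :
    riemann x ζ s η = 0 := by
  unfold riemann
  rw [if_neg (by rintro ⟨h1, h2⟩; linarith), if_neg (by intro h1; linarith)]
  norm_num

theorem measurable_riemann {α : Type*} [MeasurableSpace α] {x ζ s η : α → ℝ} (hx : Measurable x)
    (hζ : Measurable ζ) (hs : Measurable s) (hη : Measurable η) :
    Measurable fun a => riemann (x a) (ζ a) (s a) (η a) := by
  unfold riemann
  refine Measurable.const_mul (Measurable.add ?_ ?_) _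
  · refine Measurable.ite ?_ measurable_const measurable_const
    exact (measurableSet_le (hs.sub hη) (hx.sub hζ)).inter
      (measurableSet_le (hs.add hη) (hx.add hζ))
  · exact Measurable.ite (measurableSet_le (hs.add hη) (hx.sub hζ)) measurable_const
      measurable_const

/-- Fubini's theorem for a region between the diagonal and the graph `s = e(η)`. -/
theorem setIntegral_region {g : ℝ → ℝ → E} {a b : ℝ} (hab : a ≤ b) {e : ℝ → ℝ}
    (he : Measurable e) (hle : ∀ η ∈ Ioc a b, η ≤ e η) {Q : Set (ℝ × ℝ)}
    (hQ : Q = {p | p.2 ∈ Ioc a b ∧ p.1 ∈ Ioc p.2 (e p.2)})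
    (hg : IntegrableOn (Function.uncurry g) Q) :
    ∫ p in Q, g p.1 p.2 = ∫ η in a..b, ∫ s in η..e η, g s η := by
  have hQm : MeasurableSet Q := by
    rw [hQ]
    exact (measurable_snd measurableSet_Ioc).inter
      ((measurableSet_lt measurable_snd measurable_fst).inter
        (measurableSet_le measurable_fst (he.comp measurable_snd)))
  have hi : Integrable (Q.indicator (Function.uncurry g)) (volume.prod volume) := by
    rw [← Measure.volume_eq_prod]; exact (integrable_indicator_iff hQm).2 hg
  calc ∫ p in Q, g p.1 p.2 = ∫ p, Q.indicator (Function.uncurry g) p ∂(volume.prod volume) := by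
        rw [← Measure.volume_eq_prod, integral_indicator hQm]; rfl
    _ = ∫ η, ∫ s, Q.indicator (Function.uncurry g) (s, η) := integral_prod_symm _ hi
    _ = ∫ η, (Ioc a b).indicator (fun η => ∫ s in η..e η, g s η) η := by
        congr 1
        ext1 η
        by_cases hη : η ∈ Ioc a b
        · rw [indicator_of_mem hη, intervalIntegral.integral_of_le (hle η hη),
            ← integral_indicator measurableSet_Ioc]
          congr 1
          ext1 s
          simp [hQ, indicator, Function.uncurry, hη.1, hη.2]
        · rw [indicator_of_notMem hη]
          have : (fun s => Q.indicator (Function.uncurry g) (s, η)) = fun _ => 0 := by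
            ext1 s
            rw [indicator_of_notMem]
            rw [hQ]; exact fun h => hη h.1
          rw [this, integral_zero]
    _ = ∫ η in a..b, ∫ s in η..e η, g s η := by
        rw [integral_indicator measurableSet_Ioc, intervalIntegral.integral_of_le hab]

/-- `Q₁` and `Q₂`, separated by the line `η = ζ`, make up the backward characteristic region of `(x,
ζ)`; `Q₃` is the part of it whose waves also reach `(x, ζ)` after reflection at `η = 0`. Points of
`Q₃` are counted twice, so the weight is `0`, `1/2` or `1`, which is the Riemann function. -/
theorem charInt_eq_setIntegral {r : ℝ} {g : ℝ → ℝ → E}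
    (hg : IntegrableOn (Function.uncurry g) (triangle r)) {x ζ : ℝ} (hζ : 0 ≤ ζ) (hζx : ζ ≤ x)
    (hx : x ≤ r) :
    charInt g x ζ = ∫ p in triangle r, riemann x ζ p.1 p.2 • g p.1 p.2 := by
  let Q₁ : Set (ℝ × ℝ) := {p | p.2 ∈ Ioc 0 ζ ∧ p.1 ∈ Ioc p.2 (x - ζ + p.2)}
  let Q₂ : Set (ℝ × ℝ) := {p | p.2 ∈ Ioc ζ ((x + ζ) / 2) ∧ p.1 ∈ Ioc p.2 (x + ζ - p.2)}
  let Q₃ : Set (ℝ × ℝ) := {p | p.2 ∈ Ioc 0 ((x - ζ) / 2) ∧ p.1 ∈ Ioc p.2 (x - ζ - p.2)}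
  have s1 : Q₁ ⊆ triangle r := fun p h =>
    ⟨h.1.1, h.2.1, by linarith [h.2.2, h.1.2]⟩
  have s2 : Q₂ ⊆ triangle r := fun p h =>
    ⟨by linarith [h.1.1], h.2.1, by linarith [h.2.2, h.1.1]⟩
  have s3 : Q₃ ⊆ triangle r := fun p h =>
    ⟨h.1.1, h.2.1, by linarith [h.2.2, h.1.1]⟩
  have m1 : MeasurableSet Q₁ := (measurable_snd measurableSet_Ioc).inter
      ((measurableSet_lt measurable_snd measurable_fst).inter
        (measurableSet_le measurable_fst (by fun_prop)))
  have m2 : MeasurableSet Q₂ := (measurable_snd measurableSet_Ioc).inter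
      ((measurableSet_lt measurable_snd measurable_fst).inter
        (measurableSet_le measurable_fst (by fun_prop)))
  have m3 : MeasurableSet Q₃ := (measurable_snd measurableSet_Ioc).inter
      ((measurableSet_lt measurable_snd measurable_fst).inter
        (measurableSet_le measurable_fst (by fun_prop)))
  have i1 := setIntegral_region (g := g) hζ (e := fun η => x - ζ + η) (by fun_prop)
    (fun η _ => by linarith) (Q := Q₁) rfl (hg.mono_set s1)
  have i2 := setIntegral_region (g := g) (a := ζ) (b := (x + ζ) / 2) (by linarith)
    (e := fun η => x + ζ - η) (by fun_prop) (fun η h => by linarith [h.2]) (Q := Q₂) rfl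
    (hg.mono_set s2)
  have i3 := setIntegral_region (g := g) (a := 0) (b := (x - ζ) / 2) (by linarith)
    (e := fun η => x - ζ - η) (by fun_prop) (fun η h => by linarith [h.2]) (Q := Q₃) rfl
    (hg.mono_set s3)
  rw [charInt_eq_interval, ← i1, ← i2, ← i3]
  have conv : ∀ Q : Set (ℝ × ℝ), MeasurableSet Q → Q ⊆ triangle r →
      ∫ p in Q, g p.1 p.2 = ∫ p in triangle r, Q.indicator (Function.uncurry g) p := by
    intro Q hQ hs
    rw [integral_indicator hQ, Measure.restrict_restrict hQ, inter_eq_left.2 hs]; rfl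
  rw [conv _ m1 s1, conv _ m2 s2, conv _ m3 s3,
    ← integral_add (hg.indicator m1) (hg.indicator m2),
    ← integral_add (by exact (hg.indicator m1).add (hg.indicator m2)) (hg.indicator m3),
    ← integral_smul]
  refine setIntegral_congr_fun (measurableSet_triangle r) fun p hp => ?_
  obtain ⟨h0, h1, h2⟩ := hp
  have e12 : (p ∈ Q₁ ∨ p ∈ Q₂) ↔ (p.1 - p.2 ≤ x - ζ ∧ p.1 + p.2 ≤ x + ζ) := by
    simp only [Q₁, Q₂, mem_ofPred_eq, mem_Ioc]
    constructor
    · rintro (h | h) <;> constructor <;> linarith [h.1.1, h.1.2, h.2.1, h.2.2]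
    · rintro ⟨h3, h4⟩
      rcases le_or_gt p.2 ζ with h5 | h5
      · left; exact ⟨⟨h0, h5⟩, h1, by linarith⟩
      · right; exact ⟨⟨h5, by linarith⟩, h1, by linarith⟩
  have e3 : p ∈ Q₃ ↔ p.1 + p.2 ≤ x - ζ := by
    simp only [Q₃, mem_ofPred_eq, mem_Ioc]
    constructor
    · rintro h; linarith [h.2.2]
    · intro h3; exact ⟨⟨h0, by linarith⟩, h1, by linarith⟩
  have dis : p ∈ Q₁ → p ∉ Q₂ := fun h h' => absurd h.1.2 (not_le.2 h'.1.1)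
  have hsum : Q₁.indicator (Function.uncurry g) p + Q₂.indicator (Function.uncurry g) p =
      if p.1 - p.2 ≤ x - ζ ∧ p.1 + p.2 ≤ x + ζ then g p.1 p.2 else 0 := by
    by_cases hq1 : p ∈ Q₁
    · rw [if_pos (e12.1 (Or.inl hq1)), indicator_of_mem hq1, indicator_of_notMem (dis hq1), add_zero]
      rfl
    · by_cases hq2 : p ∈ Q₂
      · rw [if_pos (e12.1 (Or.inr hq2)), indicator_of_mem hq2, indicator_of_notMem hq1, zero_add]
        rfl
      · rw [if_neg (fun h => (e12.2 h).elim hq1 hq2), indicator_of_notMem hq1,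
          indicator_of_notMem hq2, add_zero]
  have h3' : Q₃.indicator (Function.uncurry g) p = if p.1 + p.2 ≤ x - ζ then g p.1 p.2 else 0 := by
    simp only [indicator, e3]; rfl
  simp only [hsum, h3', riemann]
  split_ifs <;> simp [add_smul, mul_add]

theorem integrableOn_riemann_smul {r : ℝ} {g : ℝ → ℝ → E}
    (hg : IntegrableOn (Function.uncurry g) (triangle r)) (x ζ : ℝ) :
    IntegrableOn (fun p : ℝ × ℝ => riemann x ζ p.1 p.2 • g p.1 p.2) (triangle r) := by
  refine hg.norm.mono' ?_ (Filter.Eventually.of_forall fun p => ?_)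
  · exact (measurable_riemann measurable_const measurable_const measurable_fst
      measurable_snd).aestronglyMeasurable.smul hg.1
  · rw [norm_smul]
    exact mul_le_of_le_one_left (norm_nonneg _) (norm_riemann_le_one ..)

end Characteristics

/-- The Riemann function is at most `1` and vanishes for `s > x`, so the integral is dominated by
that of `φ(s)` over `(0, x) × (0, r)`; the factor `r` is the length of the range of `η`. -/
theorem charInt_bound {E : Type*} [NormedAddCommGroup E] [NormedSpace ℝ E] {r : ℝ}
    {g : ℝ → ℝ → E} (hg : StronglyMeasurable (Function.uncurry g)) {φ : ℝ → ℝ}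
    (hφ : IntegrableOn φ (Ioo 0 r)) (hφ0 : ∀ s, 0 ≤ φ s)
    (hb : ∀ s η, 0 < η → η < s → s ≤ r → ‖g s η‖ ≤ φ s) :
    IntegrableOn (Function.uncurry g) (triangle r) ∧
      ∀ x ζ, 0 ≤ ζ → ζ ≤ x → x ≤ r → ‖charInt g x ζ‖ ≤ r * ∫ s in (0 : ℝ)..x, φ s := by
  have hφ' : IntegrableOn φ (Ioc 0 r) := by rwa [integrableOn_Ioc_iff_integrableOn_Ioo]
  have hprod : ∀ x ≤ r, IntegrableOn (fun p : ℝ × ℝ => φ p.1) (Ioc 0 x ×ˢ Ioc 0 r) := by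
    intro x hx
    rw [IntegrableOn, Measure.volume_eq_prod, ← Measure.prod_restrict]
    exact Integrable.comp_fst (f := φ) (hφ'.mono_set (Ioc_subset_Ioc_right hx)) _
  have hφt : IntegrableOn (fun p : ℝ × ℝ => φ p.1) (triangle r) :=
    (hprod r le_rfl).mono_set (triangle_subset r)
  have hint : IntegrableOn (Function.uncurry g) (triangle r) := by
    refine hφt.mono' hg.aestronglyMeasurable ?_
    refine (ae_restrict_iff' (measurableSet_triangle r)).2 (Filter.Eventually.of_forall ?_)
    exact fun p hp => hb p.1 p.2 hp.1 hp.2.1 hp.2.2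
  refine ⟨hint, fun x ζ hζ hζx hx => ?_⟩
  have hx0 : 0 ≤ x := hζ.trans hζx
  have hr : 0 ≤ r := hx0.trans hx
  have h1 : IntegrableOn ((Iic x ×ˢ univ).indicator fun p : ℝ × ℝ => φ p.1) (triangle r) :=
    hφt.indicator (measurableSet_Iic.prod MeasurableSet.univ)
  rw [charInt_eq_setIntegral hint hζ hζx hx]
  calc ‖∫ p in triangle r, riemann x ζ p.1 p.2 • g p.1 p.2‖
      ≤ ∫ p in triangle r, (Iic x ×ˢ univ).indicator (fun p : ℝ × ℝ => φ p.1) p := by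
        refine norm_integral_le_of_norm_le h1 ?_
        refine (ae_restrict_iff' (measurableSet_triangle r)).2 (Filter.Eventually.of_forall ?_)
        intro p hp
        by_cases hpx : p.1 ≤ x
        · rw [indicator_of_mem (by exact ⟨hpx, trivial⟩), norm_smul]
          calc _ ≤ 1 * ‖g p.1 p.2‖ := by gcongr; exact norm_riemann_le_one ..
            _ ≤ φ p.1 := by rw [one_mul]; exact hb p.1 p.2 hp.1 hp.2.1 hp.2.2
        · rw [riemann_eq_zero hp.1.le hζ (not_le.1 hpx), zero_smul, norm_zero]
          exact indicator_nonneg (fun p _ => hφ0 _) _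
    _ ≤ ∫ p in Ioc 0 x ×ˢ Ioc 0 r, φ p.1 := by
        rw [integral_indicator (measurableSet_Iic.prod MeasurableSet.univ),
          Measure.restrict_restrict (measurableSet_Iic.prod MeasurableSet.univ)]
        refine setIntegral_mono_set (hprod x hx) (Filter.Eventually.of_forall fun p => hφ0 _) ?_
        refine LE.le.eventuallyLE fun p hp => ?_
        have := triangle_subset r hp.2
        exact ⟨⟨this.1.1, hp.1.1⟩, this.2⟩
    _ = r * ∫ s in (0 : ℝ)..x, φ s := by
        rw [Measure.volume_eq_prod, setIntegral_prod _ (hprod x hx)]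
        simp only [integral_const, MeasurableSet.univ, measureReal_restrict_apply, univ_inter,
          Real.volume_real_Ioc_of_le hr, sub_zero, smul_eq_mul]
        rw [integral_const_mul, intervalIntegral.integral_of_le hx0]

/-! ### Convergence of the series for the kernel, and its integral equation. -/

section Series

variable {p : ℕ} {q : Type*} [Fintype q] [DecidableEq q]
  {u₄ : ℝ → Matrix (Fin p) (Fin p) ℂ} {h₁ : ℝ → Matrix (Fin p) q ℂ}
  {h₂ : ℝ → Matrix q (Fin p) ℂ} {r : ℝ} {W W' : ℝ → ℝ → Matrix (Fin p) (Fin p) ℂ}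

/-- The data of the kernel are measurable and square integrable. -/
structure IsKernelData (r : ℝ) (u₄ : ℝ → Matrix (Fin p) (Fin p) ℂ) (h₁ : ℝ → Matrix (Fin p) q ℂ)
    (h₂ : ℝ → Matrix q (Fin p) ℂ) : Prop where
  meas_u : StronglyMeasurable u₄
  meas_h₁ : StronglyMeasurable h₁
  meas_h₂ : StronglyMeasurable h₂
  memLp_u : MemLp u₄ 2 (volume.restrict (Ioo 0 r))
  memLp_h₁ : MemLp h₁ 2 (volume.restrict (Ioo 0 r))
  memLp_h₂ : MemLp h₂ 2 (volume.restrict (Ioo 0 r))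

theorem stronglyMeasurable_mul {α l m n : Type*} [MeasurableSpace α] [Fintype l] [Fintype m]
    [Fintype n] [DecidableEq l] [DecidableEq m] [DecidableEq n] {f : α → Matrix l m ℂ}
    {g : α → Matrix m n ℂ} (hf : StronglyMeasurable f) (hg : StronglyMeasurable g) :
    StronglyMeasurable fun a => f a * g a :=
  (mulL (l := l) (m := m) (n := n)).continuous₂.comp_stronglyMeasurable (hf.prodMk hg)

/-- The composition of kernels of Volterra operators. -/
def kernelComp (h₁ : ℝ → Matrix (Fin p) q ℂ) (h₂ : ℝ → Matrix q (Fin p) ℂ)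
    (W : ℝ → ℝ → Matrix (Fin p) (Fin p) ℂ) (s η : ℝ) : Matrix (Fin p) (Fin p) ℂ :=
  ∫ τ in η..s, h₁ s * h₂ τ * W τ η

/-- The coefficient which bounds the passage from a term of the series to the next one. -/
def kernelCoeff (r : ℝ) (u₄ : ℝ → Matrix (Fin p) (Fin p) ℂ) (h₁ : ℝ → Matrix (Fin p) q ℂ)
    (h₂ : ℝ → Matrix q (Fin p) ℂ) (s : ℝ) : ℝ :=
  ‖u₄ s‖ + ‖h₁ s‖ * ∫ τ in (0 : ℝ)..r, ‖h₂ τ‖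

theorem half_smul_eq {E : Type*} [AddCommGroup E] [Module ℂ E] (v : E) :
    (1 / 2 : ℂ) • v = (1 / 2 : ℝ) • v := by
  rw [← Complex.coe_smul]; norm_num

/-- From here on the explicit limits of integration are hidden in `charInt`. -/
theorem kernelStep_eq (x ζ : ℝ) :
    kernelStep u₄ (fun s η => h₁ s * h₂ η) W x ζ =
      charInt (fun s η => u₄ s * W s η) x ζ - charInt (kernelComp h₁ h₂ W) x ζ := by
  simp only [kernelStep, charInt, kernelComp, half_smul_eq]
  rw [← smul_sub]
  congr 1
  abel

theorem kernelFirst_eq (x ζ : ℝ) :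
    kernelFirst u₄ (fun s η => h₁ s * h₂ η) x ζ =
      (1 / 2 : ℝ) • ((∫ t in (0 : ℝ)..((x + ζ) / 2), u₄ t) + ∫ t in (0 : ℝ)..((x - ζ) / 2), u₄ t)
        - charInt (fun s η => h₁ s * h₂ η) x ζ := by
  simp only [kernelFirst, charInt, half_smul_eq]
  rw [← smul_sub]
  congr 1
  have e : ∀ t, x - t + ζ = ζ + x - t := fun t => by ring
  simp only [e]
  abel

namespace IsKernelData

variable (hd : IsKernelData r u₄ h₁ h₂)

include hd

theorem meas_F : StronglyMeasurable (Function.uncurry fun s η => h₁ s * h₂ η) :=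
  stronglyMeasurable_mul (hd.meas_h₁.comp_measurable measurable_fst)
    (hd.meas_h₂.comp_measurable measurable_snd)

theorem meas_uW (hW : StronglyMeasurable (Function.uncurry W)) :
    StronglyMeasurable (Function.uncurry fun s η => u₄ s * W s η) :=
  stronglyMeasurable_mul (hd.meas_u.comp_measurable measurable_fst) hW

theorem meas_comp (hW : StronglyMeasurable (Function.uncurry W)) :
    StronglyMeasurable (Function.uncurry (kernelComp h₁ h₂ W)) := by
  refine stronglyMeasurable_intervalIntegral
    (f := fun (z : ℝ × ℝ) τ => h₁ z.1 * h₂ τ * W τ z.2) ?_ measurable_snd measurable_fst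
  refine stronglyMeasurable_mul (stronglyMeasurable_mul ?_ ?_) ?_
  · exact hd.meas_h₁.comp_measurable (g := fun z : (ℝ × ℝ) × ℝ => z.1.1) (by fun_prop)
  · exact hd.meas_h₂.comp_measurable (g := fun z : (ℝ × ℝ) × ℝ => z.2) (by fun_prop)
  · exact hW.comp_measurable (g := fun z : (ℝ × ℝ) × ℝ => (z.2, z.1.2)) (by fun_prop)

theorem meas_step (hW : StronglyMeasurable (Function.uncurry W)) :
    StronglyMeasurable (Function.uncurry (kernelStep u₄ (fun s η => h₁ s * h₂ η) W)) := by
  have e : Function.uncurry (kernelStep u₄ (fun s η => h₁ s * h₂ η) W) = fun z : ℝ × ℝ =>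
      charInt (fun s η => u₄ s * W s η) z.1 z.2 - charInt (kernelComp h₁ h₂ W) z.1 z.2 := by
    ext1 z; exact kernelStep_eq z.1 z.2
  rw [e]
  exact (charInt_stronglyMeasurable (hd.meas_uW hW)).sub
    (charInt_stronglyMeasurable (hd.meas_comp hW))

theorem meas_first :
    StronglyMeasurable (Function.uncurry (kernelFirst u₄ (fun s η => h₁ s * h₂ η))) := by
  have e : Function.uncurry (kernelFirst u₄ (fun s η => h₁ s * h₂ η)) = fun z : ℝ × ℝ =>
      (1 / 2 : ℝ) • ((∫ t in (0 : ℝ)..((z.1 + z.2) / 2), u₄ t) +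
        ∫ t in (0 : ℝ)..((z.1 - z.2) / 2), u₄ t)
        - charInt (fun s η => h₁ s * h₂ η) z.1 z.2 := by
    ext1 z; exact kernelFirst_eq z.1 z.2
  rw [e]
  have hm : StronglyMeasurable (Function.uncurry fun (_ : ℝ × ℝ) t => u₄ t) :=
    hd.meas_u.comp_measurable measurable_snd
  refine StronglyMeasurable.sub (StronglyMeasurable.fun_const_smul (StronglyMeasurable.fun_add ?_ ?_) _)
    (charInt_stronglyMeasurable hd.meas_F)
  · exact stronglyMeasurable_intervalIntegral hm (by fun_prop) (by fun_prop)
  · exact stronglyMeasurable_intervalIntegral hm (by fun_prop) (by fun_prop)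

theorem meas_term (k : ℕ) :
    StronglyMeasurable (Function.uncurry (kernelTerm u₄ (fun s η => h₁ s * h₂ η) k)) := by
  induction k with
  | zero => exact hd.meas_first
  | succ k ih => exact hd.meas_step ih

theorem memLp_coeff : MemLp (kernelCoeff r u₄ h₁ h₂) 2 (volume.restrict (Ioo 0 r)) :=
  hd.memLp_u.norm.add (hd.memLp_h₁.norm.mul_const _)

theorem integral_norm_le {a b : ℝ} (ha : 0 ≤ a) (hab : a ≤ b) (hb : b ≤ r) :
    ∫ τ in a..b, ‖h₂ τ‖ ≤ ∫ τ in (0 : ℝ)..r, ‖h₂ τ‖ := by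
  refine intervalIntegral.integral_mono_interval ha hab hb
    (Filter.Eventually.of_forall fun _ => norm_nonneg _) ?_
  exact intervalIntegrable_of_Ioo (memLp_integrableOn_Ioo hd.memLp_h₂.norm)
    ⟨le_rfl, by linarith⟩ ⟨by linarith, le_rfl⟩

theorem comp_intervalIntegrable (hW : StronglyMeasurable (Function.uncurry W)) {C : ℝ}
    (hC : ∀ s η, 0 ≤ η → η ≤ s → s ≤ r → ‖W s η‖ ≤ C) {s η : ℝ} (hη : 0 ≤ η) (hηs : η ≤ s)
    (hs : s ≤ r) : IntervalIntegrable (fun τ => h₁ s * h₂ τ * W τ η) volume η s := by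
  have h2 : IntervalIntegrable (fun τ => ‖h₂ τ‖) volume η s :=
    intervalIntegrable_of_Ioo (memLp_integrableOn_Ioo hd.memLp_h₂.norm) ⟨hη, hηs.trans hs⟩
      ⟨hη.trans hηs, hs⟩
  refine (h2.const_mul (‖h₁ s‖ * C)).mono_fun' ?_ ?_
  · refine (stronglyMeasurable_mul (stronglyMeasurable_mul stronglyMeasurable_const hd.meas_h₂)
      ?_).aestronglyMeasurable
    exact hW.comp_measurable (g := fun τ : ℝ => (τ, η)) (by fun_prop)
  · refine (ae_restrict_iff' measurableSet_uIoc).2 (Filter.Eventually.of_forall fun τ hτ => ?_)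
    rw [uIoc_of_le hηs] at hτ
    calc ‖h₁ s * h₂ τ * W τ η‖ ≤ ‖h₁ s * h₂ τ‖ * ‖W τ η‖ := Matrix.l2_opNorm_mul _ _
      _ ≤ ‖h₁ s‖ * ‖h₂ τ‖ * C := by
        gcongr
        · exact Matrix.l2_opNorm_mul _ _
        · exact hC τ η hη hτ.1.le (hτ.2.trans hs)
      _ = _ := by ring

theorem norm_comp_le {C : ℝ} {s η : ℝ} (hη : 0 ≤ η) (hηs : η ≤ s) (hs : s ≤ r) (hC0 : 0 ≤ C)
    (hC : ∀ τ, η ≤ τ → τ ≤ s → ‖W τ η‖ ≤ C) :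
    ‖kernelComp h₁ h₂ W s η‖ ≤ ‖h₁ s‖ * (∫ τ in (0 : ℝ)..r, ‖h₂ τ‖) * C := by
  have h2 : IntervalIntegrable (fun τ => ‖h₂ τ‖) volume η s :=
    intervalIntegrable_of_Ioo (memLp_integrableOn_Ioo hd.memLp_h₂.norm) ⟨hη, hηs.trans hs⟩
      ⟨hη.trans hηs, hs⟩
  calc ‖kernelComp h₁ h₂ W s η‖ ≤ ∫ τ in η..s, ‖h₁ s‖ * C * ‖h₂ τ‖ := by
        refine intervalIntegral.norm_integral_le_of_norm_le hηs ?_ (h2.const_mul _)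
        refine Filter.Eventually.of_forall fun τ hτ => ?_
        calc ‖h₁ s * h₂ τ * W τ η‖ ≤ ‖h₁ s * h₂ τ‖ * ‖W τ η‖ := Matrix.l2_opNorm_mul _ _
          _ ≤ ‖h₁ s‖ * ‖h₂ τ‖ * C := by
            gcongr
            · exact Matrix.l2_opNorm_mul _ _
            · exact hC τ hτ.1.le hτ.2
          _ = _ := by ring
    _ = ‖h₁ s‖ * C * ∫ τ in η..s, ‖h₂ τ‖ := by rw [intervalIntegral.integral_const_mul]
    _ ≤ ‖h₁ s‖ * C * ∫ τ in (0 : ℝ)..r, ‖h₂ τ‖ := by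
        gcongr; exact hd.integral_norm_le hη hηs hs
    _ = _ := by ring

/-- The estimate has the form required by `exists_weight`: a kernel below `M exp(L s)` is sent below
`M` times the integral of an `L₂` coefficient against `exp(L s)`. The multiplication term and the
composition term contribute the two summands of `kernelCoeff`. -/
theorem step_bound (hW : StronglyMeasurable (Function.uncurry W)) {L M : ℝ} (hL : 0 ≤ L)
    (hM : 0 ≤ M) (hb : ∀ s η, 0 ≤ η → η ≤ s → s ≤ r → ‖W s η‖ ≤ M * Real.exp (L * s)) :
    IntegrableOn (Function.uncurry fun s η => u₄ s * W s η) (triangle r) ∧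
    IntegrableOn (Function.uncurry (kernelComp h₁ h₂ W)) (triangle r) ∧
    ∀ x ζ, 0 ≤ ζ → ζ ≤ x → x ≤ r → ‖kernelStep u₄ (fun s η => h₁ s * h₂ η) W x ζ‖ ≤
      M * ∫ s in (0 : ℝ)..x, r * kernelCoeff r u₄ h₁ h₂ s * Real.exp (L * s) := by
  rcases le_or_gt 0 r with hr | hr
  swap
  · have ht : triangle r = ∅ := by
      ext z; simp only [triangle, mem_ofPred_eq, mem_empty_iff_false, iff_false]
      rintro ⟨h1, h2, h3⟩; linarith
    rw [ht]
    exact ⟨integrableOn_empty, integrableOn_empty, fun x ζ h1 h2 h3 => by linarith⟩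
  set H := ∫ τ in (0 : ℝ)..r, ‖h₂ τ‖ with hH
  have hH0 : 0 ≤ H := intervalIntegral.integral_nonneg hr fun _ _ => norm_nonneg _
  have ii : ∀ {f : ℝ → ℝ}, IntegrableOn f (Ioo 0 r) →
      IntegrableOn (fun s => f s * (M * Real.exp (L * s))) (Ioo 0 r) := by
    intro f hf
    have := (intervalIntegrable_of_Ioo hf (left_mem_Icc.2 hr)
      (right_mem_Icc.2 hr)).mul_continuousOn (g := fun s => M * Real.exp (L * s)) (by fun_prop)
    exact (intervalIntegrable_iff_integrableOn_Ioo_of_le hr).1 this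
  have iu := ii (memLp_integrableOn_Ioo hd.memLp_u.norm)
  have ih := ii ((memLp_integrableOn_Ioo hd.memLp_h₁.norm).mul_const H)
  have b1 := charInt_bound (hd.meas_uW hW) iu (fun s => by positivity) (by
    intro s η h1 h2 h3
    refine (Matrix.l2_opNorm_mul _ _).trans ?_
    gcongr
    exact hb s η h1.le h2.le h3)
  have b2 := charInt_bound (hd.meas_comp hW) ih (fun s => by positivity) (by
    intro s η h1 h2 h3
    refine hd.norm_comp_le h1.le h2.le h3 (by positivity) fun τ h4 h5 => ?_
    refine (hb τ η h1.le h4 (h5.trans h3)).trans ?_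
    gcongr)
  refine ⟨b1.1, b2.1, fun x ζ hζ hζx hx => ?_⟩
  have h0 : (0 : ℝ) ∈ Icc 0 r := left_mem_Icc.2 hr
  have hxr : x ∈ Icc 0 r := ⟨hζ.trans hζx, hx⟩
  rw [kernelStep_eq]
  calc _ ≤ _ := norm_sub_le _ _
    _ ≤ _ := add_le_add (b1.2 x ζ hζ hζx hx) (b2.2 x ζ hζ hζx hx)
    _ = _ := by
      rw [← mul_add, ← intervalIntegral.integral_add (intervalIntegrable_of_Ioo iu h0 hxr)
        (intervalIntegrable_of_Ioo ih h0 hxr), ← intervalIntegral.integral_const_mul,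
        ← intervalIntegral.integral_const_mul]
      refine intervalIntegral.integral_congr fun s _ => ?_
      simp only [kernelCoeff, ← hH]
      ring

/-- Linearity of the step requires convergence of all the integrals involved, whence the
measurability and the bounds on both kernels. -/
theorem step_sub (hW : StronglyMeasurable (Function.uncurry W))
    (hW' : StronglyMeasurable (Function.uncurry W')) {C C' : ℝ}
    (hC : ∀ s η, 0 ≤ η → η ≤ s → s ≤ r → ‖W s η‖ ≤ C)
    (hC' : ∀ s η, 0 ≤ η → η ≤ s → s ≤ r → ‖W' s η‖ ≤ C') {x ζ : ℝ} (hζ : 0 ≤ ζ) (hζx : ζ ≤ x)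
    (hx : x ≤ r) :
    kernelStep u₄ (fun s η => h₁ s * h₂ η) (fun s η => W s η - W' s η) x ζ =
      kernelStep u₄ (fun s η => h₁ s * h₂ η) W x ζ -
        kernelStep u₄ (fun s η => h₁ s * h₂ η) W' x ζ := by
  have hb := hd.step_bound hW (L := 0) (M := |C|) le_rfl (abs_nonneg _) (by
    intro s η h1 h2 h3
    simpa using (hC s η h1 h2 h3).trans (le_abs_self C))
  have hb' := hd.step_bound hW' (L := 0) (M := |C'|) le_rfl (abs_nonneg _) (by
    intro s η h1 h2 h3
    simpa using (hC' s η h1 h2 h3).trans (le_abs_self C'))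
  have hsub : ∀ {g g' : ℝ → ℝ → Matrix (Fin p) (Fin p) ℂ},
      IntegrableOn (Function.uncurry g) (triangle r) →
      IntegrableOn (Function.uncurry g') (triangle r) →
      charInt (fun s η => g s η - g' s η) x ζ = charInt g x ζ - charInt g' x ζ := by
    intro g g' hg hg'
    rw [charInt_eq_setIntegral hg hζ hζx hx, charInt_eq_setIntegral hg' hζ hζx hx,
      charInt_eq_setIntegral (by exact hg.sub hg') hζ hζx hx,
      ← integral_sub (integrableOn_riemann_smul hg x ζ) (integrableOn_riemann_smul hg' x ζ)]
    simp only [smul_sub]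
  rw [kernelStep_eq, kernelStep_eq, kernelStep_eq]
  have e1 : charInt (fun s η => u₄ s * (W s η - W' s η)) x ζ =
      charInt (fun s η => u₄ s * W s η) x ζ - charInt (fun s η => u₄ s * W' s η) x ζ := by
    rw [← hsub hb.1 hb'.1]
    simp only [mul_sub]
  have e2 : charInt (kernelComp h₁ h₂ fun s η => W s η - W' s η) x ζ =
      charInt (kernelComp h₁ h₂ W) x ζ - charInt (kernelComp h₁ h₂ W') x ζ := by
    rw [← hsub hb.2.1 hb'.2.1]
    refine charInt_congr (r := r) ?_ hζ hζx hx
    refine (ae_restrict_iff' measurableSet_Ioo).2 (Filter.Eventually.of_forall fun η hη => ?_)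
    refine (ae_restrict_iff' measurableSet_Ioo).2 (Filter.Eventually.of_forall fun s hs hηs => ?_)
    simp only [kernelComp]
    rw [← intervalIntegral.integral_sub
      (hd.comp_intervalIntegrable hW hC hη.1.le hηs.le hs.2.le)
      (hd.comp_intervalIntegrable hW' hC' hη.1.le hηs.le hs.2.le)]
    simp only [mul_sub]
  rw [e1, e2]
  abel

theorem integrableOn_F : IntegrableOn (Function.uncurry fun s η => h₁ s * h₂ η) (triangle r) := by
  have i1 := memLp_integrableOn_Ioo hd.memLp_h₁
  have i2 := memLp_integrableOn_Ioo hd.memLp_h₂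
  rw [← integrableOn_Ioc_iff_integrableOn_Ioo] at i1 i2
  have : IntegrableOn (Function.uncurry fun s η => h₁ s * h₂ η) (Ioc 0 r ×ˢ Ioc 0 r) := by
    rw [IntegrableOn, Measure.volume_eq_prod, ← Measure.prod_restrict]
    exact i1.op_fst_snd (mulL (l := Fin p) (m := q) (n := Fin p)).continuous₂
      ⟨1, fun A B => by simpa using Matrix.l2_opNorm_mul A B⟩ i2
  exact this.mono_set (triangle_subset r)

/-- On the diagonal, twice the Riemann function is the sum of the indicators of `s ≤ (x + ζ)/2` and
`s ≤ (x - ζ)/2`. Thus `u₄` acts as a source concentrated on the diagonal. -/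
theorem first_eq {x ζ : ℝ} (hζ : 0 ≤ ζ) (hζx : ζ ≤ x) (hx : x ≤ r) :
    kernelFirst u₄ (fun s η => h₁ s * h₂ η) x ζ =
      (∫ s in Ioc 0 r, riemann x ζ s s • u₄ s) -
        ∫ z in triangle r, riemann x ζ z.1 z.2 • (h₁ z.1 * h₂ z.2) := by
  rw [kernelFirst_eq, charInt_eq_setIntegral hd.integrableOn_F hζ hζx hx]
  congr 1
  have iu : IntegrableOn u₄ (Ioc 0 r) := by
    rw [integrableOn_Ioc_iff_integrableOn_Ioo]; exact memLp_integrableOn_Ioo hd.memLp_u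
  have conv : ∀ b, 0 ≤ b → b ≤ r → ∫ t in (0 : ℝ)..b, u₄ t = ∫ s in Ioc 0 r, (Iic b).indicator u₄ s := by
    intro b hb hbr
    rw [integral_indicator measurableSet_Iic, Measure.restrict_restrict measurableSet_Iic,
      inter_comm, Ioc_inter_Iic, min_eq_right hbr, intervalIntegral.integral_of_le hb]
  rw [conv _ (by linarith) (by linarith), conv _ (by linarith) (by linarith),
    ← integral_add (iu.indicator measurableSet_Iic) (iu.indicator measurableSet_Iic),
    ← integral_smul]
  refine setIntegral_congr_fun measurableSet_Ioc fun s hs => ?_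
  have c1 : (s - s ≤ x - ζ ∧ s + s ≤ x + ζ) ↔ s ≤ (x + ζ) / 2 :=
    ⟨fun h => by linarith [h.2], fun h => ⟨by linarith, by linarith⟩⟩
  have c2 : s + s ≤ x - ζ ↔ s ≤ (x - ζ) / 2 := ⟨fun h => by linarith, fun h => by linarith⟩
  simp only [riemann, c1, c2, indicator, mem_Iic]
  split_ifs <;> simp [add_smul, mul_add]

theorem first_bound : ∃ C, 0 ≤ C ∧ ∀ x ζ, 0 ≤ ζ → ζ ≤ x → x ≤ r →
    ‖kernelFirst u₄ (fun s η => h₁ s * h₂ η) x ζ‖ ≤ C := by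
  have iu : IntegrableOn u₄ (Ioc 0 r) := by
    rw [integrableOn_Ioc_iff_integrableOn_Ioo]; exact memLp_integrableOn_Ioo hd.memLp_u
  refine ⟨(∫ s in Ioc 0 r, ‖u₄ s‖) + ∫ z in triangle r, ‖h₁ z.1 * h₂ z.2‖, by positivity,
    fun x ζ hζ hζx hx => ?_⟩
  rw [hd.first_eq hζ hζx hx]
  refine (norm_sub_le _ _).trans (add_le_add ?_ ?_)
  · refine norm_integral_le_of_norm_le iu.norm (Filter.Eventually.of_forall fun s => ?_)
    rw [norm_smul]
    exact mul_le_of_le_one_left (norm_nonneg _) (norm_riemann_le_one ..)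
  · refine norm_integral_le_of_norm_le hd.integrableOn_F.norm (Filter.Eventually.of_forall fun s => ?_)
    rw [norm_smul]
    exact mul_le_of_le_one_left (norm_nonneg _) (norm_riemann_le_one ..)

/-- The first term is bounded, and in the norm with weight `exp(-L x)` every further step contracts
by `1/2`. -/
theorem term_bound : ∃ C, 0 ≤ C ∧ ∀ k x ζ, 0 ≤ ζ → ζ ≤ x → x ≤ r →
    ‖kernelTerm u₄ (fun s η => h₁ s * h₂ η) k x ζ‖ ≤ C * (1 / 2) ^ k := by
  obtain ⟨C, hC0, hC⟩ := hd.first_bound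
  obtain ⟨L, hL, hw⟩ := exists_weight (hd.memLp_coeff.const_mul r) (ε := 1 / 2) (by norm_num)
  have hind : ∀ k x ζ, 0 ≤ ζ → ζ ≤ x → x ≤ r →
      ‖kernelTerm u₄ (fun s η => h₁ s * h₂ η) k x ζ‖ ≤ C * (1 / 2) ^ k * Real.exp (L * x) := by
    intro k
    induction k with
    | zero =>
      intro x ζ hζ hζx hx
      have : 1 ≤ Real.exp (L * x) := Real.one_le_exp (mul_nonneg hL.le (hζ.trans hζx))
      calc _ ≤ C := hC x ζ hζ hζx hx
        _ ≤ C * (1 / 2) ^ 0 * Real.exp (L * x) := by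
          rw [pow_zero, mul_one]; exact le_mul_of_one_le_right hC0 this
    | succ k ih =>
      intro x ζ hζ hζx hx
      refine ((hd.step_bound (hd.meas_term k) hL.le (by positivity) ih).2.2 x ζ hζ hζx hx).trans ?_
      calc _ ≤ C * (1 / 2) ^ k * (1 / 2 * Real.exp (L * x)) := by
            gcongr; exact hw x ⟨hζ.trans hζx, hx⟩
        _ = _ := by ring
  refine ⟨C * Real.exp (L * r), by positivity, fun k x ζ hζ hζx hx => ?_⟩
  calc _ ≤ _ := hind k x ζ hζ hζx hx
    _ ≤ C * (1 / 2) ^ k * Real.exp (L * r) := by gcongr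
    _ = _ := by ring

end IsKernelData

open Classical in
/-- The sum of the series for the kernel, restricted to the triangle `0 ≤ ζ ≤ x ≤ r`. -/
def kernelSum (r : ℝ) (u₄ : ℝ → Matrix (Fin p) (Fin p) ℂ) (h₁ : ℝ → Matrix (Fin p) q ℂ)
    (h₂ : ℝ → Matrix q (Fin p) ℂ) (x ζ : ℝ) : Matrix (Fin p) (Fin p) ℂ :=
  if 0 ≤ ζ ∧ ζ ≤ x ∧ x ≤ r then ∑' k, kernelTerm u₄ (fun s η => h₁ s * h₂ η) k x ζ else 0

theorem kernelSum_of_mem {x ζ : ℝ} (hζ : 0 ≤ ζ) (hζx : ζ ≤ x) (hx : x ≤ r) :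
    kernelSum r u₄ h₁ h₂ x ζ = ∑' k, kernelTerm u₄ (fun s η => h₁ s * h₂ η) k x ζ :=
  if_pos ⟨hζ, hζx, hx⟩

namespace IsKernelData

variable (hd : IsKernelData r u₄ h₁ h₂)

include hd

theorem hasSum_kernelSum {x ζ : ℝ} (hζ : 0 ≤ ζ) (hζx : ζ ≤ x) (hx : x ≤ r) :
    HasSum (fun k => kernelTerm u₄ (fun s η => h₁ s * h₂ η) k x ζ) (kernelSum r u₄ h₁ h₂ x ζ) := by
  obtain ⟨C, -, hC⟩ := hd.term_bound
  rw [kernelSum_of_mem hζ hζx hx]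
  refine Summable.hasSum (Summable.of_norm_bounded ?_ fun k => hC k x ζ hζ hζx hx)
  exact (summable_geometric_of_lt_one (by norm_num) (by norm_num)).mul_left C

theorem kernelSum_bound : ∃ C, 0 ≤ C ∧ ∀ x ζ, ‖kernelSum r u₄ h₁ h₂ x ζ‖ ≤ C := by
  obtain ⟨C, hC0, hC⟩ := hd.term_bound
  refine ⟨C * 2, by positivity, fun x ζ => ?_⟩
  by_cases h : 0 ≤ ζ ∧ ζ ≤ x ∧ x ≤ r
  · obtain ⟨hζ, hζx, hx⟩ := h
    rw [kernelSum_of_mem hζ hζx hx]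
    exact tsum_of_norm_bounded (hasSum_geometric_two.mul_left C) fun k => hC k x ζ hζ hζx hx
  · rw [kernelSum, if_neg h, norm_zero]; positivity

theorem kernelSum_sub_bound : ∃ C, 0 ≤ C ∧ ∀ n x ζ, 0 ≤ ζ → ζ ≤ x → x ≤ r →
    ‖kernelSum r u₄ h₁ h₂ x ζ -
      ∑ k ∈ Finset.range n, kernelTerm u₄ (fun s η => h₁ s * h₂ η) k x ζ‖ ≤ C * (1 / 2) ^ n := by
  obtain ⟨C, hC0, hC⟩ := hd.term_bound
  refine ⟨C * 2, by positivity, fun n x ζ hζ hζx hx => ?_⟩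
  have hs := hd.hasSum_kernelSum hζ hζx hx
  rw [← hs.tsum_eq, ← hs.summable.sum_add_tsum_nat_add n, add_sub_cancel_left]
  have := hasSum_geometric_two.mul_left (C * (1 / 2) ^ n)
  refine (tsum_of_norm_bounded this fun k => ?_).trans_eq (by ring)
  refine (hC (k + n) x ζ hζ hζx hx).trans_eq ?_
  rw [pow_add]; ring

theorem meas_kernelSum : StronglyMeasurable (Function.uncurry (kernelSum r u₄ h₁ h₂)) := by
  classical
  let T : Set (ℝ × ℝ) := {z | 0 ≤ z.2 ∧ z.2 ≤ z.1 ∧ z.1 ≤ r}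
  have hT : MeasurableSet T :=
    ((measurableSet_le measurable_const measurable_snd).inter
      ((measurableSet_le measurable_snd measurable_fst).inter
        (measurableSet_le measurable_fst measurable_const)))
  refine stronglyMeasurable_of_tendsto (u := Filter.atTop) (f := fun n : ℕ =>
    T.indicator fun z : ℝ × ℝ => ∑ k ∈ Finset.range n,
      kernelTerm u₄ (fun s η => h₁ s * h₂ η) k z.1 z.2) ?_ ?_
  · intro n
    refine StronglyMeasurable.indicator ?_ hT
    exact Finset.stronglyMeasurable_fun_sum _ fun k _ => hd.meas_term k
  · rw [tendsto_pi_nhds]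
    rintro ⟨x, ζ⟩
    by_cases h : 0 ≤ ζ ∧ ζ ≤ x ∧ x ≤ r
    · have hm : (x, ζ) ∈ T := h
      simp only [indicator_of_mem hm]
      exact (hd.hasSum_kernelSum h.1 h.2.1 h.2.2).tendsto_sum_nat
    · have hm : (x, ζ) ∉ T := h
      simp only [indicator_of_notMem hm, Function.uncurry, kernelSum, if_neg h]
      exact tendsto_const_nhds

/-- The sum of the series satisfies the integral equation for the kernel. -/
theorem kernelSum_step {x ζ : ℝ} (hζ : 0 ≤ ζ) (hζx : ζ ≤ x) (hx : x ≤ r) :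
    kernelSum r u₄ h₁ h₂ x ζ = kernelFirst u₄ (fun s η => h₁ s * h₂ η) x ζ +
      kernelStep u₄ (fun s η => h₁ s * h₂ η) (kernelSum r u₄ h₁ h₂) x ζ := by
  let S : ℕ → ℝ → ℝ → Matrix (Fin p) (Fin p) ℂ := fun n x ζ =>
    ∑ k ∈ Finset.range n, kernelTerm u₄ (fun s η => h₁ s * h₂ η) k x ζ
  have hSm : ∀ n, StronglyMeasurable (Function.uncurry (S n)) := fun n =>
    Finset.stronglyMeasurable_fun_sum _ fun k _ => hd.meas_term k
  obtain ⟨C, hC0, hC⟩ := hd.kernelSum_bound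
  obtain ⟨D, hD0, hD⟩ := hd.kernelSum_sub_bound
  have hSb : ∀ n s η, 0 ≤ η → η ≤ s → s ≤ r → ‖S n s η‖ ≤ C + D * (1 / 2) ^ n := by
    intro n s η h1 h2 h3
    have : S n s η = kernelSum r u₄ h₁ h₂ s η - (kernelSum r u₄ h₁ h₂ s η - S n s η) := by abel
    rw [this]
    exact (norm_sub_le _ _).trans (add_le_add (hC s η) (hD n s η h1 h2 h3))
  have hSrec : ∀ n, S (n + 1) x ζ = kernelFirst u₄ (fun s η => h₁ s * h₂ η) x ζ +
      kernelStep u₄ (fun s η => h₁ s * h₂ η) (S n) x ζ := by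
    intro n
    induction n with
    | zero =>
      have : kernelStep u₄ (fun s η => h₁ s * h₂ η) (S 0) x ζ = 0 := by
        simp [S, kernelStep]
      rw [this]; simp [S, kernelTerm]
    | succ n ih =>
      have e : (fun s η => S (n + 1) s η - S n s η) =
          kernelTerm u₄ (fun s η => h₁ s * h₂ η) n := by
        ext1 s; ext1 η; simp [S, Finset.sum_range_succ]
      have h1 := hd.step_sub (hSm (n + 1)) (hSm n) (hSb (n + 1)) (hSb n) hζ hζx hx
      rw [e] at h1
      have h2 : S (n + 1 + 1) x ζ = S (n + 1) x ζ +
          kernelTerm u₄ (fun s η => h₁ s * h₂ η) (n + 1) x ζ := Finset.sum_range_succ _ _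
      rw [h2, ih, kernelTerm, h1]
      abel
  -- For the passage to the limit a fixed Lipschitz constant of the step is enough: `I` is the
  -- constant of `step_bound` for the trivial weight `L = 0`. Both `S (n + 1)` and the step of `S n`
  -- are then within a multiple of `2⁻ⁿ` of their limits.
  obtain ⟨I, hI⟩ : ∃ I, I = ∫ s in (0 : ℝ)..x, r * kernelCoeff r u₄ h₁ h₂ s * Real.exp (0 * s) :=
    ⟨_, rfl⟩
  have hbd : ∀ n : ℕ, ‖kernelSum r u₄ h₁ h₂ x ζ - (kernelFirst u₄ (fun s η => h₁ s * h₂ η) x ζ +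
      kernelStep u₄ (fun s η => h₁ s * h₂ η) (kernelSum r u₄ h₁ h₂) x ζ)‖ ≤
      D * (1 / 2) ^ (n + 1) + D * (1 / 2) ^ n * I := by
    intro n
    have h1 := hd.step_sub hd.meas_kernelSum (hSm n) (fun s η _ _ _ => hC s η) (hSb n) hζ hζx hx
    have h2 := (hd.step_bound (W := fun s η => kernelSum r u₄ h₁ h₂ s η - S n s η)
      (hd.meas_kernelSum.sub (hSm n)) le_rfl (M := D * (1 / 2) ^ n) (by positivity)
      (by simpa using hD n)).2.2 x ζ hζ hζx hx
    rw [← hI, h1] at h2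
    have h3 := hD (n + 1) x ζ hζ hζx hx
    have h4 : kernelSum r u₄ h₁ h₂ x ζ - (kernelFirst u₄ (fun s η => h₁ s * h₂ η) x ζ +
        kernelStep u₄ (fun s η => h₁ s * h₂ η) (kernelSum r u₄ h₁ h₂) x ζ) =
        (kernelSum r u₄ h₁ h₂ x ζ - S (n + 1) x ζ) -
          (kernelStep u₄ (fun s η => h₁ s * h₂ η) (kernelSum r u₄ h₁ h₂) x ζ -
            kernelStep u₄ (fun s η => h₁ s * h₂ η) (S n) x ζ) := by
      rw [hSrec n]; abel
    rw [h4]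
    exact (norm_sub_le _ _).trans (add_le_add h3 h2)
  have hlim : Filter.Tendsto (fun n : ℕ => D * (1 / 2 : ℝ) ^ (n + 1) + D * (1 / 2) ^ n * I)
      Filter.atTop (nhds 0) := by
    have h := tendsto_pow_atTop_nhds_zero_of_lt_one (r := (1 / 2 : ℝ)) (by norm_num) (by norm_num)
    have h1 := (((Filter.tendsto_add_atTop_iff_nat 1).2 h).const_mul D).add
      ((h.const_mul D).mul_const I)
    simpa using h1
  have := ge_of_tendsto' hlim hbd
  exact sub_eq_zero.1 (norm_le_zero_iff.1 this)

end IsKernelData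

/-- The density of the right-hand side of the wave equation for the kernel. -/
def kernelSource (r : ℝ) (u₄ : ℝ → Matrix (Fin p) (Fin p) ℂ) (h₁ : ℝ → Matrix (Fin p) q ℂ)
    (h₂ : ℝ → Matrix q (Fin p) ℂ) (s η : ℝ) : Matrix (Fin p) (Fin p) ℂ :=
  u₄ s * kernelSum r u₄ h₁ h₂ s η - h₁ s * h₂ η - kernelComp h₁ h₂ (kernelSum r u₄ h₁ h₂) s η

namespace IsKernelData

variable (hd : IsKernelData r u₄ h₁ h₂)

include hd

theorem integrableOn_parts :
    IntegrableOn (Function.uncurry fun s η => u₄ s * kernelSum r u₄ h₁ h₂ s η) (triangle r) ∧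
    IntegrableOn (Function.uncurry (kernelComp h₁ h₂ (kernelSum r u₄ h₁ h₂))) (triangle r) := by
  obtain ⟨C, hC0, hC⟩ := hd.kernelSum_bound
  have := hd.step_bound hd.meas_kernelSum (L := 0) le_rfl hC0
    (fun s η _ _ _ => by simpa using hC s η)
  exact ⟨this.1, this.2.1⟩

theorem integrableOn_source : IntegrableOn (Function.uncurry (kernelSource r u₄ h₁ h₂)) (triangle r) :=
  (hd.integrableOn_parts.1.sub hd.integrableOn_F).sub hd.integrableOn_parts.2

/-- This is the mild form of `W_xx - W_ζζ = kernelSource` with the source `u₄` on the diagonal. The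
kernel becomes a superposition of Riemann functions, and its action on smooth functions can be
differentiated although the kernel cannot. -/
theorem kernelSum_eq {x ζ : ℝ} (hζ : 0 ≤ ζ) (hζx : ζ ≤ x) (hx : x ≤ r) :
    kernelSum r u₄ h₁ h₂ x ζ = (∫ s in Ioc 0 r, riemann x ζ s s • u₄ s) +
      ∫ z in triangle r, riemann x ζ z.1 z.2 • kernelSource r u₄ h₁ h₂ z.1 z.2 := by
  have ip := hd.integrableOn_parts
  rw [hd.kernelSum_step hζ hζx hx, hd.first_eq hζ hζx hx, kernelStep_eq,
    charInt_eq_setIntegral ip.1 hζ hζx hx, charInt_eq_setIntegral ip.2 hζ hζx hx]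
  simp only [kernelSource, smul_sub]
  have i1 := integrableOn_riemann_smul ip.1 x ζ
  have i2 := integrableOn_riemann_smul hd.integrableOn_F x ζ
  have i3 := integrableOn_riemann_smul ip.2 x ζ
  rw [integral_sub (by exact i1.sub i2) i3, integral_sub i1 i2]
  abel

end IsKernelData

end Series

/-! ### D'Alembert waves with a reflecting boundary. -/

section Wave

variable {E : Type*} [NormedAddCommGroup E] [NormedSpace ℝ E] [CompleteSpace E]

/-- `y` is a continuously differentiable function on the line, with first derivative `y'` which is
a primitive of `y''`, and `y''` vanishes on the left half-line. -/
structure IsGlobalU (y y' y'' : ℝ → E) : Prop where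
  meas : StronglyMeasurable y''
  integrable : Integrable y''
  eq_zero : ∀ t ≤ 0, y'' t = 0
  deriv_eq : ∀ t, y' t = y' 0 + ∫ s in (0 : ℝ)..t, y'' s
  hasDerivAt : ∀ t, HasDerivAt y (y' t) t

/-- The second derivative is continued by zero, in a strongly measurable version, and integrated
twice. The wave formulas, which evaluate `y` at reflected points, then hold without restrictions at
the end points. -/
theorem HasU.exists_isGlobalU {r : ℝ} {y y' y'' : ℝ → E} (h : HasU r y y' y'') :
    ∃ Y Y' Y'' : ℝ → E, IsGlobalU Y Y' Y'' ∧ (∀ x ∈ Icc 0 r, Y x = y x) ∧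
      (∀ x ∈ Icc 0 r, Y' x = y' x) ∧ Y'' =ᵐ[volume.restrict (Ioo 0 r)] y'' := by
  have hm := h.2.1.1
  let Y'' : ℝ → E := (Ioo 0 r).indicator (hm.mk y'')
  have hms : StronglyMeasurable Y'' := hm.stronglyMeasurable_mk.indicator measurableSet_Ioo
  have hae : Y'' =ᵐ[volume.restrict (Ioo 0 r)] y'' := by
    filter_upwards [hm.ae_eq_mk, ae_restrict_mem measurableSet_Ioo] with x hx hmem
    rw [hx]; exact indicator_of_mem hmem _
  have hint : Integrable Y'' := by
    rw [integrable_indicator_iff measurableSet_Ioo]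
    exact (memLp_integrableOn_Ioo h.2.1).congr hm.ae_eq_mk
  let Y' : ℝ → E := fun t => y' 0 + ∫ s in (0 : ℝ)..t, Y'' s
  have hc : Continuous Y' :=
    continuous_const.add (intervalIntegral.continuous_primitive (fun a b => hint.intervalIntegrable) 0)
  let Y : ℝ → E := fun t => y 0 + ∫ s in (0 : ℝ)..t, Y' s
  have e' : ∀ x ∈ Icc 0 r, Y' x = y' x := by
    intro x hx
    rw [h.2.2 x hx, ← integral_congr_of_ae_Ioo hae (left_mem_Icc.2 (hx.1.trans hx.2)) hx]
  refine ⟨Y, Y', Y'', ⟨hms, hint, ?_, ?_, ?_⟩, ?_, e', hae⟩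
  · exact fun t ht => indicator_of_notMem (fun h => absurd h.1 (not_lt.2 ht)) _
  · intro t; simp [Y']
  · intro t
    exact (intervalIntegral.integral_hasDerivAt_right (hc.intervalIntegrable _ _)
      hc.stronglyMeasurable.stronglyMeasurableAtFilter hc.continuousAt).const_add _
  · intro x hx
    rw [h.hasIntDeriv.2 x hx]
    simp only [Y]
    congr 1
    refine intervalIntegral.integral_congr fun t ht => ?_
    rw [uIcc_of_le hx.1] at ht
    exact e' t ⟨ht.1, ht.2.trans hx.2⟩

namespace IsGlobalU

variable {y y' y'' : ℝ → E} (h : IsGlobalU y y' y'')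

include h

theorem continuous : Continuous y :=
  continuous_iff_continuousAt.2 fun t => (h.hasDerivAt t).continuousAt

theorem continuous_deriv : Continuous y' := by
  have : y' = fun t => y' 0 + ∫ s in (0 : ℝ)..t, y'' s := funext h.deriv_eq
  rw [this]
  exact continuous_const.add
    (intervalIntegral.continuous_primitive (fun a b => h.integrable.intervalIntegrable) 0)

theorem integrable_abs : Integrable fun t => y'' |t| := by
  have e : (fun t => y'' |t|) = fun t => y'' t + y'' (-t) := by
    ext1 t
    rcases le_total 0 t with ht | ht
    · rw [abs_of_nonneg ht, h.eq_zero (-t) (by linarith), add_zero]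
    · rw [abs_of_nonpos ht, h.eq_zero t ht, zero_add]
  rw [e]
  exact h.integrable.add h.integrable.comp_neg

end IsGlobalU

theorem integral_abs_neg {f : ℝ → E} (v : ℝ) :
    ∫ t in (0 : ℝ)..(-v), f |t| = -∫ t in (0 : ℝ)..v, f |t| := by
  have := intervalIntegral.integral_comp_neg (a := 0) (b := v) (fun t => f |t|)
  simp only [abs_neg, neg_zero] at this
  rw [this, intervalIntegral.integral_symm]

theorem integral_abs_of_nonneg {f : ℝ → E} {v : ℝ} (hv : 0 ≤ v) :
    ∫ t in (0 : ℝ)..v, f |t| = ∫ t in (0 : ℝ)..v, f t := by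
  refine intervalIntegral.integral_congr fun t ht => ?_
  rw [uIcc_of_le hv] at ht
  simp only [abs_of_nonneg ht.1]

/-- The solution of the wave equation with a reflecting boundary, for the data `f` and a unit source
at `(s, η)`. -/
def wave (f : ℝ → E) (x s η : ℝ) : E := ∫ t in (0 : ℝ)..x, riemann x t s η • f t

theorem wave_of_lt {f : ℝ → E} {x s η : ℝ} (hx : 0 ≤ x) (hη : 0 ≤ η) (h : x < s) :
    wave f x s η = 0 := by
  rw [wave, intervalIntegral.integral_congr (g := fun _ => (0 : E)), intervalIntegral.integral_zero]
  intro t ht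
  rw [uIcc_of_le hx] at ht
  simp only [riemann_eq_zero hη ht.1 h, zero_smul]

/-- D'Alembert's formula. -/
theorem wave_eq {f : ℝ → E} (hf : ∀ a b, IntervalIntegrable (fun t => f |t|) volume a b)
    {x s η : ℝ} (hη : 0 ≤ η) (hηs : η ≤ s) (hsx : s ≤ x) :
    wave f x s η = (1 / 2 : ℝ) • ((∫ t in (0 : ℝ)..(x - s + η), f |t|) +
      ∫ t in (0 : ℝ)..(x - s - η), f |t|) := by
  have hx : 0 ≤ x := by linarith
  have hfi : IntegrableOn f (Ioc 0 x) := by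
    have := (intervalIntegrable_iff_integrableOn_Ioc_of_le hx).1 (hf 0 x)
    refine this.congr_fun (fun t ht => ?_) measurableSet_Ioc
    simp only [abs_of_nonneg ht.1.le]
  let A : Set ℝ := {t | s - η ≤ x - t ∧ s + η ≤ x + t}
  let B : Set ℝ := {t | s + η ≤ x - t}
  have hA : MeasurableSet A :=
    (measurableSet_le measurable_const (measurable_const.sub measurable_id)).inter
      (measurableSet_le measurable_const (measurable_const.add measurable_id))
  have hB : MeasurableSet B := measurableSet_le (by fun_prop) (by fun_prop)
  have e0 : wave f x s η = (1 / 2 : ℝ) • ((∫ t in A ∩ Ioc 0 x, f t) + ∫ t in B ∩ Ioc 0 x, f t) := by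
    rw [wave, intervalIntegral.integral_of_le hx, ← Measure.restrict_restrict hA,
      ← Measure.restrict_restrict hB, ← integral_indicator hA, ← integral_indicator hB,
      ← integral_add (hfi.indicator hA) (hfi.indicator hB), ← integral_smul]
    congr 1
    ext1 t
    simp only [riemann, indicator, A, B, mem_ofPred_eq]
    split_ifs <;> simp [add_smul, mul_add]
  rw [e0]
  congr 1
  have i2 : ∫ t in (0 : ℝ)..(x - s + η), f |t| = ∫ t in (0 : ℝ)..(x - s + η), f t :=
    integral_abs_of_nonneg (by linarith)
  have ii : ∀ a b, 0 ≤ a → a ≤ b → b ≤ x → IntervalIntegrable f volume a b := by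
    intro a b ha hab hb
    rw [intervalIntegrable_iff_integrableOn_Ioc_of_le hab]
    exact hfi.mono_set (Ioc_subset_Ioc ha hb)
  -- If `s + η ≤ x`, the wave has reached the boundary: the direct part is cut off at `0` and the
  -- reflected part is present. Otherwise there is no reflected part, and the second integral has a
  -- negative upper limit, so that it removes the piece below `s + η - x`.
  rcases le_or_gt (s + η) x with hc | hc
  · have eA : A ∩ Ioc 0 x = Ioc 0 (x - s + η) := by
      ext t; simp only [A, mem_inter_iff, mem_ofPred_eq, mem_Ioc]
      constructor
      · rintro ⟨⟨h1, h2⟩, h3, h4⟩; exact ⟨h3, by linarith⟩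
      · rintro ⟨h1, h2⟩; exact ⟨⟨by linarith, by linarith⟩, h1, by linarith⟩
    have eB : B ∩ Ioc 0 x = Ioc 0 (x - s - η) := by
      ext t; simp only [B, mem_inter_iff, mem_ofPred_eq, mem_Ioc]
      constructor
      · rintro ⟨h1, h3, h4⟩; exact ⟨h3, by linarith⟩
      · rintro ⟨h1, h2⟩; exact ⟨by linarith, h1, by linarith⟩
    rw [eA, eB, i2, integral_abs_of_nonneg (by linarith : 0 ≤ x - s - η),
      intervalIntegral.integral_of_le (by linarith), intervalIntegral.integral_of_le (by linarith)]
  · have eA : A ∩ Ioc 0 x = Icc (s + η - x) (x - s + η) := by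
      ext t; simp only [A, mem_inter_iff, mem_ofPred_eq, mem_Ioc, mem_Icc]
      constructor
      · rintro ⟨⟨h1, h2⟩, h3, h4⟩; exact ⟨by linarith, by linarith⟩
      · rintro ⟨h1, h2⟩; exact ⟨⟨by linarith, by linarith⟩, by linarith, by linarith⟩
    have eB : B ∩ Ioc 0 x = ∅ := by
      ext t; simp only [B, mem_inter_iff, mem_ofPred_eq, mem_Ioc, mem_empty_iff_false, iff_false]
      rintro ⟨h1, h3, h4⟩; linarith
    have i3 : ∫ t in (0 : ℝ)..(x - s - η), f |t| = -∫ t in (0 : ℝ)..(s + η - x), f t := by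
      rw [show x - s - η = -(s + η - x) by ring, integral_abs_neg,
        integral_abs_of_nonneg (by linarith)]
    rw [eA, eB, i2, i3, setIntegral_empty, add_zero, integral_Icc_eq_integral_Ioc,
      ← intervalIntegral.integral_of_le (by linarith), ← sub_eq_add_neg,
      intervalIntegral.integral_interval_sub_left (ii _ _ le_rfl (by linarith) (by linarith))
        (ii _ _ le_rfl (by linarith) (by linarith))]

/-- The mean value of `f` at the reflected end points of the dependence interval. -/
def waveMean (f : ℝ → E) (x s η : ℝ) : E := (1 / 2 : ℝ) • (f (x - s + η) + f |x - s - η|)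

/-- `waveMean` is the derivative in `x` of d'Alembert's formula. At `x = s` the wave vanishes,
because the two integrals over `(0, η)` and `(0, -η)` of an even function cancel. -/
theorem wave_eq_integral {f : ℝ → E} (hf : Continuous f) {x s η : ℝ} (hη : 0 ≤ η) (hηs : η ≤ s)
    (hsx : s ≤ x) : wave f x s η = ∫ ρ in s..x, waveMean f ρ s η := by
  have hfa : Continuous fun t => f |t| := hf.comp continuous_abs
  have hi : ∀ a b, IntervalIntegrable (fun t => f |t|) volume a b := fun a b =>
    hfa.intervalIntegrable a b
  rw [wave_eq hi hη hηs hsx]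
  simp only [waveMean]
  rw [intervalIntegral.integral_smul, intervalIntegral.integral_add
    (Continuous.intervalIntegrable (by fun_prop) _ _)
    (Continuous.intervalIntegrable (by fun_prop) _ _)]
  congr 1
  have e1 : ∫ ρ in s..x, f (ρ - s + η) = ∫ t in η..(x - s + η), f |t| := by
    have := intervalIntegral.integral_comp_add_right (a := s) (b := x) (fun t => f |t|) (η - s)
    rw [show s + (η - s) = η by ring, show x + (η - s) = x - s + η by ring] at this
    rw [← this]
    refine intervalIntegral.integral_congr fun ρ hρ => ?_
    rw [uIcc_of_le hsx] at hρ
    rw [abs_of_nonneg (by linarith [hρ.1]), show ρ + (η - s) = ρ - s + η by ring]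
  have e2 : ∫ ρ in s..x, f |ρ - s - η| = ∫ t in (-η)..(x - s - η), f |t| := by
    have := intervalIntegral.integral_comp_add_right (a := s) (b := x) (fun t => f |t|) (-s - η)
    rw [show s + (-s - η) = -η by ring, show x + (-s - η) = x - s - η by ring] at this
    rw [← this]
    refine intervalIntegral.integral_congr fun ρ hρ => ?_
    rw [show ρ + (-s - η) = ρ - s - η by ring]
  rw [e1, e2, ← intervalIntegral.integral_interval_sub_left (hi 0 (x - s + η)) (hi 0 η),
    ← intervalIntegral.integral_interval_sub_left (hi 0 (x - s - η)) (hi 0 (-η)), integral_abs_neg]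
  abel

/-- The second derivative in `x` of a wave: the velocity jumps to `y(η)` when the source is switched
on at `s`, and then changes at the rate given by the wave with data `y''`. After reflection, for `σ
> s + η`, where the Riemann function at `ζ = 0` equals `1`, the fold of `y |·|` at the origin adds
`y'(0)`. -/
theorem IsGlobalU.waveMean_eq {y y' y'' : ℝ → E} (h : IsGlobalU y y' y'') {ρ s η : ℝ}
    (hη : 0 ≤ η) (hηs : η ≤ s) (hsρ : s ≤ ρ) :
    waveMean y ρ s η = y η + ∫ σ in s..ρ, (wave y'' σ s η + riemann σ 0 s η • y' 0) := by
  have hi : ∀ a b, IntervalIntegrable (fun t => y'' |t|) volume a b := fun a b =>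
    h.integrable_abs.intervalIntegrable
  have hc := h.continuous
  have hcont : Continuous fun σ => waveMean y σ s η := by unfold waveMean; fun_prop
  have hprim : Continuous fun v => ∫ t in (0 : ℝ)..v, y'' |t| :=
    intervalIntegral.continuous_primitive hi 0
  have hv : ∀ v, 0 ≤ v → ∫ t in (0 : ℝ)..v, y'' |t| = y' v - y' 0 := by
    intro v hv
    rw [integral_abs_of_nonneg hv, h.deriv_eq v]; abel
  -- The only exceptional point is `σ = s + η`, where the argument of `|·|` changes sign.
  have key := integral_eq_of_hasDerivAt_off_countable_of_le (fun σ => waveMean y σ s η)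
    (fun σ => wave y'' σ s η + riemann σ 0 s η • y' 0) hsρ (countable_singleton (s + η))
    hcont.continuousOn ?_ ?_
  · rw [key]
    simp [waveMean, abs_of_nonneg hη, ← two_smul ℝ (y η), smul_smul]
  · rintro σ ⟨⟨hσ1, hσ2⟩, hσ3⟩
    have hne : σ ≠ s + η := hσ3
    rw [wave_eq hi hη hηs hσ1.le, hv _ (by linarith)]
    have d1 : HasDerivAt (fun σ => y (σ - s + η)) (y' (σ - s + η)) σ := by
      have := (h.hasDerivAt (σ - s + η)).scomp σ (((hasDerivAt_id σ).sub_const s).add_const η)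
      simpa [Function.comp_def] using this
    unfold waveMean
    rcases lt_or_gt_of_ne hne with hlt | hgt
    · have d2 : HasDerivAt (fun σ => y |σ - s - η|) (-y' (s + η - σ)) σ := by
        have h1 : HasDerivAt (fun σ : ℝ => s + η - σ) (-1) σ := by
          simpa using (hasDerivAt_id σ).const_sub (s + η)
        have := (h.hasDerivAt (s + η - σ)).scomp σ h1
        have h2 : HasDerivAt (fun σ => y (s + η - σ)) (-y' (s + η - σ)) σ := by
          simpa [Function.comp_def] using this
        refine h2.congr_of_eventuallyEq ?_
        filter_upwards [Iio_mem_nhds hlt] with u hu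
        have hu' : u < s + η := hu
        rw [abs_of_nonpos (by linarith)]
        congr 1; ring
      refine ((d1.add d2).const_smul (1 / 2 : ℝ)).congr_deriv ?_
      have hR : riemann σ 0 s η = 0 := by
        unfold riemann
        rw [if_neg (by rintro ⟨_, h2⟩; linarith), if_neg (by intro h2; linarith)]; norm_num
      rw [hR, zero_smul, add_zero, show σ - s - η = -(s + η - σ) by ring, integral_abs_neg,
        hv _ (by linarith)]
      congr 1; abel
    · have d2 : HasDerivAt (fun σ => y |σ - s - η|) (y' (σ - s - η)) σ := by
        have := (h.hasDerivAt (σ - s - η)).scomp σ (((hasDerivAt_id σ).sub_const s).sub_const η)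
        have h2 : HasDerivAt (fun σ => y (σ - s - η)) (y' (σ - s - η)) σ := by
          simpa [Function.comp_def] using this
        refine h2.congr_of_eventuallyEq ?_
        filter_upwards [Ioi_mem_nhds hgt] with u hu
        have hu' : s + η < u := hu
        rw [abs_of_nonneg (by linarith)]
      refine ((d1.add d2).const_smul (1 / 2 : ℝ)).congr_deriv ?_
      have hR : riemann σ 0 s η = 1 := by
        unfold riemann
        rw [if_pos ⟨by linarith, by linarith⟩, if_pos (by linarith)]; norm_num
      rw [hR, one_smul, hv _ (by linarith)]
      module
  · have i1 : IntervalIntegrable (fun σ => (1 / 2 : ℝ) • ((∫ t in (0 : ℝ)..(σ - s + η), y'' |t|) +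
        ∫ t in (0 : ℝ)..(σ - s - η), y'' |t|)) volume s ρ := by
      refine Continuous.intervalIntegrable ?_ _ _
      have c1 := hprim.comp (by fun_prop : Continuous fun σ : ℝ => σ - s + η)
      have c2 := hprim.comp (by fun_prop : Continuous fun σ : ℝ => σ - s - η)
      exact (c1.add c2).const_smul _
    have i2 : IntervalIntegrable (fun σ => riemann σ 0 s η • y' 0) volume s ρ := by
      refine (intervalIntegrable_const (c := ‖y' 0‖)).mono_fun' ?_ ?_
      · exact ((measurable_riemann measurable_id measurable_const measurable_const
          measurable_const).stronglyMeasurable.smul stronglyMeasurable_const).aestronglyMeasurable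
      · refine Filter.Eventually.of_forall fun σ => ?_
        simp only [norm_smul]
        exact mul_le_of_le_one_left (norm_nonneg _) (norm_riemann_le_one ..)
    refine (i1.add i2).congr ?_
    intro σ hσ
    rw [uIoc_of_le hsρ] at hσ
    simp only
    rw [wave_eq hi hη hηs hσ.1.le]

end Wave

/-! ### Superposition of waves over a measure of sources. -/

section Superposition

variable {Ω : Type*} [MeasurableSpace Ω] {ν : Measure Ω} [SFinite ν]
  {E F G : Type*} [NormedAddCommGroup E] [NormedSpace ℝ E] [CompleteSpace E]
  [NormedAddCommGroup F] [NormedSpace ℝ F] [CompleteSpace F]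
  [NormedAddCommGroup G] [NormedSpace ℝ G] [CompleteSpace G]

/-- Fubini's theorem for a bilinear expression with an integrable and a dominated factor. -/
theorem integral_bilin_swap (B : F →L[ℝ] E →L[ℝ] G) {g : Ω → F} (hg : Integrable g ν) {x : ℝ}
    (hx : 0 ≤ x) {k : ℝ → Ω → E}
    (hk : AEStronglyMeasurable (Function.uncurry k) ((volume.restrict (Ioc 0 x)).prod ν))
    {φ : ℝ → ℝ} (hφ : IntegrableOn φ (Ioc 0 x))
    (hb : ∀ᵐ ω ∂ν, ∀ t ∈ Ioc 0 x, ‖k t ω‖ ≤ φ t) :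
    IntervalIntegrable (fun t => ∫ ω, B (g ω) (k t ω) ∂ν) volume 0 x ∧
      ∫ ω, B (g ω) (∫ t in (0 : ℝ)..x, k t ω) ∂ν =
        ∫ t in (0 : ℝ)..x, ∫ ω, B (g ω) (k t ω) ∂ν := by
  have hm : AEStronglyMeasurable (fun z : ℝ × Ω => B (g z.2) (k z.1 z.2))
      ((volume.restrict (Ioc 0 x)).prod ν) :=
    B.continuous₂.comp_aestronglyMeasurable₂ hg.1.comp_snd hk
  have hd : Integrable (fun z : ℝ × Ω => φ z.1 * (‖B‖ * ‖g z.2‖))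
      ((volume.restrict (Ioc 0 x)).prod ν) := Integrable.mul_prod hφ (hg.norm.const_mul _)
  have hbk : ∀ᵐ z ∂((volume.restrict (Ioc 0 x)).prod ν), ‖k z.1 z.2‖ ≤ φ z.1 := by
    filter_upwards [Measure.quasiMeasurePreserving_fst.ae (ae_restrict_mem measurableSet_Ioc),
      Measure.quasiMeasurePreserving_snd.ae hb] with z h1 h2
    exact h2 z.1 h1
  have hi : Integrable (fun z : ℝ × Ω => B (g z.2) (k z.1 z.2))
      ((volume.restrict (Ioc 0 x)).prod ν) := by
    refine hd.mono' hm ?_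
    filter_upwards [hbk] with z hz
    calc ‖B (g z.2) (k z.1 z.2)‖ ≤ ‖B‖ * ‖g z.2‖ * ‖k z.1 z.2‖ := B.le_opNorm₂ _ _
      _ ≤ ‖B‖ * ‖g z.2‖ * φ z.1 := by gcongr
      _ = _ := by ring
  have hki : ∀ᵐ ω ∂ν, IntegrableOn (fun t => k t ω) (Ioc 0 x) := by
    have hkm := (hk.prod_swap).prodMk_left
    filter_upwards [hb, hkm] with ω h1 h2
    exact hφ.mono' h2 ((ae_restrict_iff' measurableSet_Ioc).2 (Filter.Eventually.of_forall h1))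
  refine ⟨?_, ?_⟩
  · rw [intervalIntegrable_iff_integrableOn_Ioc_of_le hx]
    exact hi.integral_prod_left
  · rw [intervalIntegral.integral_of_le hx, ← integral_integral_swap (by exact hi.swap)]
    refine integral_congr_ae ?_
    filter_upwards [hki] with ω hω
    rw [intervalIntegral.integral_of_le hx, ContinuousLinearMap.integral_comp_comm _ hω]

variable {s η : Ω → ℝ}

/-- The superposition of the solutions of the wave equation with sources at the points
`(s ω, η ω)`. -/
def waveSum (ν : Measure Ω) (s η : Ω → ℝ) (g : Ω → F) (x ζ : ℝ) : F :=
  ∫ ω, riemann x ζ (s ω) (η ω) • g ω ∂ν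

/-- The integration over `t` is moved from the superposition to the single waves, where it can be
carried out explicitly. -/
theorem integral_waveSum (B : F →L[ℝ] E →L[ℝ] G) (hs : Measurable s) (hη : Measurable η)
    {g : Ω → F} (hg : Integrable g ν) {x : ℝ} (hx : 0 ≤ x) {f : ℝ → E}
    (hf : IntegrableOn f (Ioc 0 x)) :
    IntervalIntegrable (fun t => B (waveSum ν s η g x t) (f t)) volume 0 x ∧
    ∫ t in (0 : ℝ)..x, B (waveSum ν s η g x t) (f t) =
      ∫ ω, B (g ω) (wave f x (s ω) (η ω)) ∂ν := by
  have hm : StronglyMeasurable fun z : ℝ × Ω => riemann x z.1 (s z.2) (η z.2) :=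
    (measurable_riemann measurable_const measurable_fst (hs.comp measurable_snd)
      (hη.comp measurable_snd)).stronglyMeasurable
  have key := integral_bilin_swap B hg hx (k := fun t ω => riemann x t (s ω) (η ω) • f t)
    (hm.aestronglyMeasurable.smul hf.1.comp_fst) hf.norm (Filter.Eventually.of_forall fun ω t _ => by
      rw [norm_smul]; exact mul_le_of_le_one_left (norm_nonneg _) (norm_riemann_le_one ..))
  have e : ∀ t, ∫ ω, B (g ω) (riemann x t (s ω) (η ω) • f t) ∂ν =
      B (waveSum ν s η g x t) (f t) := by
    intro t
    have hi : Integrable (fun ω => riemann x t (s ω) (η ω) • g ω) ν := by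
      refine hg.norm.mono' ?_ (Filter.Eventually.of_forall fun ω => ?_)
      · exact (measurable_riemann measurable_const measurable_const hs
          hη).aestronglyMeasurable.smul hg.1
      · rw [norm_smul]; exact mul_le_of_le_one_left (norm_nonneg _) (norm_riemann_le_one ..)
    have h1 := (B.flip (f t)).integral_comp_comm hi
    simp only [ContinuousLinearMap.flip_apply] at h1
    rw [waveSum, ← h1]
    simp
  simp only [e] at key
  exact ⟨key.1, key.2.symm⟩

/-- `N` is the velocity of the superposed waves. Its first term collects the jumps `y(η)` of the
sources already switched on at time `ρ`; it is left as an integral over the sources because its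
density depends on their distribution. -/
theorem IsGlobalU.integral_waveSum (B : F →L[ℝ] E →L[ℝ] G) (hs : Measurable s)
    (hη : Measurable η) (hsη : ∀ᵐ ω ∂ν, 0 ≤ η ω ∧ η ω ≤ s ω) {g : Ω → F} (hg : Integrable g ν)
    {y y' y'' : ℝ → E} (h : IsGlobalU y y' y'') (r : ℝ) :
    ∃ N : ℝ → G, IntegrableOn N (Ioo 0 r) ∧
      (∀ x ∈ Icc 0 r, ∫ t in (0 : ℝ)..x, B (waveSum ν s η g x t) (y t) = ∫ ρ in (0 : ℝ)..x, N ρ) ∧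
      (IntegrableOn (fun σ => (∫ t in (0 : ℝ)..σ, B (waveSum ν s η g σ t) (y'' t)) +
        B (waveSum ν s η g σ 0) (y' 0)) (Ioo 0 r)) ∧
      ∀ ρ ∈ Icc 0 r, N ρ = (∫ ω, B (g ω) (if s ω ≤ ρ then y (η ω) else 0) ∂ν) +
        ∫ σ in (0 : ℝ)..ρ, ((∫ t in (0 : ℝ)..σ, B (waveSum ν s η g σ t) (y'' t)) +
          B (waveSum ν s η g σ 0) (y' 0)) := by
  rcases lt_or_ge r 0 with hr | hr
  · refine ⟨0, ?_, ?_, ?_, ?_⟩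
    · rw [Ioo_eq_empty (by linarith)]; exact integrableOn_empty
    · exact fun x hx => absurd (hx.1.trans hx.2) (not_le.2 hr)
    · rw [Ioo_eq_empty (by linarith)]; exact integrableOn_empty
    · exact fun x hx => absurd (hx.1.trans hx.2) (not_le.2 hr)
  have hc := h.continuous
  obtain ⟨C, hC⟩ := (isCompact_Icc (a := -r) (b := r)).exists_bound_of_continuousOn hc.continuousOn
  have hC0 : 0 ≤ C := (norm_nonneg _).trans (hC 0 ⟨by linarith, hr⟩)
  -- `k₁` is the velocity of a single wave, zero before the source acts; `k₂` is its rate of change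
  -- apart from the jump.
  let k₁ : ℝ → Ω → E := fun ρ ω => if s ω ≤ ρ then waveMean y ρ (s ω) (η ω) else 0
  let k₂ : ℝ → Ω → E := fun σ ω => wave y'' σ (s ω) (η ω) + riemann σ 0 (s ω) (η ω) • y' 0
  have hk₁ : StronglyMeasurable (Function.uncurry k₁) := by
    refine StronglyMeasurable.ite (measurableSet_le (hs.comp measurable_snd) measurable_fst) ?_
      stronglyMeasurable_const
    refine StronglyMeasurable.fun_const_smul (StronglyMeasurable.fun_add ?_ ?_) _
    · exact hc.comp_stronglyMeasurable (g := y)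
        (f := fun z : ℝ × Ω => z.1 - s z.2 + η z.2) (by fun_prop)
    · exact hc.comp_stronglyMeasurable (g := y)
        (f := fun z : ℝ × Ω => |z.1 - s z.2 - η z.2|)
        (Measurable.stronglyMeasurable (by fun_prop))
  have hk₂ : StronglyMeasurable (Function.uncurry k₂) := by
    refine StronglyMeasurable.fun_add ?_ ?_
    · refine stronglyMeasurable_intervalIntegral
        (f := fun (z : ℝ × Ω) t => riemann z.1 t (s z.2) (η z.2) • y'' t) ?_ measurable_const
        measurable_fst
      refine StronglyMeasurable.smul ?_ (h.meas.comp_measurable measurable_snd)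
      exact (measurable_riemann (by fun_prop) (by fun_prop) (by fun_prop)
        (by fun_prop)).stronglyMeasurable
    · exact ((measurable_riemann (by fun_prop) (by fun_prop) (by fun_prop)
        (by fun_prop)).stronglyMeasurable).smul stronglyMeasurable_const
  have hb₁ : ∀ x ∈ Icc 0 r, ∀ᵐ ω ∂ν, ∀ ρ ∈ Ioc 0 x, ‖k₁ ρ ω‖ ≤ C := by
    intro x hx
    filter_upwards [hsη] with ω hω ρ hρ
    have hρr : ρ ≤ r := hρ.2.trans hx.2
    by_cases hsρ : s ω ≤ ρ
    · simp only [k₁, if_pos hsρ, waveMean]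
      rw [norm_smul]
      have h1 := hC (ρ - s ω + η ω) ⟨by linarith [hω.1], by linarith [hω.2]⟩
      have h2 := hC |ρ - s ω - η ω| ⟨by linarith [abs_nonneg (ρ - s ω - η ω)],
        abs_le.2 ⟨by linarith [hω.1, hω.2, hρ.1], by linarith [hω.1, hω.2]⟩⟩
      have h3 := norm_add_le (y (ρ - s ω + η ω)) (y |ρ - s ω - η ω|)
      norm_num
      linarith
    · simp only [k₁, if_neg hsρ, norm_zero]; exact hC0
  have hb₂ : ∀ x ∈ Icc 0 r, ∀ᵐ ω ∂ν, ∀ σ ∈ Ioc 0 x,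
      ‖k₂ σ ω‖ ≤ (∫ t, ‖y'' t‖) + ‖y' 0‖ := by
    intro x hx
    refine Filter.Eventually.of_forall fun ω σ hσ => ?_
    refine (norm_add_le _ _).trans (add_le_add ?_ ?_)
    · rw [wave, intervalIntegral.integral_of_le hσ.1.le]
      calc _ ≤ ∫ t in Ioc 0 σ, ‖y'' t‖ := by
            refine norm_integral_le_of_norm_le h.integrable.norm.integrableOn
              (Filter.Eventually.of_forall fun t => ?_)
            rw [norm_smul]; exact mul_le_of_le_one_left (norm_nonneg _) (norm_riemann_le_one ..)
        _ ≤ _ := setIntegral_le_integral h.integrable.norm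
            (Filter.Eventually.of_forall fun t => norm_nonneg _)
    · rw [norm_smul]; exact mul_le_of_le_one_left (norm_nonneg _) (norm_riemann_le_one ..)
  have ic : ∀ (c x : ℝ), IntegrableOn (fun _ : ℝ => c) (Ioc 0 x) := fun c x =>
    integrableOn_const (by simp)
  have S₁ := fun x (hx : x ∈ Icc 0 r) => integral_bilin_swap B hg hx.1
    hk₁.aestronglyMeasurable (ic C x) (hb₁ x hx)
  have S₂ := fun x (hx : x ∈ Icc 0 r) => integral_bilin_swap B hg hx.1
    hk₂.aestronglyMeasurable (ic _ x) (hb₂ x hx)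
  have hrr : r ∈ Icc 0 r := right_mem_Icc.2 hr
  have e₂ : ∀ σ, 0 ≤ σ → ∫ ω, B (g ω) (k₂ σ ω) ∂ν =
      (∫ t in (0 : ℝ)..σ, B (waveSum ν s η g σ t) (y'' t)) + B (waveSum ν s η g σ 0) (y' 0) := by
    intro σ hσ
    rw [(CanonicalSystem.integral_waveSum B hs hη hg hσ h.integrable.integrableOn).2]
    have hi : Integrable (fun ω => riemann σ 0 (s ω) (η ω) • g ω) ν := by
      refine hg.norm.mono' ?_ (Filter.Eventually.of_forall fun ω => ?_)
      · exact (measurable_riemann measurable_const measurable_const hs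
          hη).aestronglyMeasurable.smul hg.1
      · rw [norm_smul]; exact mul_le_of_le_one_left (norm_nonneg _) (norm_riemann_le_one ..)
    have h1 := (B.flip (y' 0)).integral_comp_comm hi
    simp only [ContinuousLinearMap.flip_apply] at h1
    have hi2 := (B.flip (y' 0)).integrable_comp hi
    simp only [ContinuousLinearMap.flip_apply] at hi2
    have hi1 : Integrable (fun ω => B (g ω) (wave y'' σ (s ω) (η ω))) ν := by
      have hwm : StronglyMeasurable fun ω => wave y'' σ (s ω) (η ω) := by
        refine stronglyMeasurable_intervalIntegral
          (f := fun (ω : Ω) t => riemann σ t (s ω) (η ω) • y'' t) ?_ measurable_const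
          measurable_const
        refine StronglyMeasurable.smul ?_ (h.meas.comp_measurable measurable_snd)
        exact (measurable_riemann (by fun_prop) (by fun_prop) (by fun_prop)
          (by fun_prop)).stronglyMeasurable
      refine (hg.norm.const_mul (‖B‖ * ∫ t, ‖y'' t‖)).mono'
        (B.continuous₂.comp_aestronglyMeasurable₂ hg.1 hwm.aestronglyMeasurable) ?_
      refine Filter.Eventually.of_forall fun ω => ?_
      refine (B.le_opNorm₂ _ _).trans ?_
      have : ‖wave y'' σ (s ω) (η ω)‖ ≤ ∫ t, ‖y'' t‖ := by
        rw [wave, intervalIntegral.integral_of_le hσ]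
        calc _ ≤ ∫ t in Ioc 0 σ, ‖y'' t‖ := by
              refine norm_integral_le_of_norm_le h.integrable.norm.integrableOn
                (Filter.Eventually.of_forall fun t => ?_)
              rw [norm_smul]; exact mul_le_of_le_one_left (norm_nonneg _) (norm_riemann_le_one ..)
          _ ≤ _ := setIntegral_le_integral h.integrable.norm
              (Filter.Eventually.of_forall fun t => norm_nonneg _)
      calc _ ≤ ‖B‖ * ‖g ω‖ * ∫ t, ‖y'' t‖ := by gcongr
        _ = _ := by ring
    have e3 : ∀ ω, B (g ω) (k₂ σ ω) = B (g ω) (wave y'' σ (s ω) (η ω)) +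
        B (riemann σ 0 (s ω) (η ω) • g ω) (y' 0) := by
      intro ω; simp [k₂]
    simp only [e3]
    rw [integral_add hi1 hi2, h1]
    rfl
  refine ⟨fun ρ => ∫ ω, B (g ω) (k₁ ρ ω) ∂ν, ?_, ?_, ?_, ?_⟩
  · exact (intervalIntegrable_iff_integrableOn_Ioo_of_le hr).1 (S₁ r hrr).1
  · intro x hx
    rw [(CanonicalSystem.integral_waveSum B hs hη hg hx.1
      (hc.integrableOn_Icc.mono_set Ioc_subset_Icc_self)).2, ← (S₁ x hx).2]
    refine integral_congr_ae ?_
    filter_upwards [hsη] with ω hω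
    congr 1
    have hs0 : 0 ≤ s ω := hω.1.trans hω.2
    rcases le_or_gt (s ω) x with hsx | hsx
    · rw [wave_eq_integral hc hω.1 hω.2 hsx, intervalIntegral.integral_of_le hsx,
        intervalIntegral.integral_of_le hx.1]
      have : (fun t => k₁ t ω) = (Ici (s ω)).indicator fun t => waveMean y t (s ω) (η ω) := by
        ext1 t; simp [k₁, indicator]
      rw [this, integral_indicator measurableSet_Ici, Measure.restrict_restrict measurableSet_Ici]
      refine setIntegral_congr_set ?_
      have hne : ∀ᵐ t : ℝ ∂volume, t ≠ s ω := by simp [ae_iff, measure_singleton]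
      filter_upwards [hne] with t ht
      refine propext ?_
      change t ∈ Ioc (s ω) x ↔ t ∈ Ici (s ω) ∩ Ioc 0 x
      simp only [mem_Ioc, mem_inter_iff, mem_Ici]
      constructor
      · rintro ⟨h1, h2⟩; exact ⟨h1.le, by linarith, h2⟩
      · rintro ⟨h1, h2, h3⟩; exact ⟨lt_of_le_of_ne h1 ht.symm, h3⟩
    · rw [wave_of_lt hx.1 hω.1 hsx, intervalIntegral.integral_congr (g := fun _ => (0 : E)),
        intervalIntegral.integral_zero]
      intro t ht
      rw [uIcc_of_le hx.1] at ht
      simp only [k₁]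
      rw [if_neg (by linarith [ht.2])]
  · refine IntegrableOn.congr_fun
      ((intervalIntegrable_iff_integrableOn_Ioo_of_le hr).1 (S₂ r hrr).1) ?_ measurableSet_Ioo
    exact fun σ hσ => e₂ σ hσ.1.le
  · intro ρ hρ
    have e4 : ∫ σ in (0 : ℝ)..ρ, ((∫ t in (0 : ℝ)..σ, B (waveSum ν s η g σ t) (y'' t)) +
        B (waveSum ν s η g σ 0) (y' 0)) = ∫ ω, B (g ω) (∫ σ in (0 : ℝ)..ρ, k₂ σ ω) ∂ν := by
      rw [(S₂ ρ hρ).2]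
      refine intervalIntegral.integral_congr fun σ hσ => ?_
      rw [uIcc_of_le hρ.1] at hσ
      exact (e₂ σ hσ.1).symm
    have hym : StronglyMeasurable fun ω => if s ω ≤ ρ then y (η ω) else 0 :=
      StronglyMeasurable.ite (measurableSet_le hs measurable_const)
        (hc.comp_stronglyMeasurable (g := y) hη.stronglyMeasurable) stronglyMeasurable_const
    have j1 : Integrable (fun ω => B (g ω) (if s ω ≤ ρ then y (η ω) else 0)) ν := by
      refine (hg.norm.const_mul (‖B‖ * C)).mono'
        (B.continuous₂.comp_aestronglyMeasurable₂ hg.1 hym.aestronglyMeasurable) ?_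
      filter_upwards [hsη] with ω hω
      refine (B.le_opNorm₂ _ _).trans ?_
      have : ‖(if s ω ≤ ρ then y (η ω) else 0)‖ ≤ C := by
        split_ifs with hsρ
        · exact hC _ ⟨by linarith [hω.1], by linarith [hω.2, hρ.2]⟩
        · rw [norm_zero]; exact hC0
      calc _ ≤ ‖B‖ * ‖g ω‖ * C := by gcongr
        _ = _ := by ring
    have hk₂i : ∀ᵐ ω ∂ν, k₁ ρ ω = (if s ω ≤ ρ then y (η ω) else 0) + ∫ σ in (0 : ℝ)..ρ, k₂ σ ω := by
      filter_upwards [hsη] with ω hω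
      have hs0 : 0 ≤ s ω := hω.1.trans hω.2
      have z : ∀ σ, 0 ≤ σ → σ < s ω → k₂ σ ω = 0 := by
        intro σ h0 hσ
        simp only [k₂]
        rw [wave_of_lt h0 hω.1 hσ, riemann_eq_zero hω.1 le_rfl hσ, zero_smul, add_zero]
      rcases le_or_gt (s ω) ρ with hsρ | hsρ
      · simp only [k₁, if_pos hsρ]
        rw [h.waveMean_eq hω.1 hω.2 hsρ, intervalIntegral.integral_of_le hsρ,
          intervalIntegral.integral_of_le hρ.1]
        congr 1
        have e5 : ∫ σ in Ioc 0 ρ, k₂ σ ω = ∫ σ in Ioc 0 ρ, (Ici (s ω)).indicator (fun σ => k₂ σ ω) σ := by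
          refine setIntegral_congr_fun measurableSet_Ioc fun σ hσ => ?_
          simp only [indicator, mem_Ici]
          split_ifs with h1
          · rfl
          · exact z σ hσ.1.le (not_le.1 h1)
        rw [e5, integral_indicator measurableSet_Ici, Measure.restrict_restrict measurableSet_Ici]
        refine setIntegral_congr_set ?_
        have hne : ∀ᵐ t : ℝ ∂volume, t ≠ s ω := by simp [ae_iff, measure_singleton]
        filter_upwards [hne] with t ht
        refine propext ?_
        change t ∈ Ioc (s ω) ρ ↔ t ∈ Ici (s ω) ∩ Ioc 0 ρ
        simp only [mem_Ioc, mem_inter_iff, mem_Ici]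
        constructor
        · rintro ⟨h1, h2⟩; exact ⟨h1.le, by linarith, h2⟩
        · rintro ⟨h1, h2, h3⟩; exact ⟨lt_of_le_of_ne h1 ht.symm, h3⟩
      · simp only [k₁, if_neg (not_le.2 hsρ)]
        rw [intervalIntegral.integral_congr (g := fun _ => (0 : E)),
          intervalIntegral.integral_zero, add_zero]
        intro t ht
        rw [uIcc_of_le hρ.1] at ht
        exact z t ht.1 (by linarith [ht.2])
    have j2 : Integrable (fun ω => B (g ω) (∫ σ in (0 : ℝ)..ρ, k₂ σ ω)) ν := by
      have hm2 : StronglyMeasurable fun ω => ∫ σ in (0 : ℝ)..ρ, k₂ σ ω := by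
        refine stronglyMeasurable_intervalIntegral (f := fun ω σ => k₂ σ ω) ?_ measurable_const
          measurable_const
        exact hk₂.comp_measurable measurable_swap
      refine (hg.norm.const_mul (‖B‖ * (C + C))).mono'
        (B.continuous₂.comp_aestronglyMeasurable₂ hg.1 hm2.aestronglyMeasurable) ?_
      -- The value `ρ = 0`, excluded in `hb₁`, is needed here.
      have hρ' : ∀ᵐ ω ∂ν, ‖k₁ ρ ω‖ ≤ C := by
        filter_upwards [hsη] with ω hω
        by_cases hsρ : s ω ≤ ρ
        · simp only [k₁, if_pos hsρ, waveMean]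
          rw [norm_smul]
          have h1 := hC (ρ - s ω + η ω) ⟨by linarith [hω.1], by linarith [hω.2, hρ.2]⟩
          have h2 := hC |ρ - s ω - η ω| ⟨by linarith [abs_nonneg (ρ - s ω - η ω)],
            abs_le.2 ⟨by linarith [hω.1, hω.2, hρ.2], by linarith [hω.1, hω.2, hρ.2]⟩⟩
          have h3 := norm_add_le (y (ρ - s ω + η ω)) (y |ρ - s ω - η ω|)
          norm_num
          linarith
        · simp only [k₁, if_neg hsρ, norm_zero]; exact hC0
      filter_upwards [hsη, hρ', hk₂i] with ω hω h1 h2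
      refine (B.le_opNorm₂ _ _).trans ?_
      have h3 : ‖(if s ω ≤ ρ then y (η ω) else 0)‖ ≤ C := by
        split_ifs with hsρ
        · exact hC _ ⟨by linarith [hω.1], by linarith [hω.2, hρ.2]⟩
        · rw [norm_zero]; exact hC0
      have h4 : ‖∫ σ in (0 : ℝ)..ρ, k₂ σ ω‖ ≤ C + C := by
        have : ∫ σ in (0 : ℝ)..ρ, k₂ σ ω = k₁ ρ ω - if s ω ≤ ρ then y (η ω) else 0 := by
          rw [h2]; abel
        rw [this]
        exact (norm_sub_le _ _).trans (add_le_add h1 h3)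
      calc _ ≤ ‖B‖ * ‖g ω‖ * (C + C) := by gcongr
        _ = _ := by ring
    rw [e4, ← integral_add j1 j2]
    refine integral_congr_ae ?_
    filter_upwards [hk₂i] with ω hω
    rw [hω, map_add]

end Superposition

/-! ### Volterra operators with bounded kernels. -/

section Volterra

variable {p : ℕ}

theorem stronglyMeasurable_act {α l m : Type*} [MeasurableSpace α] [Fintype l] [Fintype m]
    [DecidableEq l] [DecidableEq m] {f : α → Matrix l m ℂ} {g : α → EuclideanSpace ℂ m}
    (hf : StronglyMeasurable f) (hg : StronglyMeasurable g) :
    StronglyMeasurable fun a => act (f a) (g a) :=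
  (actR (l := l) (m := m)).continuous₂.comp_stronglyMeasurable (hf.prodMk hg)

/-- The Volterra operator with kernel `k`, applied to `f`. -/
def volterra (k : ℝ → ℝ → Matrix (Fin p) (Fin p) ℂ) (f : ℝ → EuclideanSpace ℂ (Fin p)) (x : ℝ) :
    EuclideanSpace ℂ (Fin p) :=
  ∫ t in (0 : ℝ)..x, act (k x t) (f t)

/-- A measurable kernel which is bounded on the triangle `0 ≤ t ≤ x ≤ r`. -/
structure IsBddKernel (r : ℝ) (k : ℝ → ℝ → Matrix (Fin p) (Fin p) ℂ) (C : ℝ) : Prop where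
  meas : StronglyMeasurable (Function.uncurry k)
  nonneg : 0 ≤ C
  bound : ∀ x t, 0 ≤ t → t ≤ x → x ≤ r → ‖k x t‖ ≤ C

variable {r C : ℝ} {k : ℝ → ℝ → Matrix (Fin p) (Fin p) ℂ} {f g : ℝ → EuclideanSpace ℂ (Fin p)}

theorem volterra_congr (h : f =ᵐ[volume.restrict (Ioo 0 r)] g) {x : ℝ} (hx : x ∈ Icc 0 r) :
    volterra k f x = volterra k g x := by
  refine integral_congr_of_ae_Ioo (r := r) ?_ (left_mem_Icc.2 (hx.1.trans hx.2)) hx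
  filter_upwards [h] with t ht
  rw [ht]

namespace IsBddKernel

variable (hk : IsBddKernel r k C)

include hk

theorem intervalIntegrable (hf : IntegrableOn f (Ioo 0 r)) {x : ℝ} (hx : x ∈ Icc 0 r) :
    IntervalIntegrable (fun t => act (k x t) (f t)) volume 0 x := by
  have hfi := intervalIntegrable_of_Ioo hf (left_mem_Icc.2 (hx.1.trans hx.2)) hx
  refine (hfi.norm.const_mul C).mono_fun' ?_ ?_
  · refine (actR (l := Fin p) (m := Fin p)).continuous₂.comp_aestronglyMeasurable₂ ?_
      hfi.aestronglyMeasurable_restrict_uIoc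
    exact (hk.meas.comp_measurable (g := fun t : ℝ => (x, t)) (by fun_prop)).aestronglyMeasurable
  · refine (ae_restrict_iff' measurableSet_uIoc).2 (Filter.Eventually.of_forall fun t ht => ?_)
    rw [uIoc_of_le hx.1] at ht
    exact (norm_act_le _ _).trans (mul_le_mul_of_nonneg_right (hk.bound x t ht.1.le ht.2 hx.2)
      (norm_nonneg _))

theorem norm_volterra_le (hf : IntegrableOn f (Ioo 0 r)) {x : ℝ} (hx : x ∈ Icc 0 r) :
    ‖volterra k f x‖ ≤ ∫ t in (0 : ℝ)..x, C * ‖f t‖ := by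
  have hfi := intervalIntegrable_of_Ioo hf (left_mem_Icc.2 (hx.1.trans hx.2)) hx
  refine intervalIntegral.norm_integral_le_of_norm_le hx.1 ?_ (hfi.norm.const_mul C)
  refine Filter.Eventually.of_forall fun t ht => ?_
  refine (norm_act_le _ _).trans ?_
  gcongr
  exact hk.bound x t ht.1.le ht.2 hx.2

theorem aestronglyMeasurable (hf : AEStronglyMeasurable f (volume.restrict (Ioo 0 r))) :
    AEStronglyMeasurable (volterra k f) (volume.restrict (Ioo 0 r)) := by
  have h1 : StronglyMeasurable (volterra k (hf.mk f)) :=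
    stronglyMeasurable_intervalIntegral (f := fun x t => act (k x t) (hf.mk f t))
      (stronglyMeasurable_act hk.meas (hf.stronglyMeasurable_mk.comp_measurable measurable_snd))
      measurable_const measurable_id
  refine h1.aestronglyMeasurable.congr ?_
  refine (ae_restrict_iff' measurableSet_Ioo).2 (Filter.Eventually.of_forall fun x hx => ?_)
  exact volterra_congr hf.ae_eq_mk.symm (Ioo_subset_Icc_self hx)

theorem memLp {q : ENNReal} (hf : IntegrableOn f (Ioo 0 r)) :
    MemLp (volterra k f) q (volume.restrict (Ioo 0 r)) := by
  refine MemLp.of_bound (C := ∫ t in Ioo 0 r, C * ‖f t‖) (hk.aestronglyMeasurable hf.1) ?_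
  refine (ae_restrict_iff' measurableSet_Ioo).2 (Filter.Eventually.of_forall fun x hx => ?_)
  refine (hk.norm_volterra_le hf (Ioo_subset_Icc_self hx)).trans ?_
  rw [intervalIntegral.integral_of_le hx.1.le]
  refine setIntegral_mono_set (hf.norm.const_mul C)
    (Filter.Eventually.of_forall fun t => mul_nonneg hk.nonneg (norm_nonneg _)) ?_
  exact LE.le.eventuallyLE fun t ht => ⟨ht.1, ht.2.trans_lt hx.2⟩

end IsBddKernel

end Volterra

/-! ### The integro-differential expression and its relation to the source of the kernel. -/

section Transformation

variable {p : ℕ} {q : Type*} [Fintype q] [DecidableEq q]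
  {u₄ : ℝ → Matrix (Fin p) (Fin p) ℂ} {h₁ : ℝ → Matrix (Fin p) q ℂ}
  {h₂ : ℝ → Matrix q (Fin p) ℂ} {r : ℝ}

/-- The integro-differential expression `u₄ z - h₁ ∫₀ˣ h₂ z`. -/
def potential (u₄ : ℝ → Matrix (Fin p) (Fin p) ℂ) (h₁ : ℝ → Matrix (Fin p) q ℂ)
    (h₂ : ℝ → Matrix q (Fin p) ℂ) (z : ℝ → EuclideanSpace ℂ (Fin p)) (x : ℝ) :
    EuclideanSpace ℂ (Fin p) :=
  act (u₄ x) (z x) - act (h₁ x) (∫ t in (0 : ℝ)..x, act (h₂ t) (z t))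

theorem potential_congr {z z' : ℝ → EuclideanSpace ℂ (Fin p)} (h : ∀ x ∈ Icc 0 r, z x = z' x)
    {x : ℝ} (hx : x ∈ Icc 0 r) : potential u₄ h₁ h₂ z x = potential u₄ h₁ h₂ z' x := by
  rw [potential, potential, h x hx]
  congr 2
  refine intervalIntegral.integral_congr fun t ht => ?_
  rw [uIcc_of_le hx.1] at ht
  simp only [h t ⟨ht.1, ht.2.trans hx.2⟩]

theorem memLp_potential (mu : MemLp u₄ 2 (volume.restrict (Ioo 0 r)))
    (m₁ : MemLp h₁ 2 (volume.restrict (Ioo 0 r))) (m₂ : MemLp h₂ 2 (volume.restrict (Ioo 0 r)))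
    {z : ℝ → EuclideanSpace ℂ (Fin p)} (hz : ContinuousOn z (Icc 0 r)) :
    MemLp (potential u₄ h₁ h₂ z) 2 (volume.restrict (Ioo 0 r)) := by
  have h1 : MemLp (fun t => act (u₄ t) (z t)) 2 (volume.restrict (Ioo 0 r)) :=
    memLp_bilin_left actR mu hz
  have h2 : MemLp (fun t => act (h₂ t) (z t)) 2 (volume.restrict (Ioo 0 r)) :=
    memLp_bilin_left actR m₂ hz
  have := (HasIntDeriv.of_integral (memLp_integrableOn_Ioo h2) 0).continuousOn
  simp only [zero_add] at this
  have h3 : MemLp (fun x => act (h₁ x) (∫ t in (0 : ℝ)..x, act (h₂ t) (z t))) 2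
      (volume.restrict (Ioo 0 r)) := memLp_bilin_left actR m₁ this
  exact h1.sub h3

namespace IsKernelData

variable (hd : IsKernelData r u₄ h₁ h₂)

include hd

theorem isBddKernel : ∃ C, IsBddKernel r (kernelSum r u₄ h₁ h₂) C := by
  obtain ⟨C, hC0, hC⟩ := hd.kernelSum_bound
  exact ⟨C, hd.meas_kernelSum, hC0, fun x t _ _ _ => hC x t⟩

theorem memLp_potential {z : ℝ → EuclideanSpace ℂ (Fin p)} (hz : ContinuousOn z (Icc 0 r)) :
    MemLp (potential u₄ h₁ h₂ z) 2 (volume.restrict (Ioo 0 r)) :=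
  CanonicalSystem.memLp_potential hd.memLp_u hd.memLp_h₁ hd.memLp_h₂ hz

/-- With `z = y + W y`, the three parts of the source integrate to `u₄ W y`, `-h₁ ∫ h₂ y` and `-h₁ ∫
h₂ (W y)`, the last one after an exchange of integrations. Together they form the expression for `z`
except for `u₄ y`, which comes from the diagonal. -/
theorem integral_source {y : ℝ → EuclideanSpace ℂ (Fin p)} (hy : Continuous y) {s : ℝ}
    (hs : s ∈ Icc 0 r) :
    ∫ η in (0 : ℝ)..s, act (kernelSource r u₄ h₁ h₂ s η) (y η) =
      potential u₄ h₁ h₂ (fun x => y x + volterra (kernelSum r u₄ h₁ h₂) y x) s -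
        act (u₄ s) (y s) := by
  obtain ⟨C, hk⟩ := hd.isBddKernel
  obtain ⟨D, hD⟩ := (isCompact_Icc (a := (0 : ℝ)) (b := r)).exists_bound_of_continuousOn
    hy.continuousOn
  have h0 : (0 : ℝ) ∈ Icc 0 r := left_mem_Icc.2 (hs.1.trans hs.2)
  have hyi : IntegrableOn y (Ioo 0 r) := hy.integrableOn_Icc.mono_set Ioo_subset_Icc_self
  set W := kernelSum r u₄ h₁ h₂ with hW
  have i1 := hk.intervalIntegrable hyi hs
  have i2 : ∀ x ∈ Icc 0 r, IntervalIntegrable (fun t => act (h₂ t) (y t)) volume 0 x := fun x hx =>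
    intervalIntegrable_of_Ioo
      (memLp_integrableOn_Ioo (memLp_bilin_left actR hd.memLp_h₂ hy.continuousOn)) h0 hx
  have iV : ∀ x ∈ Icc 0 r, IntervalIntegrable (fun t => act (h₂ t) (volterra W y t)) volume 0 x := by
    intro x hx
    refine intervalIntegrable_of_Ioo ?_ h0 hx
    have hb : ∀ᵐ t ∂(volume.restrict (Ioo 0 r)),
        ‖act (h₂ t) (volterra W y t)‖ ≤ (∫ t in Ioo 0 r, C * ‖y t‖) * ‖h₂ t‖ := by
      refine (ae_restrict_iff' measurableSet_Ioo).2 (Filter.Eventually.of_forall fun t ht => ?_)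
      refine (norm_act_le _ _).trans ?_
      rw [mul_comm]
      gcongr
      refine (hk.norm_volterra_le hyi (Ioo_subset_Icc_self ht)).trans ?_
      rw [intervalIntegral.integral_of_le ht.1.le]
      refine setIntegral_mono_set (hyi.norm.const_mul C)
        (Filter.Eventually.of_forall fun t => mul_nonneg hk.nonneg (norm_nonneg _)) ?_
      exact LE.le.eventuallyLE fun τ hτ => ⟨hτ.1, hτ.2.trans_lt ht.2⟩
    refine ((memLp_integrableOn_Ioo hd.memLp_h₂).norm.const_mul _).mono' ?_ hb
    exact (actR (l := q) (m := Fin p)).continuous₂.comp_aestronglyMeasurable₂ hd.memLp_h₂.1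
      (hk.aestronglyMeasurable hyi.1)
  have hsw : IntegrableOn (fun z : ℝ × ℝ => act (h₁ s * h₂ z.1 * W z.1 z.2) (y z.2))
      (Ioc 0 s ×ˢ Ioc 0 s) := by
    have hh2 : IntegrableOn h₂ (Ioc 0 s) := by
      rw [integrableOn_Ioc_iff_integrableOn_Ioo]
      exact (memLp_integrableOn_Ioo hd.memLp_h₂).mono_set (Ioo_subset_Ioo_right hs.2)
    have hdom : IntegrableOn (fun z : ℝ × ℝ => ‖h₁ s‖ * C * |D| * ‖h₂ z.1‖)
        (Ioc 0 s ×ˢ Ioc 0 s) := by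
      rw [IntegrableOn, Measure.volume_eq_prod, ← Measure.prod_restrict]
      exact (Integrable.comp_fst (f := fun τ => ‖h₂ τ‖) hh2.norm _).const_mul _
    refine hdom.mono' ?_ ?_
    · refine (stronglyMeasurable_act (stronglyMeasurable_mul (stronglyMeasurable_mul
        stronglyMeasurable_const ?_) hk.meas) ?_).aestronglyMeasurable
      · exact hd.meas_h₂.comp_measurable measurable_fst
      · exact hy.stronglyMeasurable.comp_measurable measurable_snd
    · refine (ae_restrict_iff' (measurableSet_Ioc.prod measurableSet_Ioc)).2
        (Filter.Eventually.of_forall fun z hz => ?_)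
      obtain ⟨hz1, hz2⟩ := hz
      obtain ⟨C', hC', hCb⟩ := hd.kernelSum_bound
      calc ‖act (h₁ s * h₂ z.1 * W z.1 z.2) (y z.2)‖
          ≤ ‖h₁ s * h₂ z.1 * W z.1 z.2‖ * ‖y z.2‖ := norm_act_le _ _
        _ ≤ ‖h₁ s * h₂ z.1‖ * ‖W z.1 z.2‖ * ‖y z.2‖ := by
            gcongr; exact Matrix.l2_opNorm_mul _ _
        _ ≤ ‖h₁ s‖ * ‖h₂ z.1‖ * C * |D| := by
            -- The integrability is needed on the whole square; above the diagonal `kernelSum` is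
            -- zero by definition.
            have hWb : ‖W z.1 z.2‖ ≤ C := by
              by_cases hle : z.2 ≤ z.1
              · exact hk.bound _ _ hz2.1.le hle (hz1.2.trans hs.2)
              · have : W z.1 z.2 = 0 := if_neg fun h => hle h.2.1
                rw [this, norm_zero]; exact hk.nonneg
            have hDb : ‖y z.2‖ ≤ |D| :=
              (hD _ ⟨hz2.1.le, hz2.2.trans hs.2⟩).trans (le_abs_self D)
            have := Matrix.l2_opNorm_mul (h₁ s) (h₂ z.1)
            have := hk.nonneg
            gcongr
        _ = _ := by ring
  have e3 : ∀ η ∈ uIcc 0 s, act (kernelComp h₁ h₂ W s η) (y η) =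
      ∫ τ in η..s, act (h₁ s * h₂ τ * W τ η) (y η) := by
    intro η hη
    rw [uIcc_of_le hs.1] at hη
    have hii := hd.comp_intervalIntegrable hd.meas_kernelSum hk.bound hη.1 hη.2 hs.2
    exact (((actR (l := Fin p) (m := Fin p)).flip (y η)).intervalIntegral_comp_comm hii).symm
  have e4 : ∫ η in (0 : ℝ)..s, act (kernelComp h₁ h₂ W s η) (y η) =
      act (h₁ s) (∫ τ in (0 : ℝ)..s, act (h₂ τ) (volterra W y τ)) := by
    rw [intervalIntegral.integral_congr e3, ← integral_triangle_swap hs.1 hsw]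
    have := (actR (h₁ s)).intervalIntegral_comp_comm (iV s hs)
    simp only [actR_apply] at this
    rw [← this]
    refine intervalIntegral.integral_congr fun τ hτ => ?_
    rw [uIcc_of_le hs.1] at hτ
    have h5 := (actR (h₁ s * h₂ τ)).intervalIntegral_comp_comm
      (hk.intervalIntegrable hyi (x := τ) ⟨hτ.1, hτ.2.trans hs.2⟩)
    simp only [actR_apply] at h5
    simp only [act_act]
    rw [volterra, ← h5]
    simp only [act_act]
  have i3 : IntervalIntegrable (fun η => act (kernelComp h₁ h₂ W s η) (y η)) volume 0 s := by
    refine (intervalIntegrable_const (c := ‖h₁ s‖ * (∫ τ in (0 : ℝ)..r, ‖h₂ τ‖) * C * |D|)).mono_fun'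
      ?_ ?_
    · refine (stronglyMeasurable_act ?_ hy.stronglyMeasurable).aestronglyMeasurable
      exact (hd.meas_comp hk.meas).comp_measurable (g := fun η : ℝ => (s, η)) (by fun_prop)
    · refine (ae_restrict_iff' measurableSet_uIoc).2 (Filter.Eventually.of_forall fun η hη => ?_)
      rw [uIoc_of_le hs.1] at hη
      refine (norm_act_le _ _).trans ?_
      have h7 := hd.norm_comp_le (W := W) hη.1.le hη.2 hs.2 hk.nonneg
        fun τ h1 h2 => hk.bound τ η hη.1.le h1 (h2.trans hs.2)
      have hDb : ‖y η‖ ≤ |D| := (hD _ ⟨hη.1.le, hη.2.trans hs.2⟩).trans (le_abs_self D)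
      have : 0 ≤ ∫ τ in (0 : ℝ)..r, ‖h₂ τ‖ :=
        intervalIntegral.integral_nonneg (hs.1.trans hs.2) fun _ _ => norm_nonneg _
      exact mul_le_mul h7 hDb (norm_nonneg _)
        (mul_nonneg (mul_nonneg (norm_nonneg _) this) hk.nonneg)
  have e1 := (actR (u₄ s)).intervalIntegral_comp_comm i1
  have e2 := (actR (h₁ s)).intervalIntegral_comp_comm (i2 s hs)
  have j1 := (actR (u₄ s)).integrable_comp (intervalIntegrable_iff.1 i1)
  have j2 := (actR (h₁ s)).integrable_comp (intervalIntegrable_iff.1 (i2 s hs))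
  simp only [actR_apply, act_act] at e1 e2 j1 j2
  have hsplit : ∀ η, act (kernelSource r u₄ h₁ h₂ s η) (y η) = act (u₄ s * W s η) (y η) -
      act (h₁ s * h₂ η) (y η) - act (kernelComp h₁ h₂ W s η) (y η) := by
    intro η; rw [kernelSource, sub_act, sub_act]
  simp only [hsplit]
  rw [intervalIntegral.integral_sub ((intervalIntegrable_iff.2 j1).sub (intervalIntegrable_iff.2 j2))
    i3, intervalIntegral.integral_sub (intervalIntegrable_iff.2 j1) (intervalIntegrable_iff.2 j2),
    e1, e2, e4, potential]
  have hadd : ∫ t in (0 : ℝ)..s, act (h₂ t) (y t + volterra W y t) =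
      (∫ t in (0 : ℝ)..s, act (h₂ t) (y t)) + ∫ t in (0 : ℝ)..s, act (h₂ t) (volterra W y t) := by
    rw [← intervalIntegral.integral_add (i2 s hs) (iV s hs)]
    simp only [act_add]
  rw [hadd, act_add, act_add, volterra]
  abel

end IsKernelData

end Transformation

theorem setIntegral_triangle {E : Type*} [NormedAddCommGroup E] [NormedSpace ℝ E] {r ρ : ℝ}
    (hρ : ρ ∈ Icc 0 r) {H : ℝ × ℝ → E} (hH : IntegrableOn H (triangle r)) :
    ∫ z in triangle r, (if z.1 ≤ ρ then H z else 0) =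
      ∫ s in (0 : ℝ)..ρ, ∫ η in (0 : ℝ)..s, H (s, η) := by
  have hsub : triangle ρ ⊆ triangle r := fun z hz => ⟨hz.1, hz.2.1, hz.2.2.trans hρ.2⟩
  have hi : Integrable ((triangle ρ).indicator H) (volume.prod volume) := by
    rw [← Measure.volume_eq_prod]
    exact (integrable_indicator_iff (measurableSet_triangle ρ)).2 (hH.mono_set hsub)
  calc ∫ z in triangle r, (if z.1 ≤ ρ then H z else 0)
      = ∫ z in triangle r, (triangle ρ).indicator H z := by
        refine setIntegral_congr_fun (measurableSet_triangle r) fun z hz => ?_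
        by_cases h : z.1 ≤ ρ
        · simp only [if_pos h]
          rw [indicator_of_mem (by exact ⟨hz.1, hz.2.1, h⟩)]
        · simp only [if_neg h]
          rw [indicator_of_notMem (by exact fun h' => h h'.2.2)]
    _ = ∫ z, (triangle ρ).indicator H z ∂(volume.prod volume) := by
        rw [integral_indicator (measurableSet_triangle ρ), Measure.restrict_restrict
          (measurableSet_triangle ρ), inter_eq_left.2 hsub,
          ← integral_indicator (measurableSet_triangle ρ), Measure.volume_eq_prod]
    _ = ∫ s, ∫ η, (triangle ρ).indicator H (s, η) := integral_prod _ hi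
    _ = ∫ s, (Ioc 0 ρ).indicator (fun s => ∫ η in (0 : ℝ)..s, H (s, η)) s := by
        congr 1
        ext1 s
        by_cases hs : s ∈ Ioc 0 ρ
        · rw [indicator_of_mem hs, intervalIntegral.integral_of_le hs.1.le,
            integral_Ioc_eq_integral_Ioo, ← integral_indicator measurableSet_Ioo]
          congr 1
          ext1 η
          by_cases hη : η ∈ Ioo 0 s
          · rw [indicator_of_mem hη, indicator_of_mem (by exact ⟨hη.1, hη.2, hs.2⟩)]
          · rw [indicator_of_notMem hη, indicator_of_notMem]
            exact fun h => hη ⟨h.1, h.2.1⟩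
        · rw [indicator_of_notMem hs]
          have : (fun η => (triangle ρ).indicator H (s, η)) = fun _ => 0 := by
            ext1 η
            rw [indicator_of_notMem]
            exact fun h => hs ⟨h.1.trans h.2.1, h.2.2⟩
          rw [this, integral_zero]
    _ = ∫ s in (0 : ℝ)..ρ, ∫ η in (0 : ℝ)..s, H (s, η) := by
        rw [integral_indicator measurableSet_Ioc, intervalIntegral.integral_of_le hρ.1]

/-! ### The action of the kernel on functions of class `𝒰`. -/

section Transformation

variable {p : ℕ} {q : Type*} [Fintype q] [DecidableEq q]
  {u₄ : ℝ → Matrix (Fin p) (Fin p) ℂ} {h₁ : ℝ → Matrix (Fin p) q ℂ}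
  {h₂ : ℝ → Matrix q (Fin p) ℂ} {r : ℝ}

namespace IsKernelData

variable (hd : IsKernelData r u₄ h₁ h₂)

include hd

/-- The jumps of the diagonal sources add up to `∫ u₄ y` and those of the sources in the triangle to
the integral of `potential z - u₄ y`, so `u₄ y` cancels and the expression for `z` itself remains.
The reflecting boundary is the reason why `y'(0)` enters the second derivative but `y(0)` does not.
-/
theorem hasU_of_isGlobalU (hr : 0 ≤ r) {y y' y'' : ℝ → EuclideanSpace ℂ (Fin p)}
    (h : IsGlobalU y y' y'') (h2 : MemLp y'' 2 (volume.restrict (Ioo 0 r))) :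
    ∃ z', z' 0 = y' 0 ∧
      HasU r (fun x => y x + volterra (kernelSum r u₄ h₁ h₂) y x) z' fun x =>
        potential u₄ h₁ h₂ (fun x => y x + volterra (kernelSum r u₄ h₁ h₂) y x) x +
          (y'' x + volterra (kernelSum r u₄ h₁ h₂) y'' x) +
            act (kernelSum r u₄ h₁ h₂ x 0) (y' 0) := by
  obtain ⟨C, hk⟩ := hd.isBddKernel
  set W := kernelSum r u₄ h₁ h₂ with hW
  have h0 : (0 : ℝ) ∈ Icc 0 r := left_mem_Icc.2 hr
  have hy := h.continuous
  have iu : Integrable u₄ (volume.restrict (Ioc 0 r)) := by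
    change IntegrableOn u₄ (Ioc 0 r)
    rw [integrableOn_Ioc_iff_integrableOn_Ioo]; exact memLp_integrableOn_Ioo hd.memLp_u
  have is : Integrable (Function.uncurry (kernelSource r u₄ h₁ h₂)) (volume.restrict (triangle r)) :=
    hd.integrableOn_source
  have hs1 : ∀ᵐ s ∂(volume.restrict (Ioc 0 r)), 0 ≤ id s ∧ id s ≤ id s :=
    (ae_restrict_iff' measurableSet_Ioc).2
      (Filter.Eventually.of_forall fun s hs => ⟨hs.1.le, le_rfl⟩)
  have hs2 : ∀ᵐ z ∂((volume : Measure (ℝ × ℝ)).restrict (triangle r)), 0 ≤ z.2 ∧ z.2 ≤ z.1 :=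
    (ae_restrict_iff' (measurableSet_triangle r)).2
      (Filter.Eventually.of_forall fun z hz => ⟨hz.1.le, hz.2.1.le⟩)
  -- The kernel is split into the waves emitted on the diagonal (`Pa`) and inside the triangle
  -- (`Pb`).
  let Pa := waveSum (volume.restrict (Ioc 0 r)) id id u₄
  let Pb := waveSum ((volume : Measure (ℝ × ℝ)).restrict (triangle r)) Prod.fst Prod.snd
    (Function.uncurry (kernelSource r u₄ h₁ h₂))
  have hP : ∀ x t, 0 ≤ t → t ≤ x → x ≤ r → W x t = Pa x t + Pb x t := fun x t h1 h2 h3 =>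
    hd.kernelSum_eq h1 h2 h3
  obtain ⟨Na, iNa, eNa, iKa, fNa⟩ := h.integral_waveSum (actR (l := Fin p) (m := Fin p))
    measurable_id measurable_id hs1 iu r
  obtain ⟨Nb, iNb, eNb, iKb, fNb⟩ := h.integral_waveSum (actR (l := Fin p) (m := Fin p))
    measurable_fst measurable_snd hs2 is r
  have hvol : ∀ f : ℝ → EuclideanSpace ℂ (Fin p), LocallyIntegrable f → ∀ x ∈ Icc 0 r,
      volterra W f x = (∫ t in (0 : ℝ)..x, actR (Pa x t) (f t)) +
        ∫ t in (0 : ℝ)..x, actR (Pb x t) (f t) := by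
    intro f hf x hx
    have hfi : IntegrableOn f (Ioc 0 x) :=
      (hf.integrableOn_isCompact (isCompact_Icc (a := 0) (b := x))).mono_set Ioc_subset_Icc_self
    rw [← intervalIntegral.integral_add
      (integral_waveSum actR measurable_id measurable_id iu hx.1 hfi).1
      (integral_waveSum actR measurable_fst measurable_snd is hx.1 hfi).1]
    refine intervalIntegral.integral_congr fun t ht => ?_
    rw [uIcc_of_le hx.1] at ht
    simp only [hP x t ht.1 ht.2 hx.2, add_act, actR_apply]
    rfl
  have hvoly := hvol y hy.locallyIntegrable
  have Dy : HasIntDeriv r y y' := by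
    refine ⟨h.continuous_deriv.integrableOn_Icc.mono_set Ioo_subset_Icc_self, fun x _ => ?_⟩
    rw [intervalIntegral.integral_eq_sub_of_hasDerivAt (fun t _ => h.hasDerivAt t)
      (h.continuous_deriv.intervalIntegrable _ _)]
    abel
  have Dy' : HasIntDeriv r y' y'' := ⟨h.integrable.integrableOn, fun x _ => h.deriv_eq x⟩
  have Dz : HasIntDeriv r (fun x => y x + volterra W y x) fun x => y' x + (Na x + Nb x) := by
    refine Dy.add ⟨iNa.add iNb, fun x hx => ?_⟩
    rw [hvoly x hx, eNa x hx, eNb x hx, intervalIntegral.integral_add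
      (intervalIntegrable_of_Ioo iNa h0 hx) (intervalIntegrable_of_Ioo iNb h0 hx)]
    simp [volterra]
  set z := fun x => y x + volterra W y x with hz
  have mpot := hd.memLp_potential Dz.continuousOn
  have ipot := memLp_integrableOn_Ioo mpot
  have hma : ∀ ρ ∈ Icc 0 r, ∫ ω in Ioc 0 r, actR (u₄ ω) (if id ω ≤ ρ then y (id ω) else 0) =
      ∫ s in (0 : ℝ)..ρ, act (u₄ s) (y s) := by
    intro ρ hρ
    have e : (fun ω => actR (u₄ ω) (if id ω ≤ ρ then y (id ω) else 0)) =
        (Iic ρ).indicator fun s => act (u₄ s) (y s) := by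
      ext1 s
      by_cases hs : s ≤ ρ
      · rw [indicator_of_mem (by exact hs)]; simp [hs]
      · rw [indicator_of_notMem (by exact hs)]; simp [hs, act_zero]
    rw [e, integral_indicator measurableSet_Iic, Measure.restrict_restrict measurableSet_Iic,
      inter_comm, Ioc_inter_Iic, min_eq_right hρ.2, intervalIntegral.integral_of_le hρ.1]
  have iuy : IntegrableOn (fun s => act (u₄ s) (y s)) (Ioo 0 r) :=
    memLp_integrableOn_Ioo (memLp_bilin_left actR hd.memLp_u hy.continuousOn)
  have hmb : ∀ ρ ∈ Icc 0 r, ∫ ω in triangle r, actR (Function.uncurry (kernelSource r u₄ h₁ h₂) ω)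
      (if ω.1 ≤ ρ then y ω.2 else 0) =
      ∫ s in (0 : ℝ)..ρ, (potential u₄ h₁ h₂ z s - act (u₄ s) (y s)) := by
    intro ρ hρ
    obtain ⟨D, hD⟩ := (isCompact_Icc (a := (0 : ℝ)) (b := r)).exists_bound_of_continuousOn
      hy.continuousOn
    have hH : IntegrableOn (fun z : ℝ × ℝ => act (kernelSource r u₄ h₁ h₂ z.1 z.2) (y z.2))
        (triangle r) := by
      refine (is.norm.mul_const D).mono' ?_ ?_
      · exact (actR (l := Fin p) (m := Fin p)).continuous₂.comp_aestronglyMeasurable₂ is.1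
          (hy.stronglyMeasurable.comp_measurable measurable_snd).aestronglyMeasurable
      · refine (ae_restrict_iff' (measurableSet_triangle r)).2
          (Filter.Eventually.of_forall fun z hz => ?_)
        exact (norm_act_le _ _).trans (mul_le_mul_of_nonneg_left
          (hD _ ⟨hz.1.le, hz.2.1.le.trans hz.2.2⟩) (norm_nonneg _))
    have e := setIntegral_triangle hρ hH
    have e' : ∀ ω : ℝ × ℝ, actR (Function.uncurry (kernelSource r u₄ h₁ h₂) ω)
        (if ω.1 ≤ ρ then y ω.2 else 0) =
        if ω.1 ≤ ρ then act (kernelSource r u₄ h₁ h₂ ω.1 ω.2) (y ω.2) else 0 := by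
      intro ω
      split_ifs
      · rfl
      · exact map_zero _
    simp only [e']
    rw [e]
    refine intervalIntegral.integral_congr fun s hs => ?_
    rw [uIcc_of_le hρ.1] at hs
    exact hd.integral_source hy ⟨hs.1, hs.2.trans hρ.2⟩
  have hK : ∀ σ ∈ Icc 0 r, ((∫ t in (0 : ℝ)..σ, actR (Pa σ t) (y'' t)) + actR (Pa σ 0) (y' 0)) +
      ((∫ t in (0 : ℝ)..σ, actR (Pb σ t) (y'' t)) + actR (Pb σ 0) (y' 0)) =
      volterra W y'' σ + act (W σ 0) (y' 0) := by
    intro σ hσ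
    rw [hvol _ h.integrable.locallyIntegrable σ hσ, hP σ 0 le_rfl hσ.1 hσ.2, add_act]
    simp only [actR_apply]
    abel
  have Dz' : HasIntDeriv r (fun x => y' x + (Na x + Nb x)) fun x =>
      y'' x + (potential u₄ h₁ h₂ z x + (volterra W y'' x + act (W x 0) (y' 0))) := by
    have iK : IntegrableOn (fun x => volterra W y'' x + act (W x 0) (y' 0)) (Ioo 0 r) :=
      (iKa.add iKb).congr_fun (fun σ hσ => hK σ (Ioo_subset_Icc_self hσ)) measurableSet_Ioo
    have main : ∀ ρ ∈ Icc 0 r, Na ρ + Nb ρ = ∫ x in (0 : ℝ)..ρ,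
        (potential u₄ h₁ h₂ z x + (volterra W y'' x + act (W x 0) (y' 0))) := by
      intro ρ hρ
      have c1 := intervalIntegrable_of_Ioo iuy h0 hρ
      have c2 := intervalIntegrable_of_Ioo ipot h0 hρ
      rw [fNa ρ hρ, fNb ρ hρ, hma ρ hρ, hmb ρ hρ, intervalIntegral.integral_sub c2 c1,
        intervalIntegral.integral_add c2 (intervalIntegrable_of_Ioo iK h0 hρ)]
      have : ∫ x in (0 : ℝ)..ρ, (volterra W y'' x + act (W x 0) (y' 0)) =
          (∫ σ in (0 : ℝ)..ρ, ((∫ t in (0 : ℝ)..σ, actR (Pa σ t) (y'' t)) + actR (Pa σ 0) (y' 0))) +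
          ∫ σ in (0 : ℝ)..ρ, ((∫ t in (0 : ℝ)..σ, actR (Pb σ t) (y'' t)) + actR (Pb σ 0) (y' 0)) := by
        rw [← intervalIntegral.integral_add (intervalIntegrable_of_Ioo iKa h0 hρ)
          (intervalIntegrable_of_Ioo iKb h0 hρ)]
        refine intervalIntegral.integral_congr fun σ hσ => ?_
        rw [uIcc_of_le hρ.1] at hσ
        exact (hK σ ⟨hσ.1, hσ.2.trans hρ.2⟩).symm
      rw [this]
      abel
    refine Dy'.add ⟨ipot.add iK, fun x hx => ?_⟩
    simp only [main x hx, main 0 h0, intervalIntegral.integral_same, zero_add]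
  refine ⟨fun x => y' x + (Na x + Nb x), ?_, ?_⟩
  · have z1 : Na 0 = 0 := by
      rw [fNa 0 h0, hma 0 h0, intervalIntegral.integral_same, intervalIntegral.integral_same,
        add_zero]
    have z2 : Nb 0 = 0 := by
      rw [fNb 0 h0, hmb 0 h0, intervalIntegral.integral_same, intervalIntegral.integral_same,
        add_zero]
    simp only [z1, z2, add_zero]
  · have e : (fun x => y'' x + (potential u₄ h₁ h₂ z x + (volterra W y'' x + act (W x 0) (y' 0)))) =
        fun x => potential u₄ h₁ h₂ z x + (y'' x + volterra W y'' x) + act (W x 0) (y' 0) := by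
      ext1 x; abel
    rw [e] at Dz'
    refine Dz.hasU Dz' ((mpot.add (h2.add (hk.memLp h.integrable.integrableOn))).add ?_)
    refine MemLp.of_bound (C := C * ‖y' 0‖) ?_ ?_
    · refine (stronglyMeasurable_act ?_ stronglyMeasurable_const).aestronglyMeasurable
      exact hk.meas.comp_measurable (g := fun x : ℝ => (x, (0 : ℝ))) (by fun_prop)
    · refine (ae_restrict_iff' measurableSet_Ioo).2 (Filter.Eventually.of_forall fun x hx => ?_)
      exact (norm_act_le _ _).trans (mul_le_mul_of_nonneg_right
        (hk.bound x 0 le_rfl hx.1.le hx.2.le) (norm_nonneg _))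

/-- The transformation operator intertwines the second derivative with the integro-differential
expression `z'' - u₄ z + h₁ ∫₀ˣ h₂ z`. -/
theorem hasU_transform (hr : 0 ≤ r) {y y' y'' : ℝ → EuclideanSpace ℂ (Fin p)}
    (h : HasU r y y' y'') :
    ∃ z', z' 0 = y' 0 ∧
      HasU r (fun x => y x + volterra (kernelSum r u₄ h₁ h₂) y x) z' fun x =>
        potential u₄ h₁ h₂ (fun x => y x + volterra (kernelSum r u₄ h₁ h₂) y x) x +
          (y'' x + volterra (kernelSum r u₄ h₁ h₂) y'' x) +
            act (kernelSum r u₄ h₁ h₂ x 0) (y' 0) := by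
  obtain ⟨Y, Y', Y'', hY, e, e', e''⟩ := h.exists_isGlobalU
  have h0 : (0 : ℝ) ∈ Icc 0 r := left_mem_Icc.2 hr
  obtain ⟨z', hz0, hz⟩ := hd.hasU_of_isGlobalU hr hY ((memLp_congr_ae e'').2 h.2.1)
  have hae : Y =ᵐ[volume.restrict (Ioo 0 r)] y :=
    (ae_restrict_iff' measurableSet_Ioo).2
      (Filter.Eventually.of_forall fun x hx => e x (Ioo_subset_Icc_self hx))
  have ez : ∀ x ∈ Icc 0 r, Y x + volterra (kernelSum r u₄ h₁ h₂) Y x =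
      y x + volterra (kernelSum r u₄ h₁ h₂) y x := fun x hx => by
    rw [e x hx, volterra_congr hae hx]
  refine ⟨z', by rw [hz0, e' 0 h0], ?_⟩
  have d2 : (fun x => potential u₄ h₁ h₂ (fun x => Y x + volterra (kernelSum r u₄ h₁ h₂) Y x) x +
          (Y'' x + volterra (kernelSum r u₄ h₁ h₂) Y'' x) +
            act (kernelSum r u₄ h₁ h₂ x 0) (Y' 0)) =ᵐ[volume.restrict (Ioo 0 r)]
      fun x => potential u₄ h₁ h₂ (fun x => y x + volterra (kernelSum r u₄ h₁ h₂) y x) x +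
          (y'' x + volterra (kernelSum r u₄ h₁ h₂) y'' x) +
            act (kernelSum r u₄ h₁ h₂ x 0) (y' 0) := by
    filter_upwards [e'', ae_restrict_mem measurableSet_Ioo] with x hx hm
    have hmc := Ioo_subset_Icc_self hm
    rw [potential_congr ez hmc, hx, volterra_congr e'' hmc, e' 0 h0]
  exact (hz.hasIntDeriv.congr ez).hasU (hz.hasIntDeriv_deriv.congr_ae d2)
    ((memLp_congr_ae d2).1 hz.2.1)

end IsKernelData

end Transformation

/-! ### Independence of the representatives of the data. -/

section Congruence

variable {p : ℕ} {q : Type*} [Fintype q] [DecidableEq q] {r : ℝ}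
  {u₄ u₄' : ℝ → Matrix (Fin p) (Fin p) ℂ} {h₁ h₁' : ℝ → Matrix (Fin p) q ℂ}
  {h₂ h₂' : ℝ → Matrix q (Fin p) ℂ}

/-- The terms of the series depend only on the classes of the data modulo null sets. -/
theorem kernelTerm_congr (hu : u₄ =ᵐ[volume.restrict (Ioo 0 r)] u₄')
    (e₁ : h₁ =ᵐ[volume.restrict (Ioo 0 r)] h₁') (e₂ : h₂ =ᵐ[volume.restrict (Ioo 0 r)] h₂')
    (k : ℕ) {x ζ : ℝ} (hζ : 0 ≤ ζ) (hζx : ζ ≤ x) (hx : x ≤ r) :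
    kernelTerm u₄ (fun s η => h₁ s * h₂ η) k x ζ =
      kernelTerm u₄' (fun s η => h₁' s * h₂' η) k x ζ := by
  induction k generalizing x ζ with
  | zero =>
    have h0 : (0 : ℝ) ∈ Icc 0 r := left_mem_Icc.2 (by linarith)
    simp only [kernelTerm]
    rw [kernelFirst_eq, kernelFirst_eq,
      integral_congr_of_ae_Ioo hu h0 (b := (x + ζ) / 2) ⟨by linarith, by linarith⟩,
      integral_congr_of_ae_Ioo hu h0 (b := (x - ζ) / 2) ⟨by linarith, by linarith⟩]
    congr 1
    refine charInt_congr (r := r) ?_ hζ hζx hx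
    filter_upwards [e₂] with η hη
    filter_upwards [e₁] with s hs _
    rw [hη, hs]
  | succ k ih =>
    simp only [kernelTerm]
    rw [kernelStep_eq, kernelStep_eq]
    congr 1
    · refine charInt_congr (r := r) ?_ hζ hζx hx
      filter_upwards [ae_restrict_mem measurableSet_Ioo] with η hη
      filter_upwards [hu, ae_restrict_mem measurableSet_Ioo] with s hs hm hηs
      rw [hs, ih hη.1.le hηs.le hm.2.le]
    · refine charInt_congr (r := r) ?_ hζ hζx hx
      filter_upwards [ae_restrict_mem measurableSet_Ioo] with η hη
      filter_upwards [e₁, ae_restrict_mem measurableSet_Ioo] with s hs hm hηs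
      simp only [kernelComp, hs]
      refine intervalIntegral.integral_congr_ae ?_
      filter_upwards [(ae_restrict_iff' measurableSet_Ioo).1 e₂] with τ hτ hmτ
      rw [uIoc_of_le hηs.le] at hmτ
      rw [hτ ⟨hη.1.trans hmτ.1, hmτ.2.trans_lt hm.2⟩,
        ih hη.1.le hmτ.1.le (hmτ.2.trans hm.2.le)]

theorem potential_congr_ae (hu : u₄ =ᵐ[volume.restrict (Ioo 0 r)] u₄')
    (e₁ : h₁ =ᵐ[volume.restrict (Ioo 0 r)] h₁') (e₂ : h₂ =ᵐ[volume.restrict (Ioo 0 r)] h₂')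
    (z : ℝ → EuclideanSpace ℂ (Fin p)) :
    potential u₄ h₁ h₂ z =ᵐ[volume.restrict (Ioo 0 r)] potential u₄' h₁' h₂' z := by
  filter_upwards [hu, e₁, ae_restrict_mem measurableSet_Ioo] with x hx h1 hm
  rw [potential, potential, hx, h1, integral_congr_of_ae_Ioo (r := r) (g := fun t => act (h₂' t) (z t))
    ?_ (left_mem_Icc.2 (hm.1.trans hm.2).le) (Ioo_subset_Icc_self hm)]
  filter_upwards [e₂] with t ht
  rw [ht]

/-- The kernel for square integrable data, with its transformation property. -/
theorem exists_kernel (hr : 0 ≤ r) (mu : MemLp u₄ 2 (volume.restrict (Ioo 0 r)))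
    (m₁ : MemLp h₁ 2 (volume.restrict (Ioo 0 r))) (m₂ : MemLp h₂ 2 (volume.restrict (Ioo 0 r))) :
    ∃ (W : ℝ → ℝ → Matrix (Fin p) (Fin p) ℂ) (C : ℝ), IsBddKernel r W C ∧
      (∀ x ζ, 0 ≤ ζ → ζ ≤ x → x ≤ r →
        W x ζ = ∑' k, kernelTerm u₄ (fun s η => h₁ s * h₂ η) k x ζ) ∧
      ∀ y y' y'' : ℝ → EuclideanSpace ℂ (Fin p), HasU r y y' y'' →
        ∃ z', z' 0 = y' 0 ∧ HasU r (fun x => y x + volterra W y x) z' fun x =>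
          potential u₄ h₁ h₂ (fun x => y x + volterra W y x) x + (y'' x + volterra W y'' x) +
            act (W x 0) (y' 0) := by
  have eu := mu.1.ae_eq_mk
  have e₁ := m₁.1.ae_eq_mk
  have e₂ := m₂.1.ae_eq_mk
  -- The kernel is built from strongly measurable representatives, for which Fubini's theorem is
  -- available; `kernelTerm_congr` shows that the series of the original data has the same terms.
  have hd : IsKernelData r (mu.1.mk u₄) (m₁.1.mk h₁) (m₂.1.mk h₂) :=
    ⟨mu.1.stronglyMeasurable_mk, m₁.1.stronglyMeasurable_mk, m₂.1.stronglyMeasurable_mk,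
      (memLp_congr_ae eu).1 mu, (memLp_congr_ae e₁).1 m₁, (memLp_congr_ae e₂).1 m₂⟩
  obtain ⟨C, hk⟩ := hd.isBddKernel
  refine ⟨_, C, hk, fun x ζ hζ hζx hx => ?_, fun y y' y'' hy => ?_⟩
  · rw [kernelSum_of_mem hζ hζx hx]
    exact tsum_congr fun k => (kernelTerm_congr eu e₁ e₂ k hζ hζx hx).symm
  · obtain ⟨z', h0, hz⟩ := hd.hasU_transform hr hy
    have hae := potential_congr_ae eu e₁ e₂
      fun x => y x + volterra (kernelSum r (mu.1.mk u₄) (m₁.1.mk h₁) (m₂.1.mk h₂)) y x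
    have hae' : _ =ᵐ[volume.restrict (Ioo 0 r)] _ := (hae.symm.add
      (Filter.EventuallyEq.refl _ fun x => (y'' x + volterra (kernelSum r (mu.1.mk u₄) (m₁.1.mk h₁) (m₂.1.mk h₂)) y'' x))).add
      (Filter.EventuallyEq.refl _ fun x =>
        act (kernelSum r (mu.1.mk u₄) (m₁.1.mk h₁) (m₂.1.mk h₂) x 0) (y' 0))
    exact ⟨z', h0, hz.hasIntDeriv.hasU (hz.hasIntDeriv_deriv.congr_ae hae')
      ((memLp_congr_ae hae').1 hz.2.1)⟩

end Congruence

/-! ### Regularity of `q`, `u`, `Z`, `u₄`, `h₁`, `h₂`, and invertibility of `β₂`. -/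

section Coefficients

variable {m₁ m₂ : ℕ} {r : ℝ} {β β' β'' : ℝ → Matrix (Fin m₂) (Fin m₁ ⊕ Fin m₂) ℂ}

theorem jMat_conjTranspose : (jMat m₁ m₂)ᴴ = jMat m₁ m₂ := by
  simp [jMat, Matrix.fromBlocks_conjTranspose]

theorem qFun_conjTranspose (x : ℝ) : (qFun β' x)ᴴ = -qFun β' x := by
  simp [qFun, Matrix.conjTranspose_mul, jMat_conjTranspose, Matrix.mul_assoc]

/-- The derivative of `q`. -/
def qDeriv (β' β'' : ℝ → Matrix (Fin m₂) (Fin m₁ ⊕ Fin m₂) ℂ) (x : ℝ) :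
    Matrix (Fin m₂) (Fin m₂) ℂ :=
  -(Complex.I • (β'' x * jMat m₁ m₂ * (β' x)ᴴ + β' x * jMat m₁ m₂ * (β'' x)ᴴ))

theorem memLp_matrix_mul_left {l m n : Type*} [Fintype l] [Fintype m] [Fintype n] [DecidableEq l]
    [DecidableEq m] [DecidableEq n] {f : ℝ → Matrix l m ℂ} {g : ℝ → Matrix m n ℂ}
    (hf : MemLp f 2 (volume.restrict (Ioo 0 r))) (hg : ContinuousOn g (Icc 0 r)) :
    MemLp (fun x => f x * g x) 2 (volume.restrict (Ioo 0 r)) :=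
  memLp_bilin_left mulL hf hg

theorem memLp_matrix_mul_right {l m n : Type*} [Fintype l] [Fintype m] [Fintype n] [DecidableEq l]
    [DecidableEq m] [DecidableEq n] {f : ℝ → Matrix l m ℂ} {g : ℝ → Matrix m n ℂ}
    (hf : ContinuousOn f (Icc 0 r)) (hg : MemLp g 2 (volume.restrict (Ioo 0 r))) :
    MemLp (fun x => f x * g x) 2 (volume.restrict (Ioo 0 r)) :=
  memLp_bilin_right mulL hf hg

theorem continuousOn_matrix_mul {l m n : Type*} [Fintype l] [Fintype m] [Fintype n] [DecidableEq l]
    [DecidableEq m] [DecidableEq n] {f : ℝ → Matrix l m ℂ} {g : ℝ → Matrix m n ℂ} {s : Set ℝ}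
    (hf : ContinuousOn f s) (hg : ContinuousOn g s) : ContinuousOn (fun x => f x * g x) s :=
  (mulL (l := l) (m := m) (n := n)).continuous₂.comp_continuousOn (hf.prodMk hg)

namespace HasU

variable (hβ : HasU r β β' β'')

include hβ

theorem continuousOn : ContinuousOn β (Icc 0 r) := hβ.hasIntDeriv.continuousOn

theorem continuousOn_deriv : ContinuousOn β' (Icc 0 r) := hβ.hasIntDeriv_deriv.continuousOn

theorem memLp_conjTranspose : MemLp (fun x => (β'' x)ᴴ) 2 (volume.restrict (Ioo 0 r)) :=
  (conjTransposeR (l := Fin m₂) (m := Fin m₁ ⊕ Fin m₂)).comp_memLp' hβ.2.1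

theorem continuousOn_conjTranspose : ContinuousOn (fun x => (β x)ᴴ) (Icc 0 r) :=
  hβ.hasIntDeriv.conjTranspose.continuousOn

theorem continuousOn_deriv_conjTranspose : ContinuousOn (fun x => (β' x)ᴴ) (Icc 0 r) :=
  hβ.hasIntDeriv_deriv.conjTranspose.continuousOn

theorem hasIntDeriv_qFun : HasIntDeriv r (qFun β') (qDeriv β' β'') := by
  have h1 := hβ.hasIntDeriv_deriv
  have h2 := ((h1.mul (HasIntDeriv.const r (jMat m₁ m₂))).mul h1.conjTranspose).smul Complex.I
  refine h2.neg.congr_deriv fun x _ => ?_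
  simp [qDeriv]

theorem continuousOn_qFun : ContinuousOn (qFun β') (Icc 0 r) := hβ.hasIntDeriv_qFun.continuousOn

theorem memLp_mul_jMat : MemLp (fun x => β'' x * jMat m₁ m₂) 2 (volume.restrict (Ioo 0 r)) :=
  memLp_matrix_mul_left hβ.2.1 continuousOn_const

theorem continuousOn_mul_jMat : ContinuousOn (fun x => β' x * jMat m₁ m₂) (Icc 0 r) :=
  continuousOn_matrix_mul hβ.continuousOn_deriv continuousOn_const

theorem memLp_left : MemLp (fun x => β'' x * jMat m₁ m₂ * (β' x)ᴴ) 2 (volume.restrict (Ioo 0 r)) :=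
  memLp_matrix_mul_left hβ.memLp_mul_jMat hβ.continuousOn_deriv_conjTranspose

theorem memLp_right :
    MemLp (fun x => β' x * jMat m₁ m₂ * (β'' x)ᴴ) 2 (volume.restrict (Ioo 0 r)) :=
  memLp_matrix_mul_right hβ.continuousOn_mul_jMat hβ.memLp_conjTranspose

theorem memLp_qDeriv : MemLp (qDeriv β' β'') 2 (volume.restrict (Ioo 0 r)) :=
  ((hβ.memLp_left.add hβ.memLp_right).const_smul Complex.I).neg

theorem hasIntDeriv_uFun :
    HasIntDeriv r (uFun β') fun x => -((1 / 2 : ℂ) • qFun β' x) * uFun β' x :=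
  evolution_hasIntDeriv
    (((memLp_of_continuousOn hβ.continuousOn_qFun).const_smul (1 / 2 : ℂ)).neg)

theorem continuousOn_uFun : ContinuousOn (uFun β') (Icc 0 r) := hβ.hasIntDeriv_uFun.continuousOn

/-- Since `j` is Hermitian, `q` is skew-Hermitian, and the flow `u' = -q u / 2` preserves `u^* u`.
-/
theorem uFun_unitary {x : ℝ} (hx : x ∈ Icc 0 r) :
    (uFun β' x)ᴴ * uFun β' x = 1 ∧ uFun β' x * (uFun β' x)ᴴ = 1 := by
  have h := hβ.hasIntDeriv_uFun
  have h1 : (uFun β' x)ᴴ * uFun β' x = 1 := by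
    refine (h.conjTranspose.mul h).eq_of_ae (HasIntDeriv.const r 1) ?_ ?_ hx
    · simp [uFun, evolution_zero]
    · refine Filter.Eventually.of_forall fun t => ?_
      simp [Matrix.conjTranspose_mul, qFun_conjTranspose, Matrix.mul_assoc]
  exact ⟨h1, mul_eq_one_comm.1 h1⟩

/-- The second derivative of `u`. -/
theorem hasU_uFun : HasU r (uFun β') (fun x => -((1 / 2 : ℂ) • qFun β' x) * uFun β' x)
    fun x => -((1 / 2 : ℂ) • qDeriv β' β'' x) * uFun β' x +
      -((1 / 2 : ℂ) • qFun β' x) * (-((1 / 2 : ℂ) • qFun β' x) * uFun β' x) := by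
  have hq := (hβ.hasIntDeriv_qFun.smul (1 / 2)).neg
  have hu := hβ.hasIntDeriv_uFun
  refine hu.hasU (hq.mul hu) (MemLp.add ?_ ?_)
  · exact memLp_matrix_mul_left (hβ.memLp_qDeriv.const_smul (1 / 2 : ℂ)).neg hβ.continuousOn_uFun
  · exact memLp_of_continuousOn (continuousOn_matrix_mul hq.continuousOn
      (continuousOn_matrix_mul hq.continuousOn hu.continuousOn))

theorem memLp_zCoeff :
    MemLp (fun x => Complex.I • ((β x)ᴴ * β'' x * jMat m₁ m₂)) 2 (volume.restrict (Ioo 0 r)) := by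
  have h1 : MemLp (fun x => (β x)ᴴ * β'' x) 2 (volume.restrict (Ioo 0 r)) :=
    memLp_matrix_mul_right hβ.continuousOn_conjTranspose hβ.2.1
  have h2 : MemLp (fun x => (β x)ᴴ * β'' x * jMat m₁ m₂) 2 (volume.restrict (Ioo 0 r)) :=
    memLp_matrix_mul_left h1 continuousOn_const
  exact h2.const_smul Complex.I

theorem hasIntDeriv_zFun : HasIntDeriv r (zFun β β'')
    fun x => Complex.I • ((β x)ᴴ * β'' x * jMat m₁ m₂) * zFun β β'' x :=
  evolution_hasIntDeriv hβ.memLp_zCoeff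

/-- On `[0, r]` the inverse coincides with the solution of the adjoint system, hence is continuous;
square integrability of `h₂` depends on this. -/
theorem zFun_inv : ContinuousOn (fun x => (zFun β β'' x)⁻¹) (Icc 0 r) ∧
    ∀ x ∈ Icc 0 r, zFun β β'' x * (zFun β β'' x)⁻¹ = 1 := by
  obtain ⟨X, hX, -, hXW⟩ := exists_inverse_of_hasIntDeriv hβ.memLp_zCoeff hβ.hasIntDeriv_zFun
    (by simp [zFun, evolution_zero])
  have e : ∀ x ∈ Icc 0 r, (zFun β β'' x)⁻¹ = X x := fun x hx =>
    Matrix.inv_eq_left_inv (hXW x hx).1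
  refine ⟨hX.continuousOn.congr e, fun x hx => ?_⟩
  rw [e x hx, (hXW x hx).2]

theorem memLp_u4Fun : MemLp (u4Fun β' β'') 2 (volume.restrict (Ioo 0 r)) := by
  have hu := hβ.continuousOn_uFun
  have hq := hβ.continuousOn_qFun
  refine memLp_matrix_mul_left (memLp_matrix_mul_right
    hβ.hasIntDeriv_uFun.conjTranspose.continuousOn (MemLp.sub ?_ ?_)) hu
  · exact (hβ.memLp_left.sub hβ.memLp_right).const_smul (Complex.I / 2)
  · exact (memLp_of_continuousOn (continuousOn_matrix_mul hq hq)).const_smul (3 / 4 : ℂ)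

theorem memLp_h1Fun : MemLp (h1Fun β β' β'') 2 (volume.restrict (Ioo 0 r)) := by
  have h1 : MemLp (fun x => (uFun β' x)ᴴ * β'' x) 2 (volume.restrict (Ioo 0 r)) :=
    memLp_matrix_mul_right hβ.hasIntDeriv_uFun.conjTranspose.continuousOn hβ.2.1
  have h2 : MemLp (fun x => (uFun β' x)ᴴ * β'' x * jMat m₁ m₂) 2 (volume.restrict (Ioo 0 r)) :=
    memLp_matrix_mul_left h1 continuousOn_const
  exact (memLp_matrix_mul_left h2 hβ.hasIntDeriv_zFun.continuousOn).const_smul Complex.I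

theorem memLp_h2Fun : MemLp (h2Fun β β' β'') 2 (volume.restrict (Ioo 0 r)) := by
  have hq := hβ.continuousOn_qFun
  have h1 : MemLp (fun x => qFun β' x * qFun β' x +
      Complex.I • (β' x * jMat m₁ m₂ * (β'' x)ᴴ)) 2 (volume.restrict (Ioo 0 r)) :=
    (memLp_of_continuousOn (continuousOn_matrix_mul hq hq)).add
      (hβ.memLp_right.const_smul Complex.I)
  refine memLp_matrix_mul_left (memLp_matrix_mul_right hβ.zFun_inv.1 (MemLp.add (MemLp.sub
    hβ.memLp_conjTranspose ?_) (memLp_matrix_mul_right hβ.continuousOn_conjTranspose h1)))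
    hβ.continuousOn_uFun
  exact memLp_of_continuousOn (continuousOn_matrix_mul hβ.continuousOn_deriv_conjTranspose hq)

variable (hβ1 : ∀ x ∈ Icc 0 r, β' x * jMat m₁ m₂ * (β x)ᴴ = Complex.I • 1)

include hβ1

/-- Differentiating `β' j β^* = i I` gives `β'' j β^* + β' j β'^* = 0`. -/
theorem qFun_eq_ae : ∀ᵐ x ∂(volume.restrict (Ioo 0 r)),
    qFun β' x = Complex.I • (β'' x * jMat m₁ m₂ * (β x)ᴴ) := by
  have h1 := (hβ.hasIntDeriv_deriv.mul (HasIntDeriv.const r (jMat m₁ m₂))).mul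
    hβ.hasIntDeriv.conjTranspose
  have h2 := (h1.congr hβ1).ae_unique (HasIntDeriv.const r _)
  filter_upwards [h2] with x hx
  simp only [Matrix.mul_zero, add_zero] at hx
  rw [eq_neg_of_add_eq_zero_left hx, qFun, smul_neg]

end HasU

open scoped ComplexOrder in
/-- The block `β₂` is invertible. -/
theorem isUnit_block2 {x : ℝ} (h0 : β x * jMat m₁ m₂ * (β x)ᴴ = 0)
    (h1 : β' x * jMat m₁ m₂ * (β x)ᴴ = Complex.I • 1) : IsUnit (block2 β x) := by
  -- By `β j β^* = 0` the vectors `β₁^* v` and `β₂^* v` have equal norms. So `β₂^* v = 0` implies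
  -- `β^* v = 0`, and then `β' j β^* = i I` implies `v = 0`.
  have key : ∀ v : Fin m₂ → ℂ, (block2 β x)ᴴ *ᵥ v = 0 → v = 0 := by
    intro v hv
    have hsplit : (β x)ᴴ = Matrix.fromRows (β x).toCols₁ᴴ (block2 β x)ᴴ := by
      ext i j; rcases i with i | i <;> rfl
    have hβs : β x = Matrix.fromCols (β x).toCols₁ (block2 β x) := by
      ext i j; rcases j with j | j <;> rfl
    have h2 : (β x).toCols₁ * (β x).toCols₁ᴴ = block2 β x * (block2 β x)ᴴ := by
      have h3 := h0
      rw [hsplit] at h3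
      nth_rewrite 1 [hβs] at h3
      rw [jMat, Matrix.fromCols_mul_fromBlocks, Matrix.fromCols_mul_fromRows] at h3
      simp only [Matrix.mul_one, Matrix.mul_zero, add_zero, zero_add, Matrix.mul_neg,
        Matrix.neg_mul] at h3
      exact sub_eq_zero.1 (by rwa [sub_eq_add_neg])
    have h4 : (β x).toCols₁ᴴ *ᵥ v = 0 := by
      have h5 : star v ⬝ᵥ (((β x).toCols₁ * (β x).toCols₁ᴴ) *ᵥ v) = 0 := by
        rw [h2, ← Matrix.mulVec_mulVec, hv, Matrix.mulVec_zero, dotProduct_zero]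
      rw [← Matrix.mulVec_mulVec, Matrix.dotProduct_mulVec, ← Matrix.conjTranspose_conjTranspose
        (β x).toCols₁, ← Matrix.star_mulVec, Matrix.conjTranspose_conjTranspose] at h5
      exact dotProduct_star_self_eq_zero.1 h5
    have h6 : (β x)ᴴ *ᵥ v = 0 := by
      rw [hsplit, Matrix.fromRows_mulVec, h4, hv]
      ext i; rcases i with i | i <;> rfl
    have h7 := congr_arg (fun M => M *ᵥ v) h1
    simp only [← Matrix.mulVec_mulVec, h6, Matrix.mulVec_zero, Matrix.smul_mulVec,
      Matrix.one_mulVec] at h7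
    exact (smul_eq_zero.1 h7.symm).resolve_left Complex.I_ne_zero
  rw [← Matrix.isUnit_conjTranspose]
  exact Matrix.mulVec_injective_iff_isUnit.1
    ((injective_iff_map_eq_zero (Matrix.mulVecLin (block2 β x)ᴴ)).2 key)

end Coefficients

/-! ### Bounded operators on `L₂` given by formulas, and inversion of `1 + Volterra`. -/

section Operators

variable {p : ℕ} {r : ℝ}

theorem toL2_coe {f : ℝ → EuclideanSpace ℂ (Fin p)} (hf : MemLp f 2 (volume.restrict (Ioo 0 r))) :
    toL2 r f =ᵐ[volume.restrict (Ioo 0 r)] f := by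
  rw [toL2, dif_pos hf]; exact hf.coeFn_toLp

theorem toL2_eq {f : ℝ → EuclideanSpace ℂ (Fin p)} {g : L2 p r}
    (h : g =ᵐ[volume.restrict (Ioo 0 r)] f) : toL2 r f = g := by
  have hf : MemLp f 2 (volume.restrict (Ioo 0 r)) := (memLp_congr_ae h).1 (Lp.memLp g)
  exact Lp.ext ((toL2_coe hf).trans h.symm)

theorem ae_of_Icc {P : ℝ → Prop} (h : ∀ x ∈ Icc 0 r, P x) :
    ∀ᵐ x ∂(volume.restrict (Ioo 0 r)), P x :=
  (ae_restrict_iff' measurableSet_Ioo).2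
    (Filter.Eventually.of_forall fun x hx => h x (Ioo_subset_Icc_self hx))

/-- The formula `φ` defines a map on classes modulo null sets. -/
def RespectsAE (r : ℝ) (φ : (ℝ → EuclideanSpace ℂ (Fin p)) → ℝ → EuclideanSpace ℂ (Fin p)) : Prop :=
  ∀ f g, f =ᵐ[volume.restrict (Ioo 0 r)] g → φ f =ᵐ[volume.restrict (Ioo 0 r)] φ g

theorem Represents.apply_toL2 {T : L2 p r →L[ℂ] L2 p r}
    {φ : (ℝ → EuclideanSpace ℂ (Fin p)) → ℝ → EuclideanSpace ℂ (Fin p)} (hT : Represents T φ)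
    (hφ : RespectsAE r φ) {f : ℝ → EuclideanSpace ℂ (Fin p)}
    (hf : MemLp f 2 (volume.restrict (Ioo 0 r))) :
    T (toL2 r f) =ᵐ[volume.restrict (Ioo 0 r)] φ f :=
  Filter.EventuallyEq.trans (hT _) (hφ _ _ (toL2_coe hf))

theorem Represents.congr {T : L2 p r →L[ℂ] L2 p r}
    {φ ψ : (ℝ → EuclideanSpace ℂ (Fin p)) → ℝ → EuclideanSpace ℂ (Fin p)} (hT : Represents T φ)
    (h : ∀ f : L2 p r, ∀ x ∈ Icc 0 r, φ f x = ψ f x) : Represents T ψ := fun f => by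
  filter_upwards [hT f, ae_of_Icc (h f)] with x h1 h2
  rw [h1, h2]

/-- A linear formula which satisfies an estimate defines a bounded operator. -/
theorem exists_represents {φ : (ℝ → EuclideanSpace ℂ (Fin p)) → ℝ → EuclideanSpace ℂ (Fin p)}
    {D : ℝ} (hm : ∀ f : L2 p r, MemLp (φ f) 2 (volume.restrict (Ioo 0 r)))
    (hc : RespectsAE r φ)
    (ha : ∀ f g : L2 p r, ∀ x ∈ Icc 0 r, φ (fun t => f t + g t) x = φ f x + φ g x)
    (hs : ∀ (c : ℂ) (f : L2 p r), ∀ x ∈ Icc 0 r, φ (fun t => c • f t) x = c • φ f x)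
    (hb : ∀ f : L2 p r, ‖toL2 r (φ f)‖ ≤ D * ‖f‖) :
    ∃ T : L2 p r →L[ℂ] L2 p r, Represents T φ := by
  let T₀ : L2 p r →ₗ[ℂ] L2 p r :=
    { toFun := fun f => toL2 r (φ f)
      map_add' := fun f g => by
        refine toL2_eq ?_
        filter_upwards [Lp.coeFn_add (toL2 r (φ f)) (toL2 r (φ g)), toL2_coe (hm f),
          toL2_coe (hm g), hc _ _ (Lp.coeFn_add f g), ae_of_Icc (ha f g)] with x h1 h2 h3 h4 h5
        rw [h1, Pi.add_apply, h2, h3, h4, ← h5]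
        rfl
      map_smul' := fun c f => by
        refine toL2_eq ?_
        filter_upwards [Lp.coeFn_smul c (toL2 r (φ f)), toL2_coe (hm f),
          hc _ _ (Lp.coeFn_smul c f), ae_of_Icc (hs c f)] with x h1 h2 h4 h5
        rw [RingHom.id_apply, h1, Pi.smul_apply, h2, h4, ← h5]
        rfl }
  exact ⟨T₀.mkContinuous D hb, fun f => toL2_coe (hm f)⟩

/-- The operator of multiplication by a continuous matrix function. -/
theorem exists_multiplication {M : ℝ → Matrix (Fin p) (Fin p) ℂ} (hM : ContinuousOn M (Icc 0 r)) :
    ∃ T : L2 p r →L[ℂ] L2 p r, Represents T fun f x => act (M x) (f x) := by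
  obtain ⟨C, hC⟩ := isCompact_Icc.exists_bound_of_continuousOn hM
  have hm : ∀ f : L2 p r, MemLp (fun x => act (M x) (f x)) 2 (volume.restrict (Ioo 0 r)) :=
    fun f => memLp_bilin_right actR hM (Lp.memLp f)
  refine exists_represents (D := C) hm ?_ ?_ ?_ ?_
  · intro f g h
    filter_upwards [h] with x hx
    rw [hx]
  · intro f g x _
    exact act_add _ _ _
  · intro c f x _
    exact act_smul _ _ _
  · intro f
    refine Lp.norm_le_mul_norm_of_ae_le_mul ?_
    filter_upwards [toL2_coe (hm f), ae_of_Icc hC] with x h1 h2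
    rw [h1]
    exact (norm_act_le _ _).trans (by gcongr)

theorem exists_norm_integral_le (p : ℕ) (r : ℝ) :
    ∃ D : ℝ, 0 ≤ D ∧ ∀ f : L2 p r, ∫ t in Ioo 0 r, ‖f t‖ ≤ D * ‖f‖ := by
  refine ⟨(volume.restrict (Ioo 0 r) univ ^ (1 / (1 : ENNReal).toReal - 1 / (2 : ENNReal).toReal)).toReal,
    ENNReal.toReal_nonneg, fun f => ?_⟩
  have h1 := eLpNorm_le_eLpNorm_mul_rpow_measure_univ (p := 1) (q := 2) (by norm_num)
    (Lp.memLp f).1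
  rw [integral_norm_eq_lintegral_enorm (Lp.memLp f).1, ← eLpNorm_one_eq_lintegral_enorm, mul_comm,
    Lp.norm_def, ← ENNReal.toReal_mul]
  refine ENNReal.toReal_mono (ENNReal.mul_ne_top (Lp.memLp f).2.ne ?_) h1
  refine ENNReal.rpow_ne_top_of_nonneg (by norm_num) ?_
  simp

theorem norm_le_of_bound : ∃ D : ℝ, 0 ≤ D ∧ ∀ (f : L2 p r) (M : ℝ), 0 ≤ M →
    (∀ᵐ x ∂(volume.restrict (Ioo 0 r)), ‖f x‖ ≤ M) → ‖f‖ ≤ D * M :=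
  ⟨measureUnivNNReal (volume.restrict (Ioo (0 : ℝ) r)) ^ ((2 : ENNReal).toReal)⁻¹, by positivity,
    fun _ _ hM h => Lp.norm_le_of_ae_bound hM h⟩

variable {C : ℝ} {k : ℝ → ℝ → Matrix (Fin p) (Fin p) ℂ}

theorem respectsAE_volterra : RespectsAE r (volterra k) := fun _ _ h =>
  ae_of_Icc fun _ hx => volterra_congr h hx

theorem L2.integrableOn (f : L2 p r) : IntegrableOn f (Ioo 0 r) :=
  memLp_integrableOn_Ioo (Lp.memLp f)

namespace IsBddKernel

variable (hk : IsBddKernel r k C)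

include hk

theorem volterra_add {f g : ℝ → EuclideanSpace ℂ (Fin p)} (hf : IntegrableOn f (Ioo 0 r))
    (hg : IntegrableOn g (Ioo 0 r)) {x : ℝ} (hx : x ∈ Icc 0 r) :
    volterra k (fun t => f t + g t) x = volterra k f x + volterra k g x := by
  simp only [volterra, act_add]
  exact intervalIntegral.integral_add (hk.intervalIntegrable hf hx) (hk.intervalIntegrable hg hx)

/-- One application turns an `L₂` bound into a pointwise bound, from which the weighted estimates
can start. -/
theorem norm_volterra_le_of_L2 : ∃ D : ℝ, 0 ≤ D ∧ ∀ f : L2 p r, ∀ x ∈ Icc 0 r,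
    ‖volterra k f x‖ ≤ D * ‖f‖ := by
  obtain ⟨D, hD0, hD⟩ := exists_norm_integral_le p r
  refine ⟨C * D, mul_nonneg hk.nonneg hD0, fun f x hx => ?_⟩
  refine (hk.norm_volterra_le f.integrableOn hx).trans ?_
  rw [intervalIntegral.integral_const_mul, mul_assoc, intervalIntegral.integral_of_le hx.1,
    integral_Ioc_eq_integral_Ioo]
  refine mul_le_mul_of_nonneg_left (le_trans ?_ (hD f)) hk.nonneg
  exact setIntegral_mono_set f.integrableOn.norm (Filter.Eventually.of_forall fun t => norm_nonneg _)
    (Ioo_subset_Ioo_right hx.2).eventuallyLE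

/-- A bounded kernel defines a Volterra operator. -/
theorem exists_represents_volterra : ∃ T : L2 p r →L[ℂ] L2 p r, Represents T (volterra k) := by
  obtain ⟨D, hD0, hD⟩ := hk.norm_volterra_le_of_L2
  obtain ⟨D', hD0', hD'⟩ := norm_le_of_bound (p := p) (r := r)
  have hm : ∀ f : L2 p r, MemLp (volterra k f) 2 (volume.restrict (Ioo 0 r)) := fun f =>
    hk.memLp f.integrableOn
  refine exists_represents (D := D' * D) hm respectsAE_volterra ?_ ?_ ?_
  · intro f g x hx
    exact hk.volterra_add f.integrableOn g.integrableOn hx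
  · intro c f x _
    simp only [volterra, act_smul, intervalIntegral.integral_smul]
  · intro f
    rw [mul_assoc]
    refine hD' _ _ (by positivity) ?_
    filter_upwards [toL2_coe (hm f), ae_of_Icc (hD f)] with x h1 h2
    rw [h1]; exact h2

/-- The powers of a Volterra operator tend to zero. -/
theorem exists_norm_pow_le {T : L2 p r →L[ℂ] L2 p r} (hT : Represents T (volterra k)) :
    ∃ D : ℝ, 0 ≤ D ∧ ∀ n : ℕ, ‖T ^ (n + 1)‖ ≤ D * (1 / 2) ^ n := by
  obtain ⟨D, hD0, hD⟩ := hk.norm_volterra_le_of_L2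
  obtain ⟨D', hD0', hD'⟩ := norm_le_of_bound (p := p) (r := r)
  obtain ⟨L, hL, hw⟩ := exists_weight (r := r) (c := fun _ => C) (memLp_const C) (ε := 1 / 2)
    (by norm_num)
  -- The exponent is `n + 1` because the first application is spent on obtaining a pointwise bound;
  -- each of the other `n` gains a factor `1/2` in the weighted norm.
  have hind : ∀ (n : ℕ) (f : L2 p r), ∀ᵐ x ∂(volume.restrict (Ioo 0 r)),
      ‖(T ^ (n + 1)) f x‖ ≤ D * ‖f‖ * (1 / 2) ^ n * Real.exp (L * x) := by
    intro n f
    induction n with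
    | zero =>
      filter_upwards [hT f, ae_of_Icc (hD f), ae_restrict_mem measurableSet_Ioo] with x h1 h2 hx
      have : 1 ≤ Real.exp (L * x) := Real.one_le_exp (mul_nonneg hL.le hx.1.le)
      rw [zero_add, pow_one, h1, pow_zero, mul_one]
      exact h2.trans (le_mul_of_one_le_right (by positivity) this)
    | succ n ih =>
      filter_upwards [hT ((T ^ (n + 1)) f), ae_restrict_mem measurableSet_Ioo] with x h1 hx
      have hx' := Ioo_subset_Icc_self hx
      have h0 : (0 : ℝ) ∈ Icc 0 r := left_mem_Icc.2 (hx.1.trans hx.2).le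
      have hi := intervalIntegrable_of_Ioo ((T ^ (n + 1)) f).integrableOn h0 hx'
      rw [pow_succ' T (n + 1), mul_apply_eq_comp, h1]
      refine (hk.norm_volterra_le ((T ^ (n + 1)) f).integrableOn hx').trans ?_
      calc ∫ t in (0 : ℝ)..x, C * ‖(T ^ (n + 1)) f t‖
          ≤ ∫ t in (0 : ℝ)..x, D * ‖f‖ * (1 / 2) ^ n * (C * Real.exp (L * t)) := by
            refine intervalIntegral.integral_mono_ae_restrict hx.1.le (hi.norm.const_mul C)
              (Continuous.intervalIntegrable (by fun_prop) _ _) ?_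
            have hsub : volume.restrict (Icc 0 x) ≪ volume.restrict (Ioo 0 r) := by
              rw [← restrict_Ioo_eq_restrict_Icc]
              exact (Measure.restrict_mono (Ioo_subset_Ioo_right hx.2.le) le_rfl).absolutelyContinuous
            filter_upwards [hsub.ae_le ih] with t ht
            have := mul_le_mul_of_nonneg_left ht hk.nonneg
            calc _ ≤ _ := this
              _ = _ := by ring
        _ ≤ D * ‖f‖ * (1 / 2) ^ n * (1 / 2 * Real.exp (L * x)) := by
            rw [intervalIntegral.integral_const_mul]; gcongr; exact hw x hx'
        _ = _ := by ring
  refine ⟨D' * (D * Real.exp (L * r)), by positivity, fun n => ?_⟩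
  refine ContinuousLinearMap.opNorm_le_bound _ (by positivity) fun f => ?_
  have := hD' ((T ^ (n + 1)) f) (D * ‖f‖ * (1 / 2) ^ n * Real.exp (L * r)) (by positivity) (by
    filter_upwards [hind n f, ae_restrict_mem measurableSet_Ioo] with x h1 hx
    refine h1.trans ?_
    gcongr
    exact hx.2.le)
  calc _ ≤ _ := this
    _ = _ := by ring

/-- Some power of `-T` has norm below `1`, so `1 - (-T)^(n+1)` is invertible; `1 + T` is one of its
two commuting factors. -/
theorem isUnit_one_add {T : L2 p r →L[ℂ] L2 p r} (hT : Represents T (volterra k)) :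
    IsUnit (1 + T) := by
  obtain ⟨D, hD0, hD⟩ := hk.exists_norm_pow_le hT
  have hlim : Filter.Tendsto (fun n : ℕ => D * (1 / 2 : ℝ) ^ n) Filter.atTop (nhds 0) := by
    simpa using (tendsto_pow_atTop_nhds_zero_of_lt_one (r := (1 / 2 : ℝ)) (by norm_num)
      (by norm_num)).const_mul D
  obtain ⟨n, hn⟩ := (hlim.eventually (gt_mem_nhds one_pos)).exists
  have h1 : ‖(-T) ^ (n + 1)‖ < 1 := by
    rw [neg_pow, ← Units.coe_neg_one, ← Units.val_pow_eq_pow_val]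
    rcases neg_one_pow_eq_or (L2 p r →L[ℂ] L2 p r)ˣ (n + 1) with h | h
    · rw [h]; simpa using (hD n).trans_lt hn
    · rw [h]; simpa using (hD n).trans_lt hn
  have h2 : IsUnit (1 - (-T) ^ (n + 1)) := (Units.oneSub _ h1).isUnit
  rw [← mul_neg_geom_sum] at h2
  have hc : Commute (1 - -T) (∑ i ∈ Finset.range (n + 1), (-T) ^ i) :=
    Commute.sum_right _ _ _ fun i _ => ((Commute.one_left _).sub_left (Commute.refl (-T))).pow_right i
  have := (hc.isUnit_mul_iff.1 h2).1
  rwa [sub_neg_eq_add] at this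

end IsBddKernel

end Operators

/-! ### Functions of class `𝒰` and the operator `A`. -/

section Functions

variable {E : Type*} [NormedAddCommGroup E] [NormedSpace ℝ E] [CompleteSpace E] {r : ℝ}

theorem HasU.eq_of_ae {G G' G'' F F' F'' : ℝ → E} (h : HasU r G G' G'') (k : HasU r F F' F'')
    (h0 : G 0 = F 0) (h1 : G' 0 = F' 0) (h2 : G'' =ᵐ[volume.restrict (Ioo 0 r)] F'') {x : ℝ}
    (hx : x ∈ Icc 0 r) : G x = F x :=
  h.hasIntDeriv.eq_of_ae k.hasIntDeriv h0
    (ae_of_Icc fun _ ht => h.hasIntDeriv_deriv.eq_of_ae k.hasIntDeriv_deriv h1 h2 ht) hx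

theorem exists_hasU_of_memLp (c₀ c₁ : E) {g : ℝ → E} (hg : MemLp g 2 (volume.restrict (Ioo 0 r))) :
    ∃ y y', y 0 = c₀ ∧ y' 0 = c₁ ∧ HasU r y y' g := by
  have h1 := HasIntDeriv.of_integral (memLp_integrableOn_Ioo hg) c₁
  have h2 := HasIntDeriv.of_integral (r := r)
    (h1.continuousOn.integrableOn_Icc.mono_set Ioo_subset_Icc_self) c₀
  exact ⟨_, _, by simp, by simp, h2.hasU h1 hg⟩

theorem HasU.sub {G G' G'' F F' F'' : ℝ → E} (h : HasU r G G' G'') (k : HasU r F F' F'') :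
    HasU r (fun x => G x - F x) (fun x => G' x - F' x) fun x => G'' x - F'' x :=
  (h.hasIntDeriv.sub k.hasIntDeriv).hasU (h.hasIntDeriv_deriv.sub k.hasIntDeriv_deriv)
    (h.2.1.sub k.2.1)

theorem HasU.clm {F : Type*} [NormedAddCommGroup F] [NormedSpace ℝ F] [CompleteSpace F]
    {G G' G'' : ℝ → E} (h : HasU r G G' G'') (L : E →L[ℝ] F) :
    HasU r (fun x => L (G x)) (fun x => L (G' x)) fun x => L (G'' x) :=
  (h.hasIntDeriv.clm L).hasU (h.hasIntDeriv_deriv.clm L) (L.comp_memLp' h.2.1)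

theorem HasU.act {l m : Type*} [Fintype l] [Fintype m] [DecidableEq l] [DecidableEq m]
    {M M' M'' : ℝ → Matrix l m ℂ} {v v' v'' : ℝ → EuclideanSpace ℂ m} (hM : HasU r M M' M'')
    (hv : HasU r v v' v'') : ∃ g' g'', HasU r (fun x => act (M x) (v x)) g' g'' := by
  have a1 := hM.hasIntDeriv
  have a2 := hM.hasIntDeriv_deriv
  have b1 := hv.hasIntDeriv
  have b2 := hv.hasIntDeriv_deriv
  refine ⟨_, _, (a1.act b1).hasU ((a2.act b1).add (a1.act b2)) (MemLp.add (MemLp.add ?_ ?_)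
    (MemLp.add ?_ ?_))⟩
  · exact memLp_bilin_left actR hM.2.1 b1.continuousOn
  · exact memLp_bilin_right actR a2.continuousOn (memLp_of_continuousOn b2.continuousOn)
  · exact memLp_bilin_right actR a2.continuousOn (memLp_of_continuousOn b2.continuousOn)
  · exact memLp_bilin_right actR a1.continuousOn hv.2.1

theorem formulaA_zero {p : ℕ} (f : ℝ → EuclideanSpace ℂ (Fin p)) : formulaA f 0 = 0 := by
  simp [formulaA]

/-- Writing `A f = ∫ t f - x ∫ f`, the product rule shows that `A` is, up to sign, twofold
integration from `0`. -/
theorem hasU_formulaA {p : ℕ} {f : ℝ → EuclideanSpace ℂ (Fin p)}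
    (hf : MemLp f 2 (volume.restrict (Ioo 0 r))) :
    HasU r (formulaA f) (fun x => -∫ t in (0 : ℝ)..x, f t) fun x => -f x := by
  have hi := memLp_integrableOn_Ioo hf
  have hF : HasIntDeriv r (fun x => ∫ t in (0 : ℝ)..x, f t) f :=
    ⟨hi, fun x _ => by simp⟩
  have hid : HasIntDeriv r (fun x : ℝ => x) fun _ => 1 :=
    ⟨integrableOn_const (by simp), fun x _ => by simp⟩
  have hit : IntegrableOn (fun t => t • f t) (Ioo 0 r) :=
    memLp_integrableOn_Ioo (memLp_bilin_right (ContinuousLinearMap.lsmul ℝ ℝ) hid.continuousOn hf)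
  have hG : HasIntDeriv r (fun x => ∫ t in (0 : ℝ)..x, t • f t) fun t => t • f t :=
    ⟨hit, fun x _ => by simp⟩
  have h1 := hG.sub (hid.bilin hF (ContinuousLinearMap.lsmul ℝ ℝ))
  have h2 : HasIntDeriv r (formulaA f) fun x => -∫ t in (0 : ℝ)..x, f t := by
    refine (h1.congr fun x hx => ?_).congr_deriv fun x _ => ?_
    · have h0 : (0 : ℝ) ∈ Icc 0 r := left_mem_Icc.2 (hx.1.trans hx.2)
      simp only [ContinuousLinearMap.lsmul_apply, formulaA, sub_smul]
      rw [intervalIntegral.integral_sub (intervalIntegrable_of_Ioo hit h0 hx)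
        (g := fun t => x • f t) (intervalIntegrable_of_Ioo (hi.smul x) h0 hx), intervalIntegral.integral_smul]
    · simp only [ContinuousLinearMap.lsmul_apply, one_smul]
      abel
  exact h2.hasU hF.neg hf.neg

end Functions

/-! ### The intertwining relation `K V = V A`. -/

section Intertwining

variable {m₁ m₂ : ℕ} {r : ℝ} {β β' β'' : ℝ → Matrix (Fin m₂) (Fin m₁ ⊕ Fin m₂) ℂ}

/-- The transformation `y ↦ u (y + ∫₀ˣ W(x, t) y(t) dt)`. -/
def transformation (β' : ℝ → Matrix (Fin m₂) (Fin m₁ ⊕ Fin m₂) ℂ)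
    (W : ℝ → ℝ → Matrix (Fin m₂) (Fin m₂) ℂ) (f : ℝ → EuclideanSpace ℂ (Fin m₂)) (x : ℝ) :
    EuclideanSpace ℂ (Fin m₂) :=
  act (uFun β' x) (f x + volterra W f x)

/-- The kernel `W` intertwines the second derivative with `z'' - u₄ z + h₁ ∫₀ˣ h₂ z`. -/
def IsTransformationKernel (r : ℝ) (β β' β'' : ℝ → Matrix (Fin m₂) (Fin m₁ ⊕ Fin m₂) ℂ)
    (W : ℝ → ℝ → Matrix (Fin m₂) (Fin m₂) ℂ) : Prop :=
  ∀ y y' y'' : ℝ → EuclideanSpace ℂ (Fin m₂), HasU r y y' y'' →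
    ∃ z', z' 0 = y' 0 ∧ HasU r (fun x => y x + volterra W y x) z' fun x =>
      potential (u4Fun β' β'') (h1Fun β β' β'') (h2Fun β β' β'') (fun x => y x + volterra W y x) x
        + (y'' x + volterra W y'' x) + act (W x 0) (y' 0)

theorem uFun_mul_u4Fun {x : ℝ} (hu : uFun β' x * (uFun β' x)ᴴ = 1) :
    uFun β' x * u4Fun β' β'' x =
      ((Complex.I / 2) • (β'' x * jMat m₁ m₂ * (β' x)ᴴ - β' x * jMat m₁ m₂ * (β'' x)ᴴ)
        - (3 / 4 : ℂ) • (qFun β' x * qFun β' x)) * uFun β' x := by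
  rw [u4Fun, ← Matrix.mul_assoc, ← Matrix.mul_assoc, hu, Matrix.one_mul]

theorem uFun_mul_h1Fun {x : ℝ} (hu : uFun β' x * (uFun β' x)ᴴ = 1) :
    uFun β' x * h1Fun β β' β'' x = Complex.I • (β'' x * jMat m₁ m₂ * zFun β β'' x) := by
  rw [h1Fun, Matrix.mul_smul, ← Matrix.mul_assoc, ← Matrix.mul_assoc, ← Matrix.mul_assoc, hu,
    Matrix.one_mul]

theorem zFun_mul_h2Fun {x : ℝ} (hz : zFun β β'' x * (zFun β β'' x)⁻¹ = 1) :
    zFun β β'' x * h2Fun β β' β'' x = ((β'' x)ᴴ - (β' x)ᴴ * qFun β' x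
      + (β x)ᴴ * (qFun β' x * qFun β' x + Complex.I • (β' x * jMat m₁ m₂ * (β'' x)ᴴ))) *
    uFun β' x := by
  rw [h2Fun, ← Matrix.mul_assoc, ← Matrix.mul_assoc, hz, Matrix.one_mul]

/-- The transformation carries `A` to `K`. -/
theorem IsTransformationKernel.intertwines (hβ : HasU r β β' β'')
    (hβ0 : ∀ x ∈ Icc 0 r, β x * jMat m₁ m₂ * (β x)ᴴ = 0)
    (hβ1 : ∀ x ∈ Icc 0 r, β' x * jMat m₁ m₂ * (β x)ᴴ = Complex.I • 1)
    {W : ℝ → ℝ → Matrix (Fin m₂) (Fin m₂) ℂ} {C : ℝ} (hk : IsBddKernel r W C)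
    (hW : IsTransformationKernel r β β' β'' W) {f : ℝ → EuclideanSpace ℂ (Fin m₂)}
    (hf : MemLp f 2 (volume.restrict (Ioo 0 r))) {x : ℝ} (hx : x ∈ Icc 0 r) :
    transformation β' W (formulaA f) x = formulaK β (transformation β' W f) x := by
  have h0 : (0 : ℝ) ∈ Icc 0 r := left_mem_Icc.2 (hx.1.trans hx.2)
  obtain ⟨z', hz0, hz⟩ := hW _ _ _ (hasU_formulaA hf)
  set z : ℝ → EuclideanSpace ℂ (Fin m₂) := fun x => formulaA f x + volterra W (formulaA f) x
    with hzdef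
  set w : ℝ → EuclideanSpace ℂ (Fin m₂) := fun x => f x + volterra W f x with hw
  set φ : ℝ → EuclideanSpace ℂ (Fin m₂) := fun x => act (uFun β' x) (w x) with hφ
  have hwm : MemLp w 2 (volume.restrict (Ioo 0 r)) :=
    hf.add (hk.memLp (memLp_integrableOn_Ioo hf))
  have hφm : MemLp φ 2 (volume.restrict (Ioo 0 r)) :=
    memLp_bilin_right actR hβ.continuousOn_uFun hwm
  have hz00 : z 0 = 0 := by simp [hzdef, formulaA_zero, volterra]
  have hz01 : z' 0 = 0 := by simpa using hz0
  have hz1 := hz.hasIntDeriv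
  -- The second derivative of `A f` is `-f`, and its first derivative vanishes at `0`, so the term
  -- with `W(x, 0)` drops out.
  have hz2 : HasIntDeriv r z' fun x =>
      potential (u4Fun β' β'') (h1Fun β β' β'') (h2Fun β β' β'') z x - w x := by
    refine hz.hasIntDeriv_deriv.congr_deriv fun x _ => ?_
    simp only [intervalIntegral.integral_same, neg_zero, act_zero, add_zero, volterra, act_neg,
      intervalIntegral.integral_neg, hw]
    abel
  have hu1 := hβ.hasIntDeriv_uFun
  have hu2 := hβ.hasU_uFun.hasIntDeriv_deriv
  have hq := hβ.hasIntDeriv_qFun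
  have hN : HasIntDeriv r (fun x => ∫ t in (0 : ℝ)..x, act (h2Fun β β' β'' t) (z t))
      fun t => act (h2Fun β β' β'' t) (z t) :=
    ⟨memLp_integrableOn_Ioo (memLp_bilin_left actR hβ.memLp_h2Fun hz1.continuousOn),
      fun x _ => by simp⟩
  set N : ℝ → EuclideanSpace ℂ (Fin m₁ ⊕ Fin m₂) :=
    fun x => ∫ t in (0 : ℝ)..x, act (h2Fun β β' β'' t) (z t) with hNdef
  have hY1 := hu1.act hz1
  have hY2 := (hu2.act hz1).add (hu1.act hz2)
  set Y : ℝ → EuclideanSpace ℂ (Fin m₂) := fun x => act (uFun β' x) (z x) with hY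
  set Y' : ℝ → EuclideanSpace ℂ (Fin m₂) := fun x =>
    act (-((1 / 2 : ℂ) • qFun β' x) * uFun β' x) (z x) + act (uFun β' x) (z' x) with hY'
  -- The equation for `z` rewritten for `Y = u z`: because `2 u' = -q u`, the terms with `z'`
  -- combine into `-q Y'`.
  set Y'' : ℝ → EuclideanSpace ℂ (Fin m₂) := fun x =>
    act (Complex.I • (β'' x * jMat m₁ m₂ * (β' x)ᴴ) - qFun β' x * qFun β' x) (Y x)
      - act (qFun β' x) (Y' x)
      - act (Complex.I • (β'' x * jMat m₁ m₂ * zFun β β'' x)) (N x) - φ x with hY''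
  have hYY : HasIntDeriv r Y' Y'' := by
    refine hY2.congr_deriv fun x hx => ?_
    have hu := (hβ.uFun_unitary (Ioo_subset_Icc_self hx)).2
    simp only [hY'', hY', hY, hφ, potential, act_sub, act_add, act_act, uFun_mul_u4Fun hu,
      uFun_mul_h1Fun hu, qDeriv]
    simp only [add_act, sub_act, neg_act, smul_act, smul_add, smul_sub, smul_neg, Matrix.add_mul,
      Matrix.sub_mul, Matrix.neg_mul, Matrix.mul_neg, Matrix.smul_mul, Matrix.mul_smul,
      Matrix.mul_assoc, neg_neg]
    module
  -- This candidate for `ω = ∫ β^* φ` solves `ω' = i β^* β'' j ω - β^* Y''`: variation of constants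
  -- gives `Z⁻¹ ω = -∫ Z⁻¹ β^* Y''`, and two integrations by parts, with `(Z⁻¹ β^*)' = Z⁻¹ (β'^* -
  -- β^* q)` and `(Z⁻¹ β^*)'' u = h₂`, give the stated form.
  have hω : HasIntDeriv r (fun x => -(act (β x)ᴴ (Y' x)
      - act ((β' x)ᴴ - (β x)ᴴ * qFun β' x) (Y x) + act (zFun β β'' x) (N x)))
      fun x => act (β x)ᴴ (φ x) := by
    have b1 := hβ.hasIntDeriv.conjTranspose
    have b2 := hβ.hasIntDeriv_deriv.conjTranspose
    refine (((b1.act hYY).sub ((b2.sub (b1.mul hq)).act hY1)).add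
      (hβ.hasIntDeriv_zFun.act hN)).neg.congr_deriv fun x hx => ?_
    have hZ := hβ.zFun_inv.2 x (Ioo_subset_Icc_self hx)
    have e1 : act (zFun β β'' x) (act (h2Fun β β' β'' x) (z x)) = act ((β'' x)ᴴ
        - (β' x)ᴴ * qFun β' x + (β x)ᴴ * (qFun β' x * qFun β' x
          + Complex.I • (β' x * jMat m₁ m₂ * (β'' x)ᴴ))) (Y x) := by
      rw [act_act, zFun_mul_h2Fun hZ, hY, act_act]
    rw [e1]
    simp only [hY'', qDeriv]
    simp only [act_sub, act_smul, act_act, add_act, sub_act, neg_act, smul_act, smul_add,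
      Matrix.mul_add, Matrix.mul_neg, Matrix.smul_mul, Matrix.mul_smul,
      Matrix.mul_assoc]
    module
  have hφi : HasIntDeriv r (fun x => ∫ t in (0 : ℝ)..x, act (β t)ᴴ (φ t))
      fun x => act (β x)ᴴ (φ x) :=
    ⟨hω.1, fun x _ => by simp⟩
  have hY0 : Y 0 = 0 := by simp [hY, hz00, act_zero]
  have hY0' : Y' 0 = 0 := by simp [hY', hz00, hz01, act_zero]
  have hN0 : N 0 = 0 := by simp [hNdef]
  have hωe : ∀ x ∈ Icc 0 r, -(act (β x)ᴴ (Y' x)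
      - act ((β' x)ᴴ - (β x)ᴴ * qFun β' x) (Y x) + act (zFun β β'' x) (N x)) =
      ∫ t in (0 : ℝ)..x, act (β t)ᴴ (φ t) := fun x hx =>
    hω.eq_of_ae hφi (by simp [hY0, hY0', hN0, act_zero]) (Filter.EventuallyEq.refl _ _) hx
  set ω : ℝ → EuclideanSpace ℂ (Fin m₁ ⊕ Fin m₂) :=
    fun x => ∫ t in (0 : ℝ)..x, act (β t)ᴴ (φ t) with hωdef
  replace hωe : ∀ x ∈ Icc 0 r, -(act (β x)ᴴ (Y' x) - act ((β' x)ᴴ - (β x)ᴴ * qFun β' x) (Y x)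
      + act (zFun β β'' x) (N x)) = ω x := hωe
  have hω0 : ω 0 = 0 := by simp [hωdef]
  have hJ := HasIntDeriv.const r (jMat m₁ m₂)
  -- The two identities for `β` act here: `β j β^* = 0` removes `φ` from `(K φ)'`, and `β' j β^* = i
  -- I` puts `-φ` into `(K φ)''`.
  have hP1 : HasIntDeriv r (formulaK β φ) fun x => act (Complex.I • (β' x * jMat m₁ m₂)) (ω x) := by
    refine (((hβ.hasIntDeriv.mul hJ).smul Complex.I).act hφi).congr (fun x _ => ?_)
      |>.congr_deriv fun x hx => ?_
    · rw [formulaK, smul_act]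
    · rw [act_act, Matrix.smul_mul, hβ0 x (Ioo_subset_Icc_self hx), smul_zero, zero_act, add_zero,
        Matrix.mul_zero, add_zero]
  have hP2 : HasIntDeriv r (fun x => act (Complex.I • (β' x * jMat m₁ m₂)) (ω x)) fun x =>
      act (Complex.I • (β'' x * jMat m₁ m₂)) (ω x) - φ x := by
    refine (((hβ.hasIntDeriv_deriv.mul hJ).smul Complex.I).act hφi).congr_deriv fun x hx => ?_
    rw [act_act, Matrix.smul_mul, hβ1 x (Ioo_subset_Icc_self hx), smul_smul, Complex.I_mul_I,
      neg_smul, one_smul, neg_act, one_act, Matrix.mul_zero, add_zero, ← sub_eq_add_neg]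
  -- Inserting the formula for `ω` and `i β'' j β^* = q` reproduces `Y''`. Hence `Y` and `K φ` have
  -- the same second derivative and the same zero initial values.
  have e2 : Y'' =ᵐ[volume.restrict (Ioo 0 r)] fun x =>
      act (Complex.I • (β'' x * jMat m₁ m₂)) (ω x) - φ x := by
    filter_upwards [hβ.qFun_eq_ae hβ1, ae_of_Icc hωe] with x hqx hωx
    rw [← hωx]
    have e3 : ∀ v, act (β'' x * (jMat m₁ m₂ * (β x)ᴴ)) v = -(Complex.I • act (qFun β' x) v) := by
      intro v
      rw [hqx, smul_act, smul_smul, Complex.I_mul_I, neg_smul, one_smul, neg_neg, Matrix.mul_assoc]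
    have e4 : ∀ v, act (β'' x * (jMat m₁ m₂ * ((β x)ᴴ * qFun β' x))) v =
        -(Complex.I • act (qFun β' x * qFun β' x) v) := by
      intro v
      rw [← act_act (qFun β' x), ← e3, act_act]
      simp only [Matrix.mul_assoc]
    simp only [hY'', act_sub, act_add, act_neg, act_act, sub_act, smul_act, smul_neg,
      Matrix.smul_mul, Matrix.mul_assoc, e3, e4, smul_smul, Complex.I_mul_I,
      neg_smul, one_smul]
    module
  have e1 : ∀ x ∈ Icc 0 r, Y' x = act (Complex.I • (β' x * jMat m₁ m₂)) (ω x) := fun x hx =>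
    hYY.eq_of_ae hP2 (by rw [hY0', hω0, act_zero]) e2 hx
  refine hY1.eq_of_ae hP1 ?_ (ae_of_Icc e1) hx
  rw [hY0, formulaK, intervalIntegral.integral_same, act_zero, smul_zero]

end Intertwining

/-! ### Uniqueness for the transformed initial value problem. -/

section Uniqueness

variable {p : ℕ} {q : Type*} [Fintype q] [DecidableEq q] {r : ℝ}
  {u₄ : ℝ → Matrix (Fin p) (Fin p) ℂ} {h₁ : ℝ → Matrix (Fin p) q ℂ} {h₂ : ℝ → Matrix q (Fin p) ℂ}

theorem potential_sub (m₂ : MemLp h₂ 2 (volume.restrict (Ioo 0 r)))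
    {y z : ℝ → EuclideanSpace ℂ (Fin p)} (hy : ContinuousOn y (Icc 0 r))
    (hz : ContinuousOn z (Icc 0 r)) {x : ℝ} (hx : x ∈ Icc 0 r) :
    potential u₄ h₁ h₂ (fun t => y t - z t) x = potential u₄ h₁ h₂ y x - potential u₄ h₁ h₂ z x := by
  have h0 : (0 : ℝ) ∈ Icc 0 r := left_mem_Icc.2 (hx.1.trans hx.2)
  have i : ∀ {z : ℝ → EuclideanSpace ℂ (Fin p)}, ContinuousOn z (Icc 0 r) →
      IntervalIntegrable (fun t => act (h₂ t) (z t)) volume 0 x := fun hz =>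
    intervalIntegrable_of_Ioo (memLp_integrableOn_Ioo (memLp_bilin_left actR m₂ hz)) h0 hx
  simp only [potential, act_sub]
  rw [intervalIntegral.integral_sub (i hy) (i hz), act_sub]
  abel

/-- The initial value problem `d'' = u₄ d - h₁ ∫₀ˣ h₂ d`, `d(0) = d'(0) = 0`, has only the zero
solution. -/
theorem eq_zero_of_potential (mu : MemLp u₄ 2 (volume.restrict (Ioo 0 r)))
    (m₁ : MemLp h₁ 2 (volume.restrict (Ioo 0 r))) (m₂ : MemLp h₂ 2 (volume.restrict (Ioo 0 r)))
    {d d' d'' : ℝ → EuclideanSpace ℂ (Fin p)} (hd : HasU r d d' d'') (h0 : d 0 = 0) (h0' : d' 0 = 0)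
    (he : d'' =ᵐ[volume.restrict (Ioo 0 r)] potential u₄ h₁ h₂ d) :
    ∀ x ∈ Icc 0 r, d x = 0 := by
  set H := ∫ t in (0 : ℝ)..r, ‖h₂ t‖ with hH
  have i₂ := memLp_integrableOn_Ioo m₂.norm
  have mc : MemLp (fun s => ‖u₄ s‖ + ‖h₁ s‖ * H) 2 (volume.restrict (Ioo 0 r)) :=
    mu.norm.add (m₁.norm.mul_const _)
  have hd1 := hd.hasIntDeriv
  have hd2 := hd.hasIntDeriv_deriv.congr_ae he
  refine eq_zero_of_volterra_bound (mc.const_mul r) hd1.continuousOn fun L M hL hM hb x hx => ?_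
  have z0 : (0 : ℝ) ∈ Icc 0 r := left_mem_Icc.2 (hx.1.trans hx.2)
  have hp : ∀ s ∈ Icc 0 r, ‖potential u₄ h₁ h₂ d s‖ ≤
      M * ((‖u₄ s‖ + ‖h₁ s‖ * H) * Real.exp (L * s)) := by
    intro s hs
    have h2 : ‖∫ t in (0 : ℝ)..s, act (h₂ t) (d t)‖ ≤ H * (M * Real.exp (L * s)) := by
      calc _ ≤ ∫ t in (0 : ℝ)..s, ‖h₂ t‖ * (M * Real.exp (L * s)) := by
            refine intervalIntegral.norm_integral_le_of_norm_le hs.1 ?_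
              ((intervalIntegrable_of_Ioo i₂ z0 hs).mul_const _)
            refine Filter.Eventually.of_forall fun t ht => ?_
            refine (norm_act_le _ _).trans ?_
            gcongr
            refine (hb t ⟨ht.1.le, ht.2.trans hs.2⟩).trans ?_
            gcongr
            exact ht.2
        _ ≤ H * (M * Real.exp (L * s)) := by
            rw [intervalIntegral.integral_mul_const]
            gcongr
            refine intervalIntegral.integral_mono_interval le_rfl hs.1 hs.2
              (Filter.Eventually.of_forall fun _ => norm_nonneg _) ?_
            exact intervalIntegrable_of_Ioo i₂ z0 (right_mem_Icc.2 (hx.1.trans hx.2))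
    calc _ ≤ ‖u₄ s‖ * ‖d s‖ + ‖h₁ s‖ * ‖∫ t in (0 : ℝ)..s, act (h₂ t) (d t)‖ :=
          (norm_sub_le _ _).trans (add_le_add (norm_act_le _ _) (norm_act_le _ _))
      _ ≤ ‖u₄ s‖ * (M * Real.exp (L * s)) + ‖h₁ s‖ * (H * (M * Real.exp (L * s))) := by
          gcongr
          exact hb s hs
      _ = _ := by ring
  have ic : IntegrableOn (fun s => (‖u₄ s‖ + ‖h₁ s‖ * H) * Real.exp (L * s)) (Ioo 0 r) :=
    memLp_integrableOn_Ioo (memLp_bilin_left (ContinuousLinearMap.mul ℝ ℝ) mc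
      (g := fun s => Real.exp (L * s)) (by fun_prop))
  have hH0 : 0 ≤ H := intervalIntegral.integral_nonneg (hx.1.trans hx.2) fun _ _ => norm_nonneg _
  -- The bound for `d'` is taken up to the final point `x`, so that the second integration only
  -- costs a factor `x ≤ r`; hence the coefficient `r (‖u₄‖ + ‖h₁‖ H)`.
  have hd' : ∀ y ∈ Icc 0 x, ‖d' y‖ ≤
      M * ∫ s in (0 : ℝ)..x, (‖u₄ s‖ + ‖h₁ s‖ * H) * Real.exp (L * s) := by
    intro y hy
    have hyr : y ∈ Icc 0 r := ⟨hy.1, hy.2.trans hx.2⟩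
    rw [hd2.2 y hyr, h0', zero_add, ← intervalIntegral.integral_const_mul]
    refine (intervalIntegral.norm_integral_le_of_norm_le hy.1 (Filter.Eventually.of_forall
      fun s hs => hp s ⟨hs.1.le, hs.2.trans hyr.2⟩)
      ((intervalIntegrable_of_Ioo ic z0 hyr).const_mul M)).trans ?_
    refine intervalIntegral.integral_mono_interval le_rfl hy.1 hy.2
      (Filter.Eventually.of_forall fun s => ?_) ((intervalIntegrable_of_Ioo ic z0 hx).const_mul M)
    simp only [Pi.zero_apply]
    positivity
  have e : ∫ s in (0 : ℝ)..x, r * (‖u₄ s‖ + ‖h₁ s‖ * H) * Real.exp (L * s) =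
      r * ∫ s in (0 : ℝ)..x, (‖u₄ s‖ + ‖h₁ s‖ * H) * Real.exp (L * s) := by
    rw [← intervalIntegral.integral_const_mul]
    simp only [mul_assoc]
  have hI : 0 ≤ ∫ s in (0 : ℝ)..x, (‖u₄ s‖ + ‖h₁ s‖ * H) * Real.exp (L * s) :=
    intervalIntegral.integral_nonneg hx.1 fun s _ => by positivity
  rw [e, hd1.2 x hx, h0, zero_add]
  refine (intervalIntegral.norm_integral_le_of_norm_le_const (C := M *
    ∫ s in (0 : ℝ)..x, (‖u₄ s‖ + ‖h₁ s‖ * H) * Real.exp (L * s)) fun y hy => ?_).trans ?_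
  · rw [uIoc_of_le hx.1] at hy
    exact hd' y (Ioc_subset_Icc_self hy)
  · rw [sub_zero, abs_of_nonneg hx.1]
    calc _ ≤ M * (∫ s in (0 : ℝ)..x, (‖u₄ s‖ + ‖h₁ s‖ * H) * Real.exp (L * s)) * r := by
          gcongr; exact hx.2
      _ = _ := by ring

end Uniqueness

/-! ### `V` and its inverse preserve the class `𝒰`. -/

section Regularity

variable {m₁ m₂ : ℕ} {r : ℝ} {β β' β'' : ℝ → Matrix (Fin m₂) (Fin m₁ ⊕ Fin m₂) ℂ}
  {W : ℝ → ℝ → Matrix (Fin m₂) (Fin m₂) ℂ} {C : ℝ}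

/-- A Volterra equation of the second kind is solvable in `L₂`. -/
theorem IsBddKernel.exists_solution {p : ℕ} {k : ℝ → ℝ → Matrix (Fin p) (Fin p) ℂ}
    (hk : IsBddKernel r k C) {g : ℝ → EuclideanSpace ℂ (Fin p)}
    (hg : MemLp g 2 (volume.restrict (Ioo 0 r))) :
    ∃ f : ℝ → EuclideanSpace ℂ (Fin p), MemLp f 2 (volume.restrict (Ioo 0 r)) ∧
      (fun x => f x + volterra k f x) =ᵐ[volume.restrict (Ioo 0 r)] g := by
  obtain ⟨T, hT⟩ := hk.exists_represents_volterra
  obtain ⟨S, hS⟩ := (hk.isUnit_one_add hT).exists_right_inv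
  set f : L2 p r := S (toL2 r g) with hf
  have h1 : f + T f = toL2 r g := by
    have := congr_arg (fun R : L2 p r →L[ℂ] L2 p r => R (toL2 r g)) hS
    simpa using this
  refine ⟨f, Lp.memLp f, ?_⟩
  have h2 := toL2_coe hg
  rw [← h1] at h2
  filter_upwards [Lp.coeFn_add f (T f), hT f, h2] with x h3 h4 h5
  rw [← h5, h3, Pi.add_apply, h4]

theorem IsTransformationKernel.hasU (hβ : HasU r β β' β'')
    (hW : IsTransformationKernel r β β' β'' W) {y y' y'' : ℝ → EuclideanSpace ℂ (Fin m₂)}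
    (hy : HasU r y y' y'') : ∃ g' g'', HasU r (transformation β' W y) g' g'' := by
  obtain ⟨z', -, hz⟩ := hW y y' y'' hy
  exact hβ.hasU_uFun.act hz

/-- Let `z = u^* f`. If `y + W y = z`, the transformation property forces `(1 + W) y'' = z'' -
potential z - W(·, 0) z'(0)`. This is solvable for `y''` in `L₂`; integrate twice with the initial
values of `z`. The difference of `y + W y` and `z` then solves the homogeneous problem and vanishes.
-/
theorem IsTransformationKernel.exists_preimage (hβ : HasU r β β' β'') (hk : IsBddKernel r W C)
    (hW : IsTransformationKernel r β β' β'' W) {f f' f'' : ℝ → EuclideanSpace ℂ (Fin m₂)}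
    (hf : HasU r f f' f'') : ∃ y y' y'', HasU r y y' y'' ∧
      ∀ x ∈ Icc 0 r, transformation β' W y x = f x := by
  obtain ⟨z', z'', hz⟩ := (hβ.hasU_uFun.clm conjTransposeR).act hf
  simp only [conjTransposeR_apply] at hz
  set z := fun x => act (uFun β' x)ᴴ (f x) with hzdef
  have mu := hβ.memLp_u4Fun
  have m₁ := hβ.memLp_h1Fun
  have m₂ := hβ.memLp_h2Fun
  have mW : MemLp (fun x => act (W x 0) (z' 0)) 2 (volume.restrict (Ioo 0 r)) := by
    refine MemLp.of_bound (C := C * ‖z' 0‖) ?_ ?_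
    · refine (stronglyMeasurable_act ?_ stronglyMeasurable_const).aestronglyMeasurable
      exact hk.meas.comp_measurable (g := fun x : ℝ => (x, (0 : ℝ))) (by fun_prop)
    · refine (ae_restrict_iff' measurableSet_Ioo).2 (Filter.Eventually.of_forall fun x hx => ?_)
      exact (norm_act_le _ _).trans (mul_le_mul_of_nonneg_right
        (hk.bound x 0 le_rfl hx.1.le hx.2.le) (norm_nonneg _))
  obtain ⟨g, hg, hge⟩ := hk.exists_solution
    ((hz.2.1.sub (memLp_potential mu m₁ m₂ hz.hasIntDeriv.continuousOn)).sub mW)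
  obtain ⟨y, y', hy0, hy1, hy⟩ := exists_hasU_of_memLp (z 0) (z' 0) hg
  refine ⟨y, y', g, hy, fun x hx => ?_⟩
  obtain ⟨v', hv0, hv⟩ := hW y y' g hy
  have hd := hv.sub hz
  have key := eq_zero_of_potential mu m₁ m₂ hd (by simp [volterra, hy0]) (by rw [hv0, hy1, sub_self])
    (by
      filter_upwards [hge, ae_restrict_mem measurableSet_Ioo] with t ht htm
      have htc := Ioo_subset_Icc_self htm
      simp only [Pi.sub_apply] at ht
      rw [hy1, ht, potential_sub m₂ hv.hasIntDeriv.continuousOn hz.hasIntDeriv.continuousOn htc]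
      abel) x hx
  rw [transformation, sub_eq_zero.1 key, hzdef, act_act, (hβ.uFun_unitary hx).2, one_act]

end Regularity

/-! ### Convolution operators on the class `𝒰`. -/

section Convolution

variable {p : ℕ} {r : ℝ} {k : ℝ → Matrix (Fin p) (Fin p) ℂ}

theorem exists_isBddKernel_of_continuous {k : ℝ → ℝ → Matrix (Fin p) (Fin p) ℂ}
    (hk : Continuous (Function.uncurry k)) (r : ℝ) : ∃ C, IsBddKernel r k C := by
  obtain ⟨C, hC⟩ := ((isCompact_Icc (a := (0 : ℝ)) (b := r)).prod
    (isCompact_Icc (a := (0 : ℝ)) (b := r))).exists_bound_of_continuousOn hk.continuousOn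
  refine ⟨|C|, hk.stronglyMeasurable, abs_nonneg C, fun x t h1 h2 h3 => ?_⟩
  exact (hC (x, t) ⟨⟨h1.trans h2, h3⟩, ⟨h1, h2.trans h3⟩⟩).trans (le_abs_self C)

theorem exists_isBddKernel_convolution (hk : Continuous k) (r : ℝ) :
    ∃ C, IsBddKernel r (fun x t => k (x - t)) C :=
  exists_isBddKernel_of_continuous (k := fun x t => k (x - t)) (by
    change Continuous fun z : ℝ × ℝ => k (z.1 - z.2)
    fun_prop) r

theorem integrableOn_act_square {g : ℝ × ℝ → Matrix (Fin p) (Fin p) ℂ} (hg : Continuous g)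
    {f : ℝ → EuclideanSpace ℂ (Fin p)} {x : ℝ} (hf : IntegrableOn f (Ioc 0 x)) :
    IntegrableOn (fun z => act (g z) (f z.2)) (Ioc 0 x ×ˢ Ioc 0 x) := by
  obtain ⟨C, hC⟩ := ((isCompact_Icc (a := (0 : ℝ)) (b := x)).prod
    (isCompact_Icc (a := (0 : ℝ)) (b := x))).exists_bound_of_continuousOn hg.continuousOn
  have hf2 : IntegrableOn (fun z : ℝ × ℝ => f z.2) (Ioc 0 x ×ˢ Ioc 0 x) := by
    rw [IntegrableOn, Measure.volume_eq_prod, ← Measure.prod_restrict]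
    exact Integrable.comp_snd (f := f) hf _
  refine (hf2.norm.const_mul C).mono' ?_ ?_
  · exact (actR (l := Fin p) (m := Fin p)).continuous₂.comp_aestronglyMeasurable₂
      hg.stronglyMeasurable.aestronglyMeasurable hf2.1
  · refine (ae_restrict_iff' (measurableSet_Ioc.prod measurableSet_Ioc)).2
      (Filter.Eventually.of_forall fun z hz => ?_)
    exact (norm_act_le _ _).trans (mul_le_mul_of_nonneg_right
      (hC z ⟨Ioc_subset_Icc_self hz.1, Ioc_subset_Icc_self hz.2⟩) (norm_nonneg _))

/-- The derivative of a convolution. -/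
theorem HasIntDeriv.convolution (hk : Continuous k) {f f' : ℝ → EuclideanSpace ℂ (Fin p)}
    (hf : HasIntDeriv r f f') : HasIntDeriv r (volterra (fun x t => k (x - t)) f)
      fun x => CanonicalSystem.act (k x) (f 0) + volterra (fun x t => k (x - t)) f' x := by
  obtain ⟨C, hC⟩ := exists_isBddKernel_convolution hk r
  have hkv : ∀ v, Continuous fun τ => CanonicalSystem.act (k τ) v := fun v =>
    ((actR (l := Fin p) (m := Fin p)).flip v).continuous.comp hk
  have i1 : IntegrableOn (fun x => CanonicalSystem.act (k x) (f 0)) (Ioo 0 r) :=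
    (hkv _).integrableOn_Icc.mono_set Ioo_subset_Icc_self
  have i2 : IntegrableOn (volterra (fun x t => k (x - t)) f') (Ioo 0 r) :=
    (hC.memLp (q := 2) hf.1).integrable (by norm_num)
  refine ⟨i1.add i2, fun x hx => ?_⟩
  have h0 : (0 : ℝ) ∈ Icc 0 r := left_mem_Icc.2 (hx.1.trans hx.2)
  have hf' : IntegrableOn f' (Ioc 0 x) :=
    (intervalIntegrable_iff_integrableOn_Ioc_of_le hx.1).1 (hf.intervalIntegrable h0 hx)
  have s1 := integral_triangle_swap hx.1
    (integrableOn_act_square (g := fun z : ℝ × ℝ => k (x - z.1)) (by fun_prop) hf')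
  have s2 := integral_triangle_swap hx.1
    (integrableOn_act_square (g := fun z : ℝ × ℝ => k (z.1 - z.2)) (by fun_prop) hf')
  have e1 : ∀ t ∈ uIcc 0 x, CanonicalSystem.act (k (x - t)) (f t) =
      CanonicalSystem.act (k (x - t)) (f 0) +
        ∫ s in (0 : ℝ)..t, CanonicalSystem.act (k (x - t)) (f' s) := by
    intro t ht
    rw [uIcc_of_le hx.1] at ht
    have htr : t ∈ Icc 0 r := ⟨ht.1, ht.2.trans hx.2⟩
    have := (actR (k (x - t))).intervalIntegral_comp_comm (hf.intervalIntegrable h0 htr)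
    simp only [actR_apply] at this
    rw [this, hf.2 t htr, act_add]
  have c1 : IntervalIntegrable (fun t => CanonicalSystem.act (k (x - t)) (f 0)) volume 0 x :=
    Continuous.intervalIntegrable ((hkv _).comp (continuous_const.sub continuous_id)) _ _
  have c2 : IntervalIntegrable
      (fun t => ∫ s in (0 : ℝ)..t, CanonicalSystem.act (k (x - t)) (f' s)) volume 0 x := by
    refine ((hC.intervalIntegrable (f := f)
      (hf.continuousOn.integrableOn_Icc.mono_set Ioo_subset_Icc_self) hx).sub c1).congr ?_
    intro t ht
    simp only [e1 t (uIoc_subset_uIcc ht)]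
    abel
  -- Both inner integrals equal the integral of `k` over `(0, x - t)`, once by reflection and once
  -- by translation.
  have e2 : ∫ t in (0 : ℝ)..x, ∫ s in t..x, CanonicalSystem.act (k (x - s)) (f' t) =
      ∫ t in (0 : ℝ)..x, ∫ s in t..x, CanonicalSystem.act (k (s - t)) (f' t) := by
    refine intervalIntegral.integral_congr fun t _ => ?_
    rw [intervalIntegral.integral_comp_sub_left (fun τ => CanonicalSystem.act (k τ) (f' t)) x,
      intervalIntegral.integral_comp_sub_right (fun τ => CanonicalSystem.act (k τ) (f' t)) t,
      sub_self, sub_self]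
  have e3 : ∫ t in (0 : ℝ)..x, CanonicalSystem.act (k (x - t)) (f 0) =
      ∫ t in (0 : ℝ)..x, CanonicalSystem.act (k t) (f 0) := by
    rw [intervalIntegral.integral_comp_sub_left (fun τ => CanonicalSystem.act (k τ) (f 0)) x,
      sub_self, sub_zero]
  have e0 : volterra (fun x t => k (x - t)) f 0 = 0 := by simp [volterra]
  rw [e0, zero_add, intervalIntegral.integral_add (intervalIntegrable_of_Ioo i1 h0 hx)
    (intervalIntegrable_of_Ioo i2 h0 hx)]
  simp only [volterra] at s1 s2 ⊢
  rw [intervalIntegral.integral_congr e1, intervalIntegral.integral_add c1 c2, e3, s1, e2, s2]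

variable {Y Y' Y'' : ℝ → Matrix (Fin p) (Fin p) ℂ}

/-- The operator `f ↦ Y(0) f + ∫₀ˣ Y'(x - t) f(t) dt` on functions of class `𝒰`. -/
theorem HasU.formulaV0 (hY : HasU r Y Y' Y'') (hk : Continuous k) (hkY : ∀ x ∈ Icc 0 r, k x = Y' x)
    {f f' f'' : ℝ → EuclideanSpace ℂ (Fin p)} (hf : HasU r f f' f'') :
    HasU r (formulaV0 (Y 0) k f) (fun x => CanonicalSystem.act (Y' x) (f 0) + CanonicalSystem.formulaV0 (Y 0) k f' x)
      fun x => CanonicalSystem.act (Y'' x) (f 0) +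
        (CanonicalSystem.act (Y' x) (f' 0) + CanonicalSystem.formulaV0 (Y 0) k f'' x) := by
  obtain ⟨C, hC⟩ := exists_isBddKernel_convolution hk r
  have hf1 := hf.hasIntDeriv
  have hf2 := hf.hasIntDeriv_deriv
  have hb := HasIntDeriv.const r (Y 0)
  have step : ∀ {g g' : ℝ → EuclideanSpace ℂ (Fin p)}, HasIntDeriv r g g' →
      HasIntDeriv r (CanonicalSystem.formulaV0 (Y 0) k g)
        fun x => CanonicalSystem.act (Y' x) (g 0) + CanonicalSystem.formulaV0 (Y 0) k g' x := by
    intro g g' hg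
    refine ((hb.act hg).add (hg.convolution hk)).congr_deriv fun x hx => ?_
    rw [zero_act, zero_add, hkY x (Ioo_subset_Icc_self hx), CanonicalSystem.formulaV0, volterra]
    abel
  have h2 := (hY.hasIntDeriv_deriv.act (HasIntDeriv.const r (f 0))).add (step hf2)
  refine (step hf1).hasU (h2.congr_deriv fun x _ => ?_) (MemLp.add ?_ (MemLp.add ?_ (MemLp.add ?_ ?_)))
  · rw [act_zero, add_zero]
  · exact memLp_bilin_left actR hY.2.1 continuousOn_const
  · exact memLp_bilin_left actR (memLp_of_continuousOn hY.hasIntDeriv_deriv.continuousOn)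
      continuousOn_const
  · exact memLp_bilin_right (actR (l := Fin p) (m := Fin p)) (f := fun _ => Y 0)
      continuousOn_const hf.2.1
  · exact hC.memLp hf2.1

end Convolution

/-! ### Passage between matrix functions and their columns. -/

section Columns

variable {p : ℕ} {r : ℝ}

/-- The matrix whose only nonzero column is the `k`-th one. -/
def insertCol (k : Fin p) : EuclideanSpace ℂ (Fin p) →L[ℝ] Matrix (Fin p) (Fin p) ℂ :=
  LinearMap.toContinuousLinearMap
    { toFun := fun v => Matrix.of fun i l => if l = k then v i else 0
      map_add' := fun v w => by ext i l; by_cases h : l = k <;> simp [h]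
      map_smul' := fun c v => by ext i l; by_cases h : l = k <;> simp [h] }

/-- Columns are images of the standard basis vectors, so statements about them are instances of
those about vectors. -/
theorem colE_eq_act (M : Matrix (Fin p) (Fin p) ℂ) (k : Fin p) :
    colE M k = act M (colE 1 k) := by
  ext i
  simp [colE, act, Matrix.mulVec, dotProduct, Matrix.one_apply]

theorem HasU.sum {E ι : Type*} [NormedAddCommGroup E] [NormedSpace ℝ E] [CompleteSpace E]
    (s : Finset ι) {G G' G'' : ι → ℝ → E} (h : ∀ i, HasU r (G i) (G' i) (G'' i)) :
    HasU r (fun x => ∑ i ∈ s, G i x) (fun x => ∑ i ∈ s, G' i x) fun x => ∑ i ∈ s, G'' i x := by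
  classical
  induction s using Finset.induction_on with
  | empty =>
    simp only [Finset.sum_empty]
    exact (HasIntDeriv.const r 0).hasU (HasIntDeriv.const r 0) MemLp.zero
  | insert i s hi ih =>
    simp only [Finset.sum_insert hi]
    exact ((h i).hasIntDeriv.add ih.hasIntDeriv).hasU
      ((h i).hasIntDeriv_deriv.add ih.hasIntDeriv_deriv) ((h i).2.1.add ih.2.1)

/-- A matrix function with columns of class `𝒰` is of class `𝒰`. -/
theorem exists_hasU_of_columns {y y' y'' : Fin p → ℝ → EuclideanSpace ℂ (Fin p)}
    (h : ∀ k, HasU r (y k) (y' k) (y'' k)) :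
    ∃ Y Y' Y'' : ℝ → Matrix (Fin p) (Fin p) ℂ, HasU r Y Y' Y'' ∧ ∀ k x, colE (Y x) k = y k x := by
  refine ⟨_, _, _, HasU.sum Finset.univ fun k => (h k).clm (insertCol k), fun k x => ?_⟩
  ext i
  simp [colE, Matrix.sum_apply, insertCol]

/-- The columns of a matrix function of class `𝒰` are of class `𝒰`. -/
theorem HasU.colE {M M' M'' : ℝ → Matrix (Fin p) (Fin p) ℂ} (h : HasU r M M' M'') (k : Fin p) :
    HasU r (fun x => colE (M x) k) (fun x => CanonicalSystem.colE (M' x) k)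
      fun x => CanonicalSystem.colE (M'' x) k := by
  have e : ∀ N : ℝ → Matrix (Fin p) (Fin p) ℂ, (fun x => CanonicalSystem.colE (N x) k) =
      fun x => actR.flip (CanonicalSystem.colE 1 k) (N x) := fun N => funext fun x => colE_eq_act _ k
  rw [e, e, e]
  exact h.clm _

end Columns

/-! ### From pointwise formulas to operators on `L₂`; the operator `V₀`. -/

section Classes

variable {p : ℕ} {r : ℝ}

theorem Represents.toL2_apply {T : L2 p r →L[ℂ] L2 p r}
    {φ : (ℝ → EuclideanSpace ℂ (Fin p)) → ℝ → EuclideanSpace ℂ (Fin p)} (hT : Represents T φ)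
    (hφ : RespectsAE r φ) {f g : ℝ → EuclideanSpace ℂ (Fin p)}
    (hf : MemLp f 2 (volume.restrict (Ioo 0 r))) (h : ∀ x ∈ Icc 0 r, φ f x = g x) :
    T (toL2 r f) = toL2 r g :=
  (toL2_eq ((hT.apply_toL2 hφ hf).trans (ae_of_Icc h))).symm

theorem Represents.mapsU {T : L2 p r →L[ℂ] L2 p r}
    {φ : (ℝ → EuclideanSpace ℂ (Fin p)) → ℝ → EuclideanSpace ℂ (Fin p)} (hT : Represents T φ)
    (hφ : RespectsAE r φ)
    (h : ∀ f f' f'', HasU r f f' f'' → ∃ g' g'', HasU r (φ f) g' g'') : MapsU T := by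
  intro f f' f'' hf
  obtain ⟨g', g'', hg⟩ := h f f' f'' hf
  exact ⟨_, g', g'', hg, hT.toL2_apply hφ hf.memLp fun _ _ => rfl⟩

/-- Since `T` is injective on `L₂`, any preimage found in `𝒰` is the value of the inverse. -/
theorem Represents.mapsU_symm {T : L2 p r ≃L[ℂ] L2 p r}
    {φ : (ℝ → EuclideanSpace ℂ (Fin p)) → ℝ → EuclideanSpace ℂ (Fin p)}
    (hT : Represents (T : L2 p r →L[ℂ] L2 p r) φ) (hφ : RespectsAE r φ)
    (h : ∀ f f' f'', HasU r f f' f'' → ∃ y y' y'', HasU r y y' y'' ∧ ∀ x ∈ Icc 0 r, φ y x = f x) :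
    MapsU (T.symm : L2 p r →L[ℂ] L2 p r) := by
  intro f f' f'' hf
  obtain ⟨y, y', y'', hy, e⟩ := h f f' f'' hf
  exact ⟨y, y', y'', hy, T.symm_apply_eq.2 (hT.toL2_apply hφ hy.memLp e).symm⟩

theorem MapsU.comp {S T : L2 p r →L[ℂ] L2 p r} (hS : MapsU S) (hT : MapsU T) :
    MapsU (S.comp T) := by
  intro f f' f'' hf
  obtain ⟨g, g', g'', hg, e⟩ := hT f f' f'' hf
  obtain ⟨h, h', h'', hh, e'⟩ := hS g g' g'' hg
  exact ⟨h, h', h'', hh, by rw [ContinuousLinearMap.comp_apply, e, e']⟩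

theorem respectsAE_formulaA : RespectsAE r (formulaA (p := p)) := fun f g h =>
  ae_of_Icc fun x hx => integral_congr_of_ae_Ioo (r := r) (by
    filter_upwards [h] with t ht
    rw [ht]) (left_mem_Icc.2 (hx.1.trans hx.2)) hx

theorem respectsAE_formulaV0 (b : Matrix (Fin p) (Fin p) ℂ) (k : ℝ → Matrix (Fin p) (Fin p) ℂ) :
    RespectsAE r (formulaV0 b k) := fun f g h => by
  filter_upwards [h, respectsAE_volterra (k := fun x t => k (x - t)) f g h] with x h1 h2
  simp only [volterra] at h2
  rw [formulaV0, formulaV0, h1, h2]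

theorem exists_equiv_of_isUnit {S : L2 p r →L[ℂ] L2 p r} (h : IsUnit S) :
    ∃ T : L2 p r ≃L[ℂ] L2 p r, (T : L2 p r →L[ℂ] L2 p r) = S :=
  ⟨ContinuousLinearEquiv.unitsEquiv ℂ _ h.unit, by ext1 f; rfl⟩

/-- Multiplication by a continuous, invertible matrix function, followed by an operator `1 + T` with
a Volterra operator `T`. -/
theorem exists_equiv_represents {M N : ℝ → Matrix (Fin p) (Fin p) ℂ}
    (hM : ContinuousOn M (Icc 0 r)) (hN : ContinuousOn N (Icc 0 r))
    (h1 : ∀ x ∈ Icc 0 r, M x * N x = 1) {k : ℝ → ℝ → Matrix (Fin p) (Fin p) ℂ} {C : ℝ}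
    (hk : IsBddKernel r k C) : ∃ T : L2 p r ≃L[ℂ] L2 p r,
      Represents (T : L2 p r →L[ℂ] L2 p r) fun f x => act (M x) (f x + volterra k f x) := by
  obtain ⟨P, hP⟩ := exists_multiplication hM
  obtain ⟨Q, hQ⟩ := exists_multiplication hN
  obtain ⟨S, hS⟩ := hk.exists_represents_volterra
  have inv : ∀ {P Q : L2 p r →L[ℂ] L2 p r} {M N : ℝ → Matrix (Fin p) (Fin p) ℂ},
      (Represents P fun f x => act (M x) (f x)) → (Represents Q fun f x => act (N x) (f x)) →
      (∀ x ∈ Icc 0 r, M x * N x = 1) → P * Q = 1 := by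
    intro P Q M N hP hQ h
    ext1 f
    refine Lp.ext ?_
    filter_upwards [hP (Q f), hQ f, ae_of_Icc h] with x e1 e2 e3
    rw [mul_apply_eq_comp, e1, e2, act_act, e3, one_act]
    rfl
  have hu : IsUnit P := ⟨⟨P, Q, inv hP hQ h1, inv hQ hP fun x hx => mul_eq_one_comm.1 (h1 x hx)⟩, rfl⟩
  obtain ⟨T, hT⟩ := exists_equiv_of_isUnit (hu.mul (hk.isUnit_one_add hS))
  refine ⟨T, fun f => ?_⟩
  rw [hT]
  filter_upwards [hP ((1 + S) f), Lp.coeFn_add f (S f), hS f] with x e1 e2 e3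
  rw [mul_apply_eq_comp, e1]
  have : (1 + S) f = f + S f := rfl
  rw [this, e2, Pi.add_apply, e3]

/-- Outside `[0, r]` the given functions are arbitrary; a continuous extension makes kernels such as
`k(x - t)` jointly continuous on the plane. -/
theorem exists_continuous_extension {E : Type*} [TopologicalSpace E] {f : ℝ → E} (hr : 0 ≤ r)
    (hf : ContinuousOn f (Icc 0 r)) : ∃ g : ℝ → E, Continuous g ∧ ∀ x ∈ Icc 0 r, g x = f x :=
  ⟨IccExtend hr ((Icc 0 r).domRestrict f), (continuousOn_iff_continuous_domRestrict.1 hf).Icc_extend',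
    fun _ hx => IccExtend_of_mem hr _ hx⟩

theorem exists_represents_formulaA (p : ℕ) (r : ℝ) :
    ∃ A : L2 p r →L[ℂ] L2 p r, Represents A formulaA := by
  have hc : Continuous (Function.uncurry fun x t : ℝ =>
      ((t - x : ℝ) : ℂ) • (1 : Matrix (Fin p) (Fin p) ℂ)) := by
    change Continuous fun z : ℝ × ℝ => ((z.2 - z.1 : ℝ) : ℂ) • (1 : Matrix (Fin p) (Fin p) ℂ)
    fun_prop
  obtain ⟨C, hC⟩ := exists_isBddKernel_of_continuous hc r
  obtain ⟨A, hA⟩ := hC.exists_represents_volterra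
  refine ⟨A, hA.congr fun f x _ => ?_⟩
  simp only [volterra, formulaA, smul_act, one_act]
  exact intervalIntegral.integral_congr fun t _ => Complex.coe_smul _ _

/-- The convolution operator commutes with `A`. -/
theorem formulaV0_formulaA {Y Y' Y'' k : ℝ → Matrix (Fin p) (Fin p) ℂ} (hY : HasU r Y Y' Y'')
    (hk : Continuous k) (hkY : ∀ x ∈ Icc 0 r, k x = Y' x) {f : ℝ → EuclideanSpace ℂ (Fin p)}
    (hf : MemLp f 2 (volume.restrict (Ioo 0 r))) {x : ℝ} (hx : x ∈ Icc 0 r) :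
    formulaV0 (Y 0) k (formulaA f) x = formulaA (formulaV0 (Y 0) k f) x := by
  obtain ⟨C, hC⟩ := exists_isBddKernel_convolution hk r
  have hm : MemLp (formulaV0 (Y 0) k f) 2 (volume.restrict (Ioo 0 r)) :=
    (memLp_bilin_right (actR (l := Fin p) (m := Fin p)) (f := fun _ => Y 0) continuousOn_const hf).add
      (hC.memLp (memLp_integrableOn_Ioo hf))
  -- Both sides have zero initial values and the second derivative `-V₀ f`.
  refine (hY.formulaV0 hk hkY (hasU_formulaA hf)).eq_of_ae (hasU_formulaA hm) ?_ ?_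
    (Filter.Eventually.of_forall fun t => ?_) hx
  · simp [formulaV0, formulaA_zero, act_zero]
  · simp [formulaV0, formulaA_zero, act_zero]
  · simp only [formulaA_zero, intervalIntegral.integral_same, neg_zero, act_zero, zero_add,
      formulaV0, act_neg, intervalIntegral.integral_neg]
    abel

/-- The convolution operator maps `𝒰` onto `𝒰`. -/
theorem exists_preimage_formulaV0 {Y Y' Y'' k : ℝ → Matrix (Fin p) (Fin p) ℂ} (hY : HasU r Y Y' Y'')
    (hk : Continuous k) (hkY : ∀ x ∈ Icc 0 r, k x = Y' x) (hb : IsUnit (Y 0))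
    {T : L2 p r ≃L[ℂ] L2 p r} (hT : Represents (T : L2 p r →L[ℂ] L2 p r) (formulaV0 (Y 0) k))
    {f f' f'' : ℝ → EuclideanSpace ℂ (Fin p)} (hf : HasU r f f' f'') :
    ∃ y y' y'', HasU r y y' y'' ∧ ∀ x ∈ Icc 0 r, formulaV0 (Y 0) k y x = f x := by
  obtain ⟨c, hc⟩ := hb.exists_right_inv
  -- The initial values are forced by `(V₀ y)(0) = Y(0) y(0)` and `(V₀ y)'(0) = Y'(0) y(0) + Y(0)
  -- y'(0)`, where `c` inverts `Y(0)`. The second derivative is then found in `L₂` from `V₀ y'' =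
  -- f'' - Y'' y₀ - Y' y₁`.
  set y₀ := act c (f 0)
  set y₁ := act c (f' 0 - act (Y' 0) y₀)
  have hg : MemLp (fun x => f'' x - (act (Y'' x) y₀ + act (Y' x) y₁)) 2
      (volume.restrict (Ioo 0 r)) :=
    hf.2.1.sub ((memLp_bilin_left (actR (l := Fin p) (m := Fin p)) (g := fun _ => y₀) hY.2.1
      continuousOn_const).add (memLp_bilin_left (actR (l := Fin p) (m := Fin p)) (g := fun _ => y₁)
        (memLp_of_continuousOn hY.hasIntDeriv_deriv.continuousOn) continuousOn_const))
  set y'' : L2 p r := T.symm (toL2 r fun x => f'' x - (act (Y'' x) y₀ + act (Y' x) y₁)) with hy''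
  have e : formulaV0 (Y 0) k y'' =ᵐ[volume.restrict (Ioo 0 r)]
      fun x => f'' x - (act (Y'' x) y₀ + act (Y' x) y₁) := by
    have h1 : T y'' = toL2 r fun x => f'' x - (act (Y'' x) y₀ + act (Y' x) y₁) :=
      T.apply_symm_apply _
    have h2 := hT y''
    rw [ContinuousLinearEquiv.coe_coe, h1] at h2
    exact Filter.EventuallyEq.trans (Filter.EventuallyEq.symm h2) (toL2_coe hg)
  obtain ⟨y, y', h0, h1, hy⟩ := exists_hasU_of_memLp y₀ y₁ (Lp.memLp y'')
  refine ⟨y, y', y'', hy, fun x hx => ?_⟩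
  refine (hY.formulaV0 hk hkY hy).eq_of_ae hf ?_ ?_ ?_ hx
  · simp only [formulaV0, intervalIntegral.integral_same, add_zero, h0, y₀, act_act, hc, one_act]
  · simp only [formulaV0, intervalIntegral.integral_same, add_zero, h0, h1, y₁]
    rw [act_act (Y 0) c, hc, one_act]
    abel
  · filter_upwards [e] with t ht
    rw [ht, h0, h1]
    abel

/-- The convolution operator maps the constant functions to the columns of `Y`. -/
theorem formulaV0_const {Y Y' Y'' k : ℝ → Matrix (Fin p) (Fin p) ℂ} (hY : HasU r Y Y' Y'')
    (hk : Continuous k) (hkY : ∀ x ∈ Icc 0 r, k x = Y' x) (l : Fin p) {x : ℝ} (hx : x ∈ Icc 0 r) :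
    formulaV0 (Y 0) k (fun _ => colE 1 l) x = colE (Y x) l := by
  have hc : HasU r (fun _ => colE (1 : Matrix (Fin p) (Fin p) ℂ) l) (fun _ => 0) fun _ => 0 :=
    (HasIntDeriv.const r _).hasU (HasIntDeriv.const r 0) MemLp.zero
  refine (hY.formulaV0 hk hkY hc).hasIntDeriv.eq_of_ae (hY.colE l).hasIntDeriv ?_
    (Filter.Eventually.of_forall fun t => ?_) hx
  · simp only [formulaV0, intervalIntegral.integral_same, add_zero]
    exact (colE_eq_act _ _).symm
  · simp only [formulaV0, act_zero, intervalIntegral.integral_zero, add_zero]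
    exact (colE_eq_act _ _).symm

end Classes

/-! ### The operator `K` and the block `β₂`. -/

section Operators

variable {m₁ m₂ : ℕ} {r : ℝ} {β β' β'' : ℝ → Matrix (Fin m₂) (Fin m₁ ⊕ Fin m₂) ℂ}

theorem respectsAE_formulaK : RespectsAE r (formulaK β) := fun f g h =>
  ae_of_Icc fun x hx => by
    rw [formulaK, formulaK, integral_congr_of_ae_Ioo (r := r) (g := fun t => act (β t)ᴴ (g t)) ?_
      (left_mem_Icc.2 (hx.1.trans hx.2)) hx]
    filter_upwards [h] with t ht
    rw [ht]

theorem respectsAE_transformation (W : ℝ → ℝ → Matrix (Fin m₂) (Fin m₂) ℂ) :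
    RespectsAE r (transformation β' W) := fun f g h => by
  filter_upwards [h, respectsAE_volterra (k := W) f g h] with x h1 h2
  rw [transformation, transformation, h1, h2]

theorem exists_represents_formulaK (hr : 0 ≤ r) (hβ : ContinuousOn β (Icc 0 r)) :
    ∃ K : L2 m₂ r →L[ℂ] L2 m₂ r, Represents K (formulaK β) := by
  obtain ⟨B, hB, hBβ⟩ := exists_continuous_extension hr hβ
  have hc : Continuous (Function.uncurry fun x t : ℝ =>
      Complex.I • (B x * jMat m₁ m₂ * (B t)ᴴ)) := by
    have h1 : Continuous fun z : ℝ × ℝ => B z.1 * jMat m₁ m₂ :=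
      (mulL (l := Fin m₂) (m := Fin m₁ ⊕ Fin m₂) (n := Fin m₁ ⊕ Fin m₂)).continuous₂.comp
        ((hB.comp continuous_fst).prodMk continuous_const)
    have h2 : Continuous fun z : ℝ × ℝ => (B z.2)ᴴ :=
      (conjTransposeR (l := Fin m₂) (m := Fin m₁ ⊕ Fin m₂)).continuous.comp (hB.comp continuous_snd)
    exact ((mulL (l := Fin m₂) (m := Fin m₁ ⊕ Fin m₂) (n := Fin m₂)).continuous₂.comp
      (h1.prodMk h2)).const_smul Complex.I
  obtain ⟨C, hC⟩ := exists_isBddKernel_of_continuous hc r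
  obtain ⟨K, hK⟩ := hC.exists_represents_volterra
  refine ⟨K, hK.congr fun f x hx => ?_⟩
  have h0 : (0 : ℝ) ∈ Icc 0 r := left_mem_Icc.2 hr
  have hβc : ContinuousOn (fun t => (β t)ᴴ) (Icc 0 r) :=
    (conjTransposeR (l := Fin m₂) (m := Fin m₁ ⊕ Fin m₂)).continuous.comp_continuousOn hβ
  have hi := intervalIntegrable_of_Ioo
    (memLp_integrableOn_Ioo (memLp_bilin_right actR hβc (Lp.memLp f))) h0 hx
  have h1 := (actR (Complex.I • (β x * jMat m₁ m₂))).intervalIntegral_comp_comm hi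
  simp only [actR_apply, act_act] at h1
  rw [formulaK, ← smul_act, ← h1, volterra]
  refine intervalIntegral.integral_congr fun t ht => ?_
  rw [uIcc_of_le hx.1] at ht
  simp only [hBβ x hx, hBβ t ⟨ht.1, ht.2.trans hx.2⟩, Matrix.smul_mul]

theorem HasU.block2 (hβ : HasU r β β' β'') :
    HasU r (block2 β) (CanonicalSystem.block2 β') (CanonicalSystem.block2 β'') :=
  hβ.clm (LinearMap.toContinuousLinearMap
    { toFun := fun M : Matrix (Fin m₂) (Fin m₁ ⊕ Fin m₂) ℂ => M.toCols₂
      map_add' := fun _ _ => rfl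
      map_smul' := fun _ _ => rfl })

end Operators

end

end CanonicalSystem

/-- The operators `A`, `K`, `V`, `V₀` are determined by their formulas; the existential quantifiers
say that the formulas do define bounded (for `V` and `V₀`: boundedly invertible) operators. -/
theorem propositionA4 {m₁ m₂ : ℕ} {r : ℝ} (hr : 0 < r)
    (β β' β'' : ℝ → Matrix (Fin m₂) (Fin m₁ ⊕ Fin m₂) ℂ)
    (hβ : HasU r β β' β'')
    (hβ0 : ∀ x ∈ Icc 0 r, β x * jMat m₁ m₂ * (β x)ᴴ = 0)
    (hβ1 : ∀ x ∈ Icc 0 r, β' x * jMat m₁ m₂ * (β x)ᴴ = Complex.I • 1) :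
    ∃ (A K : L2 m₂ r →L[ℂ] L2 m₂ r) (V V₀ E : L2 m₂ r ≃L[ℂ] L2 m₂ r),
      Represents A formulaA ∧
      Represents K (formulaK β) ∧
      IsTransformationPair r β β' β'' V V₀ ∧
      (∀ f, E f = V (V₀ f)) ∧
      (∀ f, K f = E (A (E.symm f))) ∧
      (∀ k, E.symm (toL2 r fun x => colE (block2 β x) k) =
        toL2 r fun _ => colE (1 : Matrix (Fin m₂) (Fin m₂) ℂ) k) ∧
      MapsU (E : L2 m₂ r →L[ℂ] L2 m₂ r) ∧
      MapsU (E.symm : L2 m₂ r →L[ℂ] L2 m₂ r) := by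
  have h0 : (0 : ℝ) ∈ Icc 0 r := left_mem_Icc.2 hr.le
  obtain ⟨A, hA⟩ := exists_represents_formulaA m₂ r
  obtain ⟨K, hK⟩ := exists_represents_formulaK hr.le hβ.continuousOn
  obtain ⟨W, C, hk, hWV, hW⟩ := exists_kernel hr.le hβ.memLp_u4Fun hβ.memLp_h1Fun hβ.memLp_h2Fun
  replace hW : IsTransformationKernel r β β' β'' W := hW
  obtain ⟨V, hV⟩ := exists_equiv_represents hβ.continuousOn_uFun
    (hβ.hasU_uFun.clm conjTransposeR).hasIntDeriv.continuousOn
    (fun x hx => (hβ.uFun_unitary hx).2) hk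
  replace hV : Represents (V : L2 m₂ r →L[ℂ] L2 m₂ r) (transformation β' W) := hV
  have hcV := respectsAE_transformation (r := r) (β' := β') W
  have hpre := fun f f' f'' (hf : HasU r f f' f'') => hW.exists_preimage hβ hk hf
  -- The columns of `β₂` have preimages of class `𝒰` under the formula for `V`; they are assembled
  -- into `Y = V⁻¹ β₂`.
  choose y y' y'' hy hye using fun k => hpre _ _ _ (hβ.block2.colE k)
  obtain ⟨Y, Y', Y'', hY, hYy⟩ := exists_hasU_of_columns hy
  have hVY : ∀ k, V (toL2 r fun x => colE (Y x) k) = toL2 r fun x => colE (block2 β x) k :=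
    fun k => hV.toL2_apply hcV (hY.colE k).memLp fun x hx => by
      simp only [hYy]
      exact hye k x hx
  -- At `x = 0` the integral vanishes and `u(0) = I`, so `V` does not change the initial value.
  have hY0 : Y 0 = block2 β 0 := by
    ext i k
    have h1 := hye k 0 h0
    have h2 : uFun β' 0 = 1 := evolution_zero
    rw [transformation, h2, one_act, volterra, intervalIntegral.integral_same, add_zero, ← hYy]
      at h1
    exact congr_arg (fun v : EuclideanSpace ℂ (Fin m₂) => v i) h1
  have hb : IsUnit (Y 0) := hY0 ▸ isUnit_block2 (hβ0 0 h0) (hβ1 0 h0)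
  obtain ⟨c, hc⟩ := hb.exists_right_inv
  obtain ⟨k, hkc, hkY⟩ := exists_continuous_extension hr.le hY.hasIntDeriv_deriv.continuousOn
  -- `V₀` is factored as `Y(0) (1 + T)`, where `T` is the Volterra operator with kernel `c k(x - t)`
  -- and `c` inverts `Y(0)`.
  obtain ⟨C₀, hk₀⟩ := exists_isBddKernel_of_continuous (k := fun x t => c * k (x - t)) (by
    change Continuous fun z : ℝ × ℝ => c * k (z.1 - z.2)
    exact (mulL c).continuous.comp (hkc.comp (continuous_fst.sub continuous_snd))) r
  obtain ⟨C₁, hk₁⟩ := exists_isBddKernel_convolution hkc r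
  obtain ⟨V₀, hV₀⟩ := exists_equiv_represents (M := fun _ => Y 0) (N := fun _ => c)
    continuousOn_const continuousOn_const (fun _ _ => hc) hk₀
  replace hV₀ : Represents (V₀ : L2 m₂ r →L[ℂ] L2 m₂ r) (formulaV0 (Y 0) k) :=
    hV₀.congr fun f x hx => by
      have h1 := (actR c).intervalIntegral_comp_comm (hk₁.intervalIntegrable f.integrableOn hx)
      simp only [actR_apply, act_act] at h1
      rw [act_add, volterra, h1, act_act, hc, one_act, formulaV0]
  have hcV₀ := respectsAE_formulaV0 (r := r) (Y 0) k
  refine ⟨A, K, V, V₀, V₀.trans V, hA, hK, ⟨hV.congr fun f x hx => ?_, Y, Y', Y'', hY,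
    fun l => ?_, hY0 ▸ hV₀.congr fun f x hx => ?_⟩, fun f => rfl, fun f => ?_, fun l => ?_, ?_, ?_⟩
  · rw [transformation, formulaV, volterra]
    congr 2
    refine intervalIntegral.integral_congr fun t ht => ?_
    rw [uIcc_of_le hx.1] at ht
    simp only [hWV x t ht.1 ht.2 hx.2]
    rfl
  · rw [ContinuousLinearEquiv.symm_apply_eq, hVY]
  · rw [formulaV0, formulaV0]
    congr 1
    refine intervalIntegral.integral_congr fun t ht => ?_
    rw [uIcc_of_le hx.1] at ht
    simp only [hkY (x - t) ⟨sub_nonneg.2 ht.2, by linarith [ht.1, hx.2]⟩]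
  · have hAm : ∀ g : L2 m₂ r, MemLp (formulaA g) 2 (volume.restrict (Ioo 0 r)) := fun g =>
      (hasU_formulaA (Lp.memLp g)).memLp
    have hAe : ∀ g : L2 m₂ r, toL2 r (formulaA g) = A g := fun g => toL2_eq (hA g)
    have hKV : ∀ g, K (V g) = V (A g) := by
      intro g
      rw [← hAe g]
      refine Lp.ext ?_
      filter_upwards [hK (V g), respectsAE_formulaK _ _ (hV g), hV.apply_toL2 hcV (hAm g),
        ae_of_Icc fun x hx => hW.intertwines hβ hβ0 hβ1 hk (Lp.memLp g) hx] with x e1 e2 e3 e4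
      exact e1.trans (e2.trans (e4.symm.trans e3.symm))
    have hVA : ∀ g, V₀ (A g) = A (V₀ g) := by
      intro g
      rw [← hAe g]
      refine Lp.ext ?_
      filter_upwards [hA (V₀ g), respectsAE_formulaA _ _ (hV₀ g), hV₀.apply_toL2 hcV₀ (hAm g),
        ae_of_Icc fun x hx => formulaV0_formulaA hY hkc hkY (Lp.memLp g) hx] with x e1 e2 e3 e4
      exact e3.trans (e4.trans (e2.symm.trans e1.symm))
    -- On the image of `E` the claim reads `K V V₀ g = V A V₀ g = V V₀ A g`.
    obtain ⟨g, rfl⟩ := (V₀.trans V).surjective f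
    rw [ContinuousLinearEquiv.symm_apply_apply, ContinuousLinearEquiv.trans_apply,
      ContinuousLinearEquiv.trans_apply, hKV, hVA]
  -- Equivalently `V V₀ I = β₂`; as `β₂ = V Y`, it is enough that `V₀` sends the constant columns of
  -- `I` to those of `Y`.
  · rw [ContinuousLinearEquiv.symm_apply_eq, ContinuousLinearEquiv.trans_apply, ← hVY]
    congr 1
    exact (hV₀.toL2_apply hcV₀ (memLp_const _) fun x hx => formulaV0_const hY hkc hkY l hx).symm
  · exact (hV.mapsU hcV fun f f' f'' hf => hW.hasU hβ hf).comp
      (hV₀.mapsU hcV₀ fun f f' f'' hf => ⟨_, _, hY.formulaV0 hkc hkY hf⟩)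
  · exact (hV₀.mapsU_symm hcV₀ fun f f' f'' hf =>
      exists_preimage_formulaV0 hY hkc hkY hb hV₀ hf).comp (hV.mapsU_symm hcV hpre)
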